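/- **Setting.** Identify $\mathbb R^2$ with $\mathbb C$. Let $\overline{\mathcal M}$ be the set of signed real regular Borel (i.e. signed Radon) measures on $\mathbb R^2$ and $\mathcal M\subset\overline{\mathcal M}$ the set of those with finite total variation. For $\mu\in\overline{\mathcal M}$ let $\mu^*$, the *reduction* of $\mu$, be the unique measure in $\overline{\mathcal M}$ with $\mu-\mu^*=2\pi\sum_j n_j\delta_{z_j}$ ($n_j\in\mathbb Z\setminus\{0\}$, the $z_j$ distinct and without accumulation point) and $\mu^*(\{x\})\in[-\pi,\pi)$ for all $x$. For a real $h\in L^1_{loc}(\mathbb R^2)$ with $\Delta h=\mu^*$ (in the sense of distributions), let $H_h$ be the self-adjoint operator on $L^2(\mathbb R^2,\mathbb C^2)$ associated with the closed form $$\pi^h(\psi,\xi)=4\int\overline{\partial_{\bar z}(e^{-h}\psi_+)}\,\partial_{\bar z}(e^{-h}\xi_+)\,e^{2h}+4\int\overline{\partial_{z}(e^{h}\psi_-)}\,\partial_{z}(e^{h}\xi_-)\,e^{-2h}$$ on its maximal domain $\{\psi=(\psi_+,\psi_-)\in L^2(\mathbb R^2,\mathbb C^2):\pi^h(\psi,\psi)<\infty\}$,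 the derivatives being taken in the sense of distributions. A *Pauli operator with magnetic field $\mu$* is any operator $H=U^*H_hU$ with such an $h$, where $U\psi=\frac{L}{|L|}\psi$, $L=F\,\overline G$, and $F$, $G$ are entire functions such that the zeros of $F$ are exactly the $z_j$ with $n_j>0$, with multiplicity $n_j$, and those of $G$ are exactly the $z_j$ with $n_j<0$, with multiplicity $-n_j$. **Statement.** Suppose that $\mu\in\overline{\mathcal M}$ can be written as $\mu=\mu_{rad}+\widetilde\mu$, where $\widetilde\mu\in\mathcal M$ and $\mu_{rad}$ is invariant under all rotations about the origin, with $\mu_{rad}(\{0\})=0$. Put $\Phi(R):=\frac1{2\pi}\mu_{rad}(\{|x|\le R\})$ and assume that $\Phi_{rad}:=\lim_{R\to\infty}\Phi(R)$ exists in $[-\infty,\infty]$ and that $h_{rad}(x):=\Phi(|x|)\log|x|$ satisfies $\nabla h_{rad}\in L^\infty_{loc}$ (distributional gradient). Let $$\Phi:=\Phi_{rad}+\frac1{2\pi}\int\widetilde\mu^*(dx)\in[-\infty,\infty].$$ Then, for every Pauli operator $H$ with magnetic field $\mu$, with $[a]$ the integer part of $a$ and $[\infty]=\infty$: 1. if $\Phi\notin\mathbb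 Z$ (in particular if $\Phi=\pm\infty$) or $\Phi=0$, then $\dim\operatorname{Ker}H=[|\Phi|]$; 2. if $\Phi\in\mathbb Z\setminus\{0\}$, then $\dim\operatorname{Ker}H$ is $|\Phi|$ or $|\Phi|-1$; if, additionally, $\mu^*$ has compact support or has a definite sign ($\mu^*\ge0$ or $\mu^*\le0$), then $\dim\operatorname{Ker}H=|\Phi|-1$; 3. in all cases $\operatorname{Ker}H\subset\{\psi:\sigma_3\psi=-s\psi\}$, where $\sigma_3=\operatorname{diag}(1,-1)$ and $s=\operatorname{sign}(\Phi)$ (with $\operatorname{sign}(0)=0$). Moreover, both possibilities in 2 do occur: for every integer $n\ne0$ there are measures $\mu$ as above with $\Phi=n$ that have a Pauli operator with kernel of dimension $|n|$, and others that have one with kernel of dimension $|n|-1$. -/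

import Mathlib

open MeasureTheory Set Filter Topology
open scoped ContDiff

namespace PauliMeasure

/-! The plane `ℝ²` is identified with `ℂ` through `x = (x₁, x₂) ↔ z = x₁ + i x₂`; `volume` on `ℂ` is
Lebesgue measure. -/

/-! ### Signed Radon measures -/

/-- A signed real Radon measure on the plane (the class `M̄`), given by its Jordan decomposition: two
mutually singular positive Borel measures, each finite on compact sets. -/
@[ext]
structure SignedRadon where
  pos : Measure ℂ
  neg : Measure ℂ
  locFin_pos : IsLocallyFiniteMeasure pos
  locFin_neg : IsLocallyFiniteMeasure neg
  singular : pos.MutuallySingular neg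

namespace SignedRadon

/-- The value `μ(A)`, meaningful when `|μ|(A) < ∞`, in particular for every bounded Borel set `A`. -/
noncomputable def val (μ : SignedRadon) (A : Set ℂ) : ℝ := μ.pos.real A - μ.neg.real A

/-- The total variation measure `|μ|`. -/
noncomputable def variation (μ : SignedRadon) : Measure ℂ := μ.pos + μ.neg

/-- `μ` has finite total variation (`μ ∈ M`). -/
def FiniteVariation (μ : SignedRadon) : Prop := μ.variation univ < ⊤

/-- `μ = a + b`. -/
def IsSum (μ a b : SignedRadon) : Prop :=
  ∀ A : Set ℂ, MeasurableSet A → Bornology.IsBounded A → μ.val A = a.val A + b.val A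

/-- Invariance under every rotation about the origin. -/
def RotationInvariant (μ : SignedRadon) : Prop :=
  ∀ c : ℂ, ‖c‖ = 1 →
    μ.pos.map (fun z => c * z) = μ.pos ∧ μ.neg.map (fun z => c * z) = μ.neg

/-- The total flux divided by `2π` of a measure of finite total variation. -/
noncomputable def flux (μ : SignedRadon) : ℝ := μ.val univ / (2 * Real.pi)

/-- The flux divided by `2π` through the closed disc of radius `R` about the origin. -/
noncomputable def discFlux (μ : SignedRadon) (R : ℝ) : ℝ :=
  μ.val (Metric.closedBall 0 R) / (2 * Real.pi)

/-- `μ - ν = 2π ∑ⱼ nⱼ δ_{zⱼ}` with `n z ∈ ℤ` the weight at `z`. -/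
def DiffersByIntegerFluxes (μ ν : SignedRadon) (n : ℂ → ℤ) : Prop :=
  ∀ A : Set ℂ, MeasurableSet A → Bornology.IsBounded A →
    {z ∈ A | n z ≠ 0}.Finite ∧
      μ.val A - ν.val A = 2 * Real.pi * ∑ᶠ (z : ℂ) (_ : z ∈ A), (n z : ℝ)

/-- `ν` is the reduction `μ*` of `μ`: it is equivalent to `μ` modulo integer point fluxes
`2π n δ_z`, and all its point masses lie in `[-π, π)`. -/
def IsReduction (μ ν : SignedRadon) : Prop :=
  (∃ n : ℂ → ℤ, μ.DiffersByIntegerFluxes ν n) ∧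
    ∀ z : ℂ, ν.val {z} ∈ Ico (-Real.pi) Real.pi

/-- Compact support. -/
def CompactlySupported (μ : SignedRadon) : Prop :=
  ∃ K : Set ℂ, IsCompact K ∧ μ.variation Kᶜ = 0

/-- `μ ≥ 0` or `μ ≤ 0`. -/
def DefiniteSign (μ : SignedRadon) : Prop := μ.neg = 0 ∨ μ.pos = 0

end SignedRadon

/-! ### Weak derivatives -/

/-- `g` is the distributional derivative of the real function `f` in the direction `v`. -/
def IsWeakDirDeriv (v : ℂ) (f g : ℂ → ℝ) : Prop :=
  LocallyIntegrable f volume ∧ LocallyIntegrable g volume ∧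
    ∀ φ : ℂ → ℝ, ContDiff ℝ ∞ φ → HasCompactSupport φ →
      ∫ z, f z * fderiv ℝ φ z v = - ∫ z, g z * φ z

/-- `∇f ∈ L^∞_loc` in the distributional sense. -/
def HasLocallyBoundedGradient (f : ℂ → ℝ) : Prop :=
  ∃ g₁ g₂ : ℂ → ℝ, IsWeakDirDeriv 1 f g₁ ∧ IsWeakDirDeriv Complex.I f g₂ ∧
    ∀ K : Set ℂ, IsCompact K →
      MemLp g₁ ⊤ (volume.restrict K) ∧ MemLp g₂ ⊤ (volume.restrict K)

/-- `h ∈ L¹_loc` and `Δh = μ` in the distributional sense. -/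
def IsGeneratingPotential (h : ℂ → ℝ) (μ : SignedRadon) : Prop :=
  LocallyIntegrable h volume ∧
    ∀ φ : ℂ → ℝ, ContDiff ℝ ∞ φ → HasCompactSupport φ →
      ∫ z, h z * Laplacian.laplacian φ z = (∫ z, φ z ∂μ.pos) - ∫ z, φ z ∂μ.neg

/-- `∂_z̄ φ = (∂₁φ + i ∂₂φ) / 2` for smooth `φ`. -/
noncomputable def dbar (φ : ℂ → ℂ) (z : ℂ) : ℂ :=
  (fderiv ℝ φ z 1 + Complex.I * fderiv ℝ φ z Complex.I) / 2

/-- `∂_z φ = (∂₁φ - i ∂₂φ) / 2` for smooth `φ`. -/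
noncomputable def dz (φ : ℂ → ℂ) (z : ℂ) : ℂ :=
  (fderiv ℝ φ z 1 - Complex.I * fderiv ℝ φ z Complex.I) / 2

/-- `u` represents the distribution `∂_z̄ f`. -/
def IsWeakDbar (f u : ℂ → ℂ) : Prop :=
  LocallyIntegrable f volume ∧ LocallyIntegrable u volume ∧
    ∀ φ : ℂ → ℂ, ContDiff ℝ ∞ φ → HasCompactSupport φ →
      ∫ z, f z * dbar φ z = - ∫ z, u z * φ z

/-- `u` represents the distribution `∂_z f`. -/
def IsWeakDz (f u : ℂ → ℂ) : Prop :=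
  LocallyIntegrable f volume ∧ LocallyIntegrable u volume ∧
    ∀ φ : ℂ → ℂ, ContDiff ℝ ∞ φ → HasCompactSupport φ →
      ∫ z, f z * dz φ z = - ∫ z, u z * φ z

open Classical in
/-- The function representing `∂_z̄ f` (unique almost everywhere), when there is one. -/
noncomputable def weakDbar (f : ℂ → ℂ) : ℂ → ℂ :=
  if hf : ∃ u, IsWeakDbar f u then hf.choose else 0

open Classical in
/-- The function representing `∂_z f` (unique almost everywhere), when there is one. -/
noncomputable def weakDz (f : ℂ → ℂ) : ℂ → ℂ :=
  if hf : ∃ u, IsWeakDz f u then hf.choose else 0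

/-! ### The Pauli form and the Pauli operators -/

/-- The spinor space `L²(ℝ², ℂ²)`; component `0` is `ψ₊`, component `1` is `ψ₋`. -/
abbrev Spinor : Type := Lp (EuclideanSpace ℂ (Fin 2)) 2 (volume : Measure ℂ)

/-- `e^{-h} ψ₊`. -/
noncomputable def reducedUp (h : ℂ → ℝ) (ψ : Spinor) (z : ℂ) : ℂ :=
  (Real.exp (-h z) : ℂ) * ψ z 0

/-- `e^{h} ψ₋`. -/
noncomputable def reducedDown (h : ℂ → ℝ) (ψ : Spinor) (z : ℂ) : ℂ :=
  (Real.exp (h z) : ℂ) * ψ z 1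

/-- The maximal form domain `D(π^h)`: the distributions `∂_z̄(e^{-h}ψ₊)` and `∂_z(e^{h}ψ₋)` are
functions lying in `L²(e^{2h}dx)` and in `L²(e^{-2h}dx)` respectively. -/
def formDomain (h : ℂ → ℝ) : Set Spinor :=
  {ψ | IsWeakDbar (reducedUp h ψ) (weakDbar (reducedUp h ψ)) ∧
    IsWeakDz (reducedDown h ψ) (weakDz (reducedDown h ψ)) ∧
    MemLp (fun z => (Real.exp (h z) : ℂ) * weakDbar (reducedUp h ψ) z) 2 volume ∧
    MemLp (fun z => (Real.exp (-h z) : ℂ) * weakDz (reducedDown h ψ) z) 2 volume}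

/-- The form `π^h(ψ, ξ)`, conjugate linear in `ψ`. -/
noncomputable def pauliForm (h : ℂ → ℝ) (ψ ξ : Spinor) : ℂ :=
  4 * (∫ z, (starRingEnd ℂ) (weakDbar (reducedUp h ψ) z) * weakDbar (reducedUp h ξ) z *
      (Real.exp (2 * h z) : ℂ)) +
  4 * ∫ z, (starRingEnd ℂ) (weakDz (reducedDown h ψ) z) * weakDz (reducedDown h ξ) z *
      (Real.exp (-2 * h z) : ℂ)

/-- `H` is the operator `H_h` associated with the form `π^h`: `ψ ∈ D(H)` and `Hψ = η` if and only if
`ψ ∈ D(π^h)` and `π^h(ψ, ξ) = (η, ξ)` for all `ξ ∈ D(π^h)`. -/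
def IsFormOperator (h : ℂ → ℝ) (H : Spinor →ₗ.[ℂ] Spinor) : Prop :=
  ∀ ψ η : Spinor, (ψ, η) ∈ H.graph ↔
    ψ ∈ formDomain h ∧ ∀ ξ ∈ formDomain h, pauliForm h ψ ξ = inner ℂ η ξ

/-- `L = F · conj G`, where `F`, `G` are entire and, writing `μ - ν = 2π ∑ⱼ nⱼ δ_{zⱼ}`, the zeros of
`F` are exactly the `zⱼ` with `nⱼ > 0`, of multiplicity `nⱼ`, and the zeros of `G` are exactly the
`zⱼ` with `nⱼ < 0`, of multiplicity `-nⱼ`. -/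
def IsGaugeFactor (μ ν : SignedRadon) (L : ℂ → ℂ) : Prop :=
  ∃ (n : ℂ → ℤ) (F G : ℂ → ℂ), μ.DiffersByIntegerFluxes ν n ∧
    Differentiable ℂ F ∧ Differentiable ℂ G ∧
    (∀ z, analyticOrderAt F z = ((n z).toNat : ℕ∞)) ∧
    (∀ z, analyticOrderAt G z = ((-n z).toNat : ℕ∞)) ∧
    L = fun z => F z * (starRingEnd ℂ) (G z)

/-- `H` is a Pauli operator with magnetic field `μ`: `H = U⋆ H_h U`, where `h` generates the reduced
field `μ*` and `U` is the gauge transformation, multiplication by `L / |L|`, that removes the integer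
point fluxes. -/
def IsPauliOperator (μ : SignedRadon) (H : Spinor →ₗ.[ℂ] Spinor) : Prop :=
  ∃ (ν : SignedRadon) (h : ℂ → ℝ) (H₀ : Spinor →ₗ.[ℂ] Spinor) (L : ℂ → ℂ)
    (U : Spinor ≃ₗᵢ[ℂ] Spinor),
    μ.IsReduction ν ∧ IsGeneratingPotential h ν ∧ IsFormOperator h H₀ ∧ IsGaugeFactor μ ν L ∧
    (∀ ψ : Spinor, ∀ᵐ z, U ψ z = (L z / (‖L z‖ : ℂ)) • ψ z) ∧
    ∀ ψ η : Spinor, (ψ, η) ∈ H.graph ↔ (U ψ, U η) ∈ H₀.graph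

/-- The dimension of `Ker H`, with value `⊤` when it is infinite. -/
noncomputable def kernelDim (H : Spinor →ₗ.[ℂ] Spinor) : ℕ∞ :=
  Cardinal.toENat (Module.rank ℂ (LinearMap.ker H.toFun))

/-- The Pauli matrix `σ₃`. -/
def sigma3 : Matrix (Fin 2) (Fin 2) ℂ := !![1, 0; 0, -1]

/-- `Ker H ⊆ {ψ : σ₃ψ = -sψ}`. -/
def KernelHasSpin (H : Spinor →ₗ.[ℂ] Spinor) (s : ℂ) : Prop :=
  ∀ ψ : H.domain, H ψ = 0 →
    ∀ᵐ z, sigma3.mulVec ((ψ : Spinor) z).ofLp = (-s) • ((ψ : Spinor) z).ofLp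

/-! ### The class of magnetic fields -/

/-- `μ = μrad + μt` with `μt` of finite total variation and `μrad` rotationally symmetric without mass
at the origin, such that the flux of `μrad` through the disc of radius `R` has a limit `Φrad` in
`[-∞, ∞]` and `x ↦ Φ(|x|) log |x|` has a locally bounded gradient. -/
structure RadialDecomposition (μ μrad μt : SignedRadon) (Φrad : EReal) : Prop where
  isSum : μ.IsSum μrad μt
  finite : μt.FiniteVariation
  radial : μrad.RotationInvariant
  noAtomZero : μrad.val {0} = 0
  tendsto : Tendsto (fun R : ℝ => (μrad.discFlux R : EReal)) atTop (𝓝 Φrad)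
  gradient : HasLocallyBoundedGradient (fun x : ℂ => μrad.discFlux ‖x‖ * Real.log ‖x‖)

/-- `μ` admits a decomposition as above for which `Φ = Φrad + (2π)⁻¹ ∫ μt*`. -/
def HasRegularFlux (μ : SignedRadon) (Φ : EReal) : Prop :=
  ∃ (μrad μt νt : SignedRadon) (Φrad : EReal),
    RadialDecomposition μ μrad μt Φrad ∧ μt.IsReduction νt ∧ Φ = Φrad + (νt.flux : EReal)

end PauliMeasure

open PauliMeasure

-- Testing the form at a kernel element shows that `e^{-h}ψ₊` is annihilated by `∂_z̄` and `e^{h}ψ₋`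
-- by `∂_z`. By Weyl's lemma the first is an entire function of `z` and the second an entire
-- function of `z̄`. Up to the unitary `U`, the kernel is therefore a product of two spaces of
-- entire functions: those with `e^h f ∈ L²`, and the same space for the potential `-h(z̄)`
-- (`mem_range_zeroMode_iff`, `kernelDim_eq`).
--
-- The dimensions depend only on `μ*`. Two generating potentials differ by `Re E` with `E` entire,
-- and multiplication by `exp E` identifies the two spaces (`dimHol_congr`,
-- `dimHol_eq_of_generating`), so one well chosen potential suffices. The radial measure has no
-- atoms, hence `μ*` is `μrad` plus the reduction of the finite part. The potential `fieldPot` adds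
-- a radial function whose radial derivative is the flux through the disc divided by `r` and the
-- logarithmic potential of a finite measure.
--
-- This potential behaves like `Φ log|x|` in the integrated sense of `RegularWeight`: `(1+|x|)^s
-- e^{±h} ∈ L²` whenever `s ± Φ < -1`. At infinity this is a count of masses. Locally, Jensen's
-- inequality bounds the exponential of a potential of small mass by averages of `|x-y|^{-p}`, and
-- the bound `π` on the atoms of `μ*` keeps `p < 2`.
--
-- A regular weight decides every power of `z` except one. The power `z^k` is admissible if `k + Φ <
-- -1`. If `k + Φ > -1`, Cauchy's estimate and the Cauchy–Schwarz inequality against the weight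
-- `e^{-h}` force the `k`-th Taylor coefficient to vanish. So `Φ ≥ 0` leaves no upper component, `Φ
-- ≤ 0` no lower one, and the count is `[|Φ|]` unless `Φ` is a nonzero integer, when one critical
-- power stays undecided. If `μ*` has compact support or a definite sign, a pointwise lower bound on
-- the weight makes the norm of the critical power diverge logarithmically. The potential `(n/2)
-- log(1+|z|²)` realises this case, and adding `sign(n) log(1 + log(1+|z|²))`, which carries no
-- flux, makes the critical power square integrable.

namespace PauliMeasure

-- Mollification and Weyl's lemma for the Laplacian and for `∂_z̄`.

section Weyl

open ContinuousLinearMap Convolution InnerProductSpace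

variable {F : Type*} [NormedAddCommGroup F] [NormedSpace ℝ F]

lemma contDiff_two {φ : ℂ → F} (hφ : ContDiff ℝ ∞ φ) : ContDiff ℝ 2 φ :=
  contDiff_infty.1 hφ 2

lemma laplacian_eq_fderiv {f : ℂ → F} {x : ℂ} (hf : ContDiff ℝ 2 f) :
    Laplacian.laplacian f x = fderiv ℝ (fun y => fderiv ℝ f y 1) x 1
      + fderiv ℝ (fun y => fderiv ℝ f y Complex.I) x Complex.I := by
  have h1 : DifferentiableAt ℝ (fderiv ℝ f) x :=
    (hf.fderiv_right (m := 1) (by norm_num)).differentiable (by norm_num) x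
  rw [laplacian_eq_iteratedFDeriv_complexPlane]
  simp only [iteratedFDeriv_two_apply]
  rw [fderiv_clm_apply h1 (by fun_prop), fderiv_clm_apply h1 (by fun_prop)]
  simp

lemma contDiff_fderiv_apply {φ : ℂ → F} (hφ : ContDiff ℝ ∞ φ) (v : ℂ) :
    ContDiff ℝ ∞ (fun t => fderiv ℝ φ t v) :=
  (hφ.fderiv_right (m := ∞) (by simp)).clm_apply contDiff_const

lemma continuous_laplacian {φ : ℂ → F} (hφ : ContDiff ℝ ∞ φ) :
    Continuous (Laplacian.laplacian φ) := by
  have : Laplacian.laplacian φ = fun x => fderiv ℝ (fun y => fderiv ℝ φ y 1) x 1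
      + fderiv ℝ (fun y => fderiv ℝ φ y Complex.I) x Complex.I := by
    ext x
    exact laplacian_eq_fderiv (contDiff_two hφ)
  rw [this]
  exact (contDiff_fderiv_apply (contDiff_fderiv_apply hφ _) _).continuous.add
    (contDiff_fderiv_apply (contDiff_fderiv_apply hφ _) _).continuous

lemma hasCompactSupport_laplacian {φ : ℂ → F} (hφ : ContDiff ℝ ∞ φ) (hc : HasCompactSupport φ) :
    HasCompactSupport (Laplacian.laplacian φ) := by
  have : Laplacian.laplacian φ = fun x => fderiv ℝ (fun y => fderiv ℝ φ y 1) x 1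
      + fderiv ℝ (fun y => fderiv ℝ φ y Complex.I) x Complex.I := by
    ext x
    exact laplacian_eq_fderiv (contDiff_two hφ)
  rw [this]
  exact ((hc.fderiv_apply ℝ _).fderiv_apply ℝ _).add ((hc.fderiv_apply ℝ _).fderiv_apply ℝ _)

lemma fderiv_comp_const_sub_apply {g : ℂ → F} (hg : ContDiff ℝ ∞ g) (x t v : ℂ) :
    fderiv ℝ (fun s => g (x - s)) t v = - fderiv ℝ g (x - t) v := by
  have h := ((hg.differentiable (by simp)) (x - t)).hasFDerivAt.comp t
    ((hasFDerivAt_id (𝕜 := ℝ) t).const_sub x)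
  have h2 := h.fderiv
  simp only [Function.comp_def] at h2
  rw [h2]; simp

lemma laplacian_comp_const_sub {g : ℂ → F} (hg : ContDiff ℝ ∞ g) (x t : ℂ) :
    Laplacian.laplacian (fun s => g (x - s)) t = Laplacian.laplacian g (x - t) := by
  have h2 : ContDiff ℝ 2 g := contDiff_two hg
  have h3 : ContDiff ℝ 2 (fun s => g (x - s)) := h2.comp (contDiff_const.sub contDiff_id)
  rw [laplacian_eq_fderiv h3, laplacian_eq_fderiv h2]
  simp only [fderiv_comp_const_sub_apply hg]
  have (v : ℂ) : fderiv ℝ (fun s => - fderiv ℝ g (x - s) v) t v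
      = fderiv ℝ (fun s => fderiv ℝ g s v) (x - t) v := by
    rw [fderiv_fun_neg]
    rw [neg_apply, fderiv_comp_const_sub_apply (contDiff_fderiv_apply hg v), neg_neg]
  rw [this, this]

/-- The mollification `φ ⋆ f`. -/
noncomputable abbrev moll (φ : ℂ → ℝ) (f : ℂ → F) : ℂ → F :=
  φ ⋆[lsmul ℝ ℝ, volume] f

lemma moll_apply (φ : ℂ → ℝ) (f : ℂ → F) (x : ℂ) : moll φ f x = ∫ t, φ (x - t) • f t := by
  rw [moll, convolution_eq_swap]; rfl

lemma fderiv_moll {φ : ℂ → ℝ} (hφ : ContDiff ℝ ∞ φ) (hc : HasCompactSupport φ) {f : ℂ → F}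
    (hf : LocallyIntegrable f volume) (x v : ℂ) :
    fderiv ℝ (moll φ f) x v = moll (fun t => fderiv ℝ φ t v) f x := by
  rw [(hc.hasFDerivAt_convolution_left (lsmul ℝ ℝ) (hφ.of_le (by exact_mod_cast le_top)) hf
    x).fderiv]
  rw [moll, convolution, convolution]
  have hint : Integrable (fun t => ((lsmul ℝ ℝ : ℝ →L[ℝ] F →L[ℝ] F).precompL ℂ)
      (fderiv ℝ φ t) (f (x - t))) :=
    (hc.fderiv ℝ).convolutionExists_left _ (hφ.continuous_fderiv (by simp)) hf x
  exact (ContinuousLinearMap.integral_apply hint v).trans (by simp [precompL_apply])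

lemma contDiff_moll {φ : ℂ → ℝ} (hφ : ContDiff ℝ ∞ φ) (hc : HasCompactSupport φ) {f : ℂ → F}
    (hf : LocallyIntegrable f volume) : ContDiff ℝ ∞ (moll φ f) :=
  hc.contDiff_convolution_left _ hφ hf

/-- All derivatives fall on `φ`, so the Laplacian of the mollification at `y` is `u` tested against
the Laplacian of `s ↦ φ (y - s)`, again a test function. -/
lemma harmonic_moll {φ : ℂ → ℝ} (hφ : ContDiff ℝ ∞ φ) (hc : HasCompactSupport φ) {u : ℂ → ℝ}
    (hu : LocallyIntegrable u volume)
    (h : ∀ φ : ℂ → ℝ, ContDiff ℝ ∞ φ → HasCompactSupport φ →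
      ∫ z, u z * Laplacian.laplacian φ z = 0) :
    HarmonicOnNhd (moll φ u) univ := by
  have h2 : ContDiff ℝ 2 (moll φ u) := contDiff_two (contDiff_moll hφ hc hu)
  intro x _
  refine ⟨h2.contDiffAt, Eventually.of_forall fun y => ?_⟩
  rw [laplacian_eq_fderiv h2]
  simp only [fderiv_moll hφ hc hu]
  rw [fderiv_moll (contDiff_fderiv_apply hφ _) (hc.fderiv_apply ℝ _) hu,
    fderiv_moll (contDiff_fderiv_apply hφ _) (hc.fderiv_apply ℝ _) hu, moll_apply, moll_apply,
    ← integral_add]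
  · have := h (fun s => φ (y - s)) (hφ.comp (contDiff_const.sub contDiff_id))
      (hc.comp_homeomorph (Homeomorph.subLeft y))
    rw [Pi.zero_apply, ← this]
    congr 1; ext t
    rw [laplacian_comp_const_sub hφ, laplacian_eq_fderiv (contDiff_two hφ)]
    simp only [smul_eq_mul]; ring
  all_goals
    refine (HasCompactSupport.convolutionExists_left (lsmul ℝ ℝ)
      ((hc.fderiv_apply ℝ _).fderiv_apply ℝ _) (contDiff_fderiv_apply (contDiff_fderiv_apply hφ _)
        _).continuous hu y).integrable_swap

lemma differentiable_of_dbar_eq_zero {f : ℂ → ℂ} (hf : Differentiable ℝ f)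
    (h : ∀ z, fderiv ℝ f z 1 + Complex.I * fderiv ℝ f z Complex.I = 0) : Differentiable ℂ f := by
  intro z
  rw [differentiableAt_complex_iff_differentiableAt_real]
  refine ⟨hf z, ?_⟩
  have h1 := h z
  have : fderiv ℝ f z 1 = - (Complex.I * fderiv ℝ f z Complex.I) := eq_neg_of_add_eq_zero_left h1
  rw [smul_eq_mul, this, mul_neg, ← mul_assoc, Complex.I_mul_I]; ring

lemma differentiable_moll {φ : ℂ → ℝ} (hφ : ContDiff ℝ ∞ φ) (hc : HasCompactSupport φ) {f : ℂ → ℂ}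
    (hf : LocallyIntegrable f volume)
    (h : ∀ φ : ℂ → ℂ, ContDiff ℝ ∞ φ → HasCompactSupport φ → ∫ z, f z * dbar φ z = 0) :
    Differentiable ℂ (moll φ f) := by
  refine differentiable_of_dbar_eq_zero ((contDiff_moll hφ hc hf).differentiable (by simp))
    fun y => ?_
  rw [fderiv_moll hφ hc hf, fderiv_moll hφ hc hf, moll_apply, moll_apply,
    ← integral_const_mul, ← integral_add]
  · have hφ' : ContDiff ℝ ∞ (fun s => (φ s : ℂ)) := Complex.ofRealCLM.contDiff.comp hφ
    have := h (fun s => (φ (y - s) : ℂ)) (hφ'.comp (contDiff_const.sub contDiff_id))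
      ((hc.comp_homeomorph (Homeomorph.subLeft y)).comp_left (g := fun r : ℝ => (r : ℂ)) (by simp))
    have h3 : ∀ s v, fderiv ℝ (fun s => (φ s : ℂ)) s v = (fderiv ℝ φ s v : ℂ) := fun s v => by
      have := (Complex.ofRealCLM.hasFDerivAt (x := φ s)).comp s
        ((hφ.differentiable (by simp)) s).hasFDerivAt
      have h4 := this.fderiv
      simp only [Function.comp_def, Complex.ofRealCLM_apply] at h4
      rw [h4]; simp
    -- The factor `-2` undoes the `1/2` in `dbar` and the sign produced by the reflection `s ↦ y -
    -- s`.
    have h5 : ∫ t, (-2 : ℂ) * (f t * dbar (fun s => (φ (y - s) : ℂ)) t) = 0 := by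
      rw [integral_const_mul, this, mul_zero]
    rw [← h5]
    congr 1; ext t
    simp only [dbar]
    rw [fderiv_comp_const_sub_apply hφ', fderiv_comp_const_sub_apply hφ', h3, h3]
    simp only [Complex.real_smul]; ring
  · exact (HasCompactSupport.convolutionExists_left (lsmul ℝ ℝ) (hc.fderiv_apply ℝ _)
      (contDiff_fderiv_apply hφ _).continuous hf y).integrable_swap
  · exact (HasCompactSupport.convolutionExists_left (lsmul ℝ ℝ) (hc.fderiv_apply ℝ _)
      (contDiff_fderiv_apply hφ _).continuous hf y).integrable_swap.const_mul _

lemma moll_comm [CompleteSpace F] {ρ φ : ℂ → ℝ} (hρ : Continuous ρ) (hρc : HasCompactSupport ρ)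
    (hφ : Continuous φ)
    (hφc : HasCompactSupport φ) {u : ℂ → F} (hu : LocallyIntegrable u volume) (x : ℂ) :
    moll ρ (moll φ u) x = moll φ (moll ρ u) x := by
  have hun : LocallyIntegrable (fun x => ‖u x‖) volume := fun x => (hu x).norm
  have key : ∀ {ρ φ : ℂ → ℝ}, Continuous ρ → HasCompactSupport ρ → Continuous φ →
      HasCompactSupport φ →
      ((ρ ⋆[mul ℝ ℝ, volume] φ) ⋆[lsmul ℝ ℝ, volume] u) x = moll ρ (moll φ u) x := by
    intro ρ φ hρ hρc hφ hφc
    refine convolution_assoc (mul ℝ ℝ) (lsmul ℝ ℝ) (lsmul ℝ ℝ) (lsmul ℝ ℝ)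
      (fun a b c => mul_smul a b c) hρ.aestronglyMeasurable hφ.aestronglyMeasurable
      hu.aestronglyMeasurable (Eventually.of_forall fun y => ?_)
      (Eventually.of_forall fun y => ?_) ?_
    · exact hρc.convolutionExists_left _ hρ hφ.locallyIntegrable y
    · exact hφc.norm.convolutionExists_left _ hφ.norm hun y
    · exact hρc.norm.convolutionExists_left _ hρ.norm
        (hφc.norm.continuous_convolution_left _ hφ.norm hun).locallyIntegrable x
  rw [← key hρ hρc hφ hφc, ← key hφ hφc hρ hρc]
  congr 1
  rw [← convolution_flip]
  congr 1
  ext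
  simp

/-- Averaging over a circle becomes averaging over the rotation group applied to a fixed point,
which Fubini can exchange with a rotation invariant measure. -/
lemma circleAverage_rotate (f : ℂ → F) (c w : ℂ) :
    Real.circleAverage f c ‖w‖ =
      (2 * Real.pi)⁻¹ • ∫ θ in 0..2 * Real.pi, f (c + circleMap 0 1 θ * w) := by
  rw [Real.circleAverage_eq_integral_add (Complex.arg w)]
  congr 2
  ext θ
  congr 1
  have hw := Complex.norm_mul_exp_arg_mul_I w
  simp only [circleMap, Complex.ofReal_add, add_mul, Complex.exp_add]
  conv_rhs => rw [← hw]
  push_cast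
  ring

/-- Averaging a continuous integrable function over circles about the origin does not change its
integral against a rotation invariant measure. -/
lemma integral_circleAverage [CompleteSpace F] {μ : Measure ℂ} [SFinite μ]
    (hμ : ∀ c : ℂ, ‖c‖ = 1 → μ.map (fun z => c * z) = μ) {g : ℂ → F} (hg : Continuous g)
    (hi : Integrable g μ) :
    Integrable (fun x => Real.circleAverage g 0 ‖x‖) μ ∧
      ∫ x, Real.circleAverage g 0 ‖x‖ ∂μ = ∫ x, g x ∂μ := by
  set ν := (volume : Measure ℝ).restrict (Ioc 0 (2 * Real.pi)) with hν
  have hmp : ∀ θ : ℝ, MeasurePreserving (fun x : ℂ => circleMap 0 1 θ * x) μ μ := fun θ =>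
    ⟨by fun_prop, hμ _ (by simp)⟩
  have hcont : Continuous (fun p : ℝ × ℂ => g (circleMap 0 1 p.1 * p.2)) := by fun_prop
  have hint : Integrable (fun p : ℝ × ℂ => g (circleMap 0 1 p.1 * p.2)) (ν.prod μ) := by
    rw [integrable_prod_iff hcont.aestronglyMeasurable]
    refine ⟨Eventually.of_forall fun θ => (hmp θ).integrable_comp_of_integrable hi, ?_⟩
    have : (fun θ : ℝ => ∫ y, ‖g (circleMap 0 1 θ * y)‖ ∂μ) = fun _ => ∫ y, ‖g y‖ ∂μ := by
      ext θ
      have h := (hmp θ).map_eq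
      conv_rhs => rw [← h]
      rw [integral_map (hmp θ).measurable.aemeasurable hg.norm.aestronglyMeasurable]
    simp only [this]
    exact integrable_const _
  have heq : ∀ x : ℂ, Real.circleAverage g 0 ‖x‖
      = (2 * Real.pi)⁻¹ • ∫ θ, g (circleMap 0 1 θ * x) ∂ν := fun x => by
    rw [circleAverage_rotate, intervalIntegral.integral_of_le Real.two_pi_pos.le]
    simp [hν]
  simp only [heq]
  refine ⟨hint.integral_prod_right.smul _, ?_⟩
  rw [integral_smul]
  rw [← integral_integral_swap hint]
  have : ∀ θ : ℝ, ∫ y, g (circleMap 0 1 θ * y) ∂μ = ∫ y, g y ∂μ := fun θ => by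
    have h := (hmp θ).map_eq
    conv_rhs => rw [← h]
    rw [integral_map (hmp θ).measurable.aemeasurable hg.aestronglyMeasurable]
  simp only [this, integral_const, hν]
  have hpi : (0 : ℝ) ≤ 2 * Real.pi := Real.two_pi_pos.le
  simp only [Measure.real, Measure.restrict_apply_univ, Real.volume_Ioc, sub_zero,
    ENNReal.toReal_ofReal hpi]
  rw [inv_smul_smul₀ Real.two_pi_pos.ne']

lemma volume_rotate (c : ℂ) (hc : ‖c‖ = 1) :
    (volume : Measure ℂ).map (fun z => c * z) = volume := by
  have h := (rotation ⟨c, mem_sphere_zero_iff_norm.2 hc⟩).measurePreserving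
  exact h.map_eq

/-- A smooth radial probability density. -/
lemma exists_radial_mollifier : ∃ ρ : ℂ → ℝ, ContDiff ℝ ∞ ρ ∧ HasCompactSupport ρ ∧
    (∀ x y, ‖x‖ = ‖y‖ → ρ x = ρ y) ∧ ∫ x, ρ x = 1 := by
  set r : ℂ → ℝ := fun x => expNegInvGlue (1 - ‖x‖ ^ 2) with hr
  have h1 : ContDiff ℝ ∞ r := expNegInvGlue.contDiff.comp (contDiff_const.sub (contDiff_norm_sq ℝ))
  have h2 : HasCompactSupport r := by
    refine HasCompactSupport.intro (isCompact_closedBall 0 1) fun x hx => ?_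
    refine expNegInvGlue.zero_of_nonpos ?_
    simp only [Metric.mem_closedBall, dist_zero_right, not_le] at hx
    nlinarith
  have h3 : 0 < ∫ x, r x := by
    refine h1.continuous.integral_pos_of_hasCompactSupport_nonneg_nonzero h2
      (fun x => expNegInvGlue.nonneg _) (x := 0) ?_
    simp only [hr]
    exact (expNegInvGlue.pos_of_pos (by simp)).ne'
  refine ⟨fun x => (∫ x, r x)⁻¹ * r x, contDiff_const.mul h1, h2.mul_left, fun x y h => ?_, ?_⟩
  · simp [hr, h]
  · rw [integral_const_mul, inv_mul_cancel₀ h3.ne']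

/-- Since `ρ` is constant on circles, averaging the integrand over circles first replaces `v (x -
t)` by `v x`; the total mass of `ρ` is one. -/
lemma moll_eq_self [CompleteSpace F] {ρ : ℂ → ℝ} (hρ : Continuous ρ) (hc : HasCompactSupport ρ)
    (hrad : ∀ x y, ‖x‖ = ‖y‖ → ρ x = ρ y) (h1 : ∫ x, ρ x = 1) {v : ℂ → F} (hv : Continuous v)
    (hmv : ∀ x R, Real.circleAverage v x R = v x) : moll ρ v = v := by
  funext x
  have hg : Continuous (fun t => ρ t • v (x - t)) := by fun_prop
  have h := (integral_circleAverage volume_rotate hg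
    (hg.integrable_of_hasCompactSupport hc.smul_right)).2
  have h2 : ∀ t : ℂ, Real.circleAverage (fun t => ρ t • v (x - t)) 0 ‖t‖ = ρ t • v x := fun t => by
    -- The convolution evaluates `v` at `x - t`, so the relevant circle about `x` is parametrised
    -- with radius `-‖t‖`.
    rw [← hmv x (-‖t‖)]
    simp only [Real.circleAverage_def]
    rw [smul_comm (ρ t), ← intervalIntegral.integral_smul (ρ t)]
    refine congrArg _ (intervalIntegral.integral_congr fun θ _ => ?_)
    rw [hrad _ t (by simp)]
    congr 2
    simp [circleMap]; ring
  rw [moll, convolution]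
  simp only [lsmul_apply]
  rw [← h]
  simp only [h2]
  rw [integral_smul_const, h1, one_smul]

/-- If all mollifications of `u` have the mean value property, then `u` agrees almost everywhere
with a mollification of itself. -/
lemma exists_moll_ae_eq [CompleteSpace F] {u : ℂ → F} (hu : LocallyIntegrable u volume)
    (h : ∀ φ : ℂ → ℝ, ContDiff ℝ ∞ φ → HasCompactSupport φ →
      ∀ x R, Real.circleAverage (moll φ u) x R = moll φ u x) :
    ∃ ρ : ℂ → ℝ, ContDiff ℝ ∞ ρ ∧ HasCompactSupport ρ ∧ u =ᵐ[volume] moll ρ u := by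
  obtain ⟨ρ, hρ, hρc, hrad, h1⟩ := exists_radial_mollifier
  refine ⟨ρ, hρ, hρc, ?_⟩
  let φ : ℕ → ContDiffBump (0 : ℂ) := fun n =>
    ⟨1 / (n + 1 : ℝ), 2 * (1 / (n + 1 : ℝ)), by positivity, by
      have : 0 < 1 / ((n : ℝ) + 1) := by positivity
      linarith⟩
  have hlim : Tendsto (fun n => (φ n).rOut) atTop (𝓝 0) := by
    have := tendsto_one_div_add_atTop_nhds_zero_nat (𝕜 := ℝ)
    simpa [φ] using this.const_mul 2
  have hcont : Continuous (moll ρ u) := hρc.continuous_convolution_left _ hρ.continuous hu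
  filter_upwards [ContDiffBump.ae_convolution_tendsto_right_of_locallyIntegrable (φ := φ) hlim
    (K := 2) (Eventually.of_forall fun n => le_rfl) hu] with x hx
  refine tendsto_nhds_unique hx ?_
  -- The mollification by `φ n` has the mean value property, so mollifying it by `ρ` changes
  -- nothing; commuting the two puts `φ n` outside `ρ ⋆ u`. As `n → ∞` one side tends to `u` almost
  -- everywhere, the other to `ρ ⋆ u`.
  have h3 : ∀ n, ((φ n).normed volume ⋆[lsmul ℝ ℝ, volume] u) x
      = ((φ n).normed volume ⋆[lsmul ℝ ℝ, volume] moll ρ u) x := fun n => by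
    have hs : ContDiff ℝ ∞ ((φ n).normed (volume : Measure ℂ)) := (φ n).contDiff_normed
    have hsc : HasCompactSupport ((φ n).normed (volume : Measure ℂ)) :=
      (φ n).hasCompactSupport_normed
    have := moll_eq_self hρ.continuous hρc hrad h1
      (hsc.continuous_convolution_left (lsmul ℝ ℝ) hs.continuous hu) (h _ hs hsc)
    exact (congrFun this x).symm.trans (moll_comm hρ.continuous hρc hs.continuous hsc hu x)
  simp only [h3]
  exact ContDiffBump.convolution_tendsto_right_of_continuous hlim hcont x

/-- **Weyl's lemma** for the Laplacian. -/
theorem exists_entire_re_ae_eq {u : ℂ → ℝ} (hu : LocallyIntegrable u volume)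
    (h : ∀ φ : ℂ → ℝ, ContDiff ℝ ∞ φ → HasCompactSupport φ →
      ∫ z, u z * Laplacian.laplacian φ z = 0) :
    ∃ E : ℂ → ℂ, Differentiable ℂ E ∧ ∀ᵐ z, u z = (E z).re := by
  obtain ⟨ρ, hρ, hρc, hae⟩ := exists_moll_ae_eq hu fun φ hφ hc x R =>
    InnerProductSpace.HarmonicOnNhd.circleAverage_eq ((harmonic_moll hφ hc hu h).mono (subset_univ _))
  obtain ⟨E, hE, hre⟩ := HarmonicOnNhd.exists_analyticOnNhd_univ_re_eq
    (harmonic_moll hρ hρc hu h)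
  refine ⟨E, fun z => (hE z (mem_univ z)).differentiableAt, ?_⟩
  filter_upwards [hae] with z hz
  rw [hz, ← hre]

/-- **Weyl's lemma** for the Cauchy–Riemann operator. -/
theorem exists_entire_ae_eq {f : ℂ → ℂ} (hf : LocallyIntegrable f volume)
    (h : ∀ φ : ℂ → ℂ, ContDiff ℝ ∞ φ → HasCompactSupport φ → ∫ z, f z * dbar φ z = 0) :
    ∃ E : ℂ → ℂ, Differentiable ℂ E ∧ f =ᵐ[volume] E := by
  obtain ⟨ρ, hρ, hρc, hae⟩ := exists_moll_ae_eq hf fun φ hφ hc x R =>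
    (differentiable_moll hφ hc hf h).diffContOnCl.circleAverage
  exact ⟨_, differentiable_moll hρ hρc hf h, hae⟩

end Weyl

-- Radial integrals and the fundamental solution of the Laplacian.

section FundamentalSolution

lemma integrable_radial_iff {f : ℝ → ℝ} :
    Integrable (fun x : ℂ => f ‖x‖) volume ↔ IntegrableOn (fun r => r * f r) (Ioi 0) := by
  rw [integrable_fun_norm_addHaar (f := f) (volume : Measure ℂ)]
  simp

lemma integral_radial (f : ℝ → ℝ) :
    ∫ x : ℂ, f ‖x‖ = 2 * Real.pi * ∫ r in Ioi (0 : ℝ), r * f r := by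
  rw [integral_fun_norm_addHaar (volume : Measure ℂ) f]
  simp [Measure.real, Complex.volume_ball, mul_assoc]

/-- Integration of a nonnegative radial function with known antiderivative of `r f(r)`. -/
lemma integral_radial_of_hasDerivAt {f G : ℝ → ℝ} {l : ℝ} (hc : ContinuousWithinAt G (Ici 0) 0)
    (hd : ∀ r ∈ Ioi (0 : ℝ), HasDerivAt G (r * f r) r) (hf : ∀ r ∈ Ioi (0 : ℝ), 0 ≤ f r)
    (hl : Tendsto G atTop (𝓝 l)) :
    Integrable (fun x : ℂ => f ‖x‖) volume ∧ ∫ x : ℂ, f ‖x‖ = 2 * Real.pi * (l - G 0) := by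
  have hp : ∀ r ∈ Ioi (0 : ℝ), 0 ≤ r * f r := fun r hr => mul_nonneg (le_of_lt hr) (hf r hr)
  refine ⟨integrable_radial_iff.2 (integrableOn_Ioi_deriv_of_nonneg hc hd hp hl), ?_⟩
  rw [integral_radial, integral_Ioi_of_hasDerivAt_of_nonneg hc hd hp hl]

lemma integral_ball_rpow_neg {p : ℝ} (hp : p < 2) {R : ℝ} (hR : 0 < R) :
    IntegrableOn (fun x : ℂ => ‖x‖ ^ (-p)) (Metric.ball 0 R) ∧
      ∫ x in Metric.ball (0 : ℂ) R, ‖x‖ ^ (-p) = 2 * Real.pi * (R ^ (2 - p) / (2 - p)) := by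
  have heq : ∀ y ∈ Ioo 0 R, y ^ (Module.finrank ℝ ℂ - 1) • y ^ (-p) = y ^ (1 - p) := by
    intro y hy
    rw [sub_eq_add_neg, Real.rpow_add hy.1, Real.rpow_one]
    simp
  constructor
  · rw [integrableOn_fun_norm_addHaar (f := fun r => r ^ (-p)) (volume : Measure ℂ),
      integrableOn_congr_fun heq measurableSet_Ioo,
      intervalIntegral.integrableOn_Ioo_rpow_iff hR]
    linarith
  · rw [← integral_indicator measurableSet_ball]
    have : (Metric.ball (0 : ℂ) R).indicator (fun x => ‖x‖ ^ (-p))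
        = fun x => (Iio R).indicator (fun r : ℝ => r ^ (-p)) ‖x‖ := by
      ext x; simp [indicator]
    rw [this, integral_radial]
    congr 1
    have h2 : (fun r => r * (Iio R).indicator (fun r : ℝ => r ^ (-p)) r)
        = (Iio R).indicator (fun r : ℝ => r * r ^ (-p)) := by
      ext x; simp [indicator]
    rw [h2, setIntegral_indicator measurableSet_Iio, Ioi_inter_Iio,
      setIntegral_congr_fun (g := fun r => r ^ (1 - p)) measurableSet_Ioo,
      ← integral_Ioc_eq_integral_Ioo, ← intervalIntegral.integral_of_le hR.le,
      integral_rpow (Or.inl (by linarith)), Real.zero_rpow (by linarith)]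
    · rw [show 1 - p + 1 = 2 - p by ring, sub_zero]
    · intro y hy
      have := heq y hy
      simp at this
      simp [this]

lemma abs_log_le_inv_add (t : ℝ) (ht : 0 ≤ t) : |Real.log t| ≤ t⁻¹ + t := by
  rcases ht.eq_or_lt with rfl | ht
  · simp
  have h1 := Real.log_le_sub_one_of_pos ht
  have h2 := Real.log_le_sub_one_of_pos (inv_pos.2 ht)
  rw [Real.log_inv] at h2
  have := inv_pos.2 ht
  rw [abs_le]; constructor <;> linarith

lemma locallyIntegrable_inv_norm_sub (y : ℂ) :
    LocallyIntegrable (fun x : ℂ => ‖x - y‖⁻¹) volume := by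
  rw [locallyIntegrable_iff]
  intro K hK
  obtain ⟨R, hR⟩ := hK.isBounded.subset_ball_lt 0 y
  have h := (integral_ball_rpow_neg (p := 1) (by norm_num) hR.1).1
  simp only [Real.rpow_neg_one] at h
  have hmp := (measurePreserving_sub_right (volume : Measure ℂ) y).restrict_preimage
    (s := Metric.ball 0 R) measurableSet_ball
  have h2 : IntegrableOn (fun x : ℂ => ‖x - y‖⁻¹)
      ((fun x : ℂ => x - y) ⁻¹' Metric.ball 0 R) := hmp.integrable_comp_of_integrable h
  refine h2.mono_set (hR.2.trans fun x hx => ?_)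
  simpa [dist_eq_norm] using hx

lemma locallyIntegrable_log_norm_sub (y : ℂ) :
    LocallyIntegrable (fun x : ℂ => Real.log ‖x - y‖) volume := by
  have hc : Continuous (fun x : ℂ => ‖x - y‖) := by fun_prop
  refine ((locallyIntegrable_inv_norm_sub y).add hc.locallyIntegrable).mono
    (Real.measurable_log.comp hc.measurable).aestronglyMeasurable
    (Eventually.of_forall fun x => ?_)
  rw [Real.norm_eq_abs]
  refine (abs_log_le_inv_add _ (norm_nonneg _)).trans (le_abs_self _)

lemma locallyIntegrable_log_norm : LocallyIntegrable (fun x : ℂ => Real.log ‖x‖) volume := by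
  simpa using locallyIntegrable_log_norm_sub 0

/-- Green's formula. -/
lemma integral_mul_laplacian {f φ : ℂ → ℝ} (hf : ContDiff ℝ ∞ f) (hφ : ContDiff ℝ ∞ φ)
    (hc : HasCompactSupport φ) :
    ∫ z, f z * Laplacian.laplacian φ z = ∫ z, Laplacian.laplacian f z * φ z := by
  have key : ∀ v, ∫ z, f z * fderiv ℝ (fun y => fderiv ℝ φ y v) z v
      = ∫ z, fderiv ℝ (fun y => fderiv ℝ f y v) z v * φ z := by
    intro v
    have hf1 := contDiff_fderiv_apply hf v
    have hf2 := contDiff_fderiv_apply hf1 v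
    have hφ1 := contDiff_fderiv_apply hφ v
    have hφ2 := contDiff_fderiv_apply hφ1 v
    have hc1 : HasCompactSupport (fun y => fderiv ℝ φ y v) := hc.fderiv_apply ℝ v
    have hc2 : HasCompactSupport (fun y => fderiv ℝ (fun y => fderiv ℝ φ y v) y v) :=
      hc1.fderiv_apply ℝ v
    rw [integral_mul_fderiv_eq_neg_fderiv_mul_of_integrable
      ((hf1.continuous.mul hφ1.continuous).integrable_of_hasCompactSupport hc1.mul_left)
      ((hf.continuous.mul hφ2.continuous).integrable_of_hasCompactSupport hc2.mul_left)
      ((hf.continuous.mul hφ1.continuous).integrable_of_hasCompactSupport hc1.mul_left)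
      (fun x _ => hf.differentiable (by simp) x) (fun x _ => hφ1.differentiable (by simp) x),
      integral_mul_fderiv_eq_neg_fderiv_mul_of_integrable
      ((hf2.continuous.mul hφ.continuous).integrable_of_hasCompactSupport hc.mul_left)
      ((hf1.continuous.mul hφ1.continuous).integrable_of_hasCompactSupport hc1.mul_left)
      ((hf1.continuous.mul hφ.continuous).integrable_of_hasCompactSupport hc.mul_left)
      (fun x _ => hf1.differentiable (by simp) x) (fun x _ => hφ.differentiable (by simp) x),
      neg_neg]
  have hi : ∀ v, Integrable (fun z => f z * fderiv ℝ (fun y => fderiv ℝ φ y v) z v) := fun v =>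
    (hf.continuous.mul (contDiff_fderiv_apply (contDiff_fderiv_apply hφ v)
      v).continuous).integrable_of_hasCompactSupport
      ((hc.fderiv_apply ℝ v).fderiv_apply ℝ v).mul_left
  have hi2 : ∀ v, Integrable (fun z => fderiv ℝ (fun y => fderiv ℝ f y v) z v * φ z) := fun v =>
    ((contDiff_fderiv_apply (contDiff_fderiv_apply hf v)
      v).continuous.mul hφ.continuous).integrable_of_hasCompactSupport hc.mul_left
  simp only [laplacian_eq_fderiv (contDiff_two hφ), laplacian_eq_fderiv (contDiff_two hf),
    mul_add, add_mul]
  rw [integral_add (hi _) (hi _), integral_add (hi2 _) (hi2 _), key, key]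

/-- In the variable `s = |z|²` there is no singularity at the origin, and the chain rule gives `Δ =
4 X' + 4 s X''`. -/
lemma laplacian_radial {X X₁ X₂ : ℝ → ℝ} (hX : ∀ s, 0 ≤ s → HasDerivAt X (X₁ s) s)
    (hX₁ : ∀ s, 0 ≤ s → HasDerivAt X₁ (X₂ s) s)
    (hs : ContDiff ℝ ∞ (fun z : ℂ => X (‖z‖ ^ 2))) (z : ℂ) :
    Laplacian.laplacian (fun z : ℂ => X (‖z‖ ^ 2)) z
      = 4 * X₁ (‖z‖ ^ 2) + 4 * ‖z‖ ^ 2 * X₂ (‖z‖ ^ 2) := by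
  have hn : ∀ z : ℂ, HasFDerivAt (fun z : ℂ => ‖z‖ ^ 2) (2 • innerSL ℝ z) z := fun z =>
    (hasStrictFDerivAt_norm_sq z).hasFDerivAt
  have h1 : ∀ z v : ℂ, fderiv ℝ (fun z : ℂ => X (‖z‖ ^ 2)) z v
      = X₁ (‖z‖ ^ 2) * (2 * inner ℝ z v) := fun z v => by
    have := ((hX _ (sq_nonneg ‖z‖)).comp_hasFDerivAt z (hn z)).fderiv
    simp only [Function.comp_def] at this
    rw [this]
    simp
    left; ring
  rw [laplacian_eq_fderiv (contDiff_two hs)]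
  simp only [h1]
  have h2 : ∀ z v : ℂ, fderiv ℝ (fun z : ℂ => X₁ (‖z‖ ^ 2) * (2 * inner ℝ z v)) z v
      = X₁ (‖z‖ ^ 2) * (2 * inner ℝ v v)
        + 4 * X₂ (‖z‖ ^ 2) * (inner ℝ z v) ^ 2 := fun z v => by
    have ha := ((hX₁ _ (sq_nonneg ‖z‖)).comp_hasFDerivAt z (hn z))
    have hb : HasFDerivAt (fun z : ℂ => 2 * (inner ℝ z v : ℝ)) (2 • innerSL ℝ v) z := by
      have := ((innerSL ℝ v).hasFDerivAt (x := z)).const_smul (2 : ℝ)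
      refine (this.congr_of_eventuallyEq (Eventually.of_forall fun w => ?_)).congr_fderiv ?_
      · simp [real_inner_comm]
      · ext; simp; ring
    have := (ha.mul hb).fderiv
    simp only [Function.comp_def] at this
    erw [this]
    simp
    ring
  rw [h2, h2]
  simp [Complex.inner, ← Complex.normSq_eq_norm_sq, Complex.normSq_apply]
  ring

/-- The integrand is the Laplacian of `log(1+|w|²) / 2`; its mass is the constant `2π` in the
fundamental solution. -/
lemma integral_two_div_sq :
    Integrable (fun w : ℂ => 2 / (1 + ‖w‖ ^ 2) ^ 2) volume ∧
      ∫ w : ℂ, 2 / (1 + ‖w‖ ^ 2) ^ 2 = 2 * Real.pi := by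
  have h := integral_radial_of_hasDerivAt (f := fun r => 2 / (1 + r ^ 2) ^ 2)
    (G := fun r => - (1 + r ^ 2)⁻¹) (l := 0)
    (by
      refine Continuous.continuousWithinAt ?_
      exact (Continuous.inv₀ (by fun_prop) (fun x => by positivity)).neg)
    (fun r _ => by
      have h1 : HasDerivAt (fun r : ℝ => 1 + r ^ 2) (2 * r) r := by
        simpa using (hasDerivAt_pow 2 r).const_add 1
      have := (h1.inv (by positivity)).neg
      refine this.congr_deriv ?_
      field_simp)
    (fun r _ => by positivity)
    (by
      rw [← neg_zero]
      refine (tendsto_inv_atTop_zero.comp ?_).neg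
      exact tendsto_atTop_add_const_left _ _ (tendsto_pow_atTop (by norm_num)))
  simpa using h

/-- The smooth functions `log(|z|²+ε²) / 2` converge to `log|z|`, and their Laplacians are
rescalings of one density of mass `2π`, which concentrate at the origin. Dominated convergence
applies on both sides of Green's formula. -/
lemma integral_log_norm_mul_laplacian {φ : ℂ → ℝ} (hφ : ContDiff ℝ ∞ φ)
    (hc : HasCompactSupport φ) :
    ∫ z, Real.log ‖z‖ * Laplacian.laplacian φ z = 2 * Real.pi * φ 0 := by
  set ε : ℕ → ℝ := fun n => 1 / ((n : ℝ) + 1) with hε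
  have hε0 : ∀ n, 0 < ε n := fun n => by positivity
  have hε1 : ∀ n, ε n ≤ 1 := fun n => by
    rw [hε]; simp only
    rw [div_le_one (by positivity)]; linarith [(Nat.cast_nonneg n : (0 : ℝ) ≤ n)]
  have hlim : Tendsto ε atTop (𝓝 0) := tendsto_one_div_add_atTop_nhds_zero_nat
  set ψ := Laplacian.laplacian φ with hψ
  have hψc : Continuous ψ := continuous_laplacian hφ
  have hψs : HasCompactSupport ψ := hasCompactSupport_laplacian hφ hc
  have hA : Tendsto (fun n => ∫ z, 1 / 2 * Real.log (‖z‖ ^ 2 + ε n ^ 2) * ψ z) atTop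
      (𝓝 (∫ z, Real.log ‖z‖ * ψ z)) := by
    refine tendsto_integral_of_dominated_convergence
      (fun z => (|Real.log ‖z‖| + 1 / 2 * Real.log (‖z‖ ^ 2 + 1)) * |ψ z|) (fun n => ?_) ?_
      (fun n => ?_) ?_
    · refine Continuous.aestronglyMeasurable ?_
      refine (continuous_const.mul (Continuous.log (by fun_prop) fun z => ?_)).mul hψc
      have := hε0 n; positivity
    · have h1 : LocallyIntegrable
          (fun z : ℂ => |Real.log ‖z‖| + 1 / 2 * Real.log (‖z‖ ^ 2 + 1)) volume := by
        refine LocallyIntegrable.add (fun x => (locallyIntegrable_log_norm x).norm)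
          (Continuous.locallyIntegrable ?_)
        refine continuous_const.mul (Continuous.log (by fun_prop) fun z => ?_)
        positivity
      have := h1.integrable_smul_right_of_hasCompactSupport hψc.abs
        (hψs.comp_left (g := fun r : ℝ => |r|) abs_zero)
      simpa only [smul_eq_mul] using this
    · have : (∀ᵐ z : ℂ, z ≠ 0) := by
        simp [ae_iff]
      filter_upwards [this] with z hz
      rw [norm_mul, Real.norm_eq_abs, Real.norm_eq_abs]
      refine mul_le_mul_of_nonneg_right ?_ (abs_nonneg _)
      have hz' : 0 < ‖z‖ := norm_pos_iff.2 hz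
      have e1 : Real.log ‖z‖ = 1 / 2 * Real.log (‖z‖ ^ 2) := by rw [Real.log_pow]; push_cast; ring
      have e2 : Real.log (‖z‖ ^ 2) ≤ Real.log (‖z‖ ^ 2 + ε n ^ 2) :=
        Real.log_le_log (by positivity) (by have := hε0 n; nlinarith)
      have e3 : Real.log (‖z‖ ^ 2 + ε n ^ 2) ≤ Real.log (‖z‖ ^ 2 + 1) :=
        Real.log_le_log (by have := hε0 n; positivity) (by have := hε0 n; have := hε1 n; nlinarith)
      have e4 : 0 ≤ Real.log (‖z‖ ^ 2 + 1) := Real.log_nonneg (by nlinarith)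
      have e5 := neg_abs_le (Real.log ‖z‖)
      have e6 := abs_nonneg (Real.log ‖z‖)
      rw [abs_le]; constructor <;> linarith
    · have : (∀ᵐ z : ℂ, z ≠ 0) := by
        simp [ae_iff]
      filter_upwards [this] with z hz
      have hz' : 0 < ‖z‖ := norm_pos_iff.2 hz
      refine Tendsto.mul_const _ ?_
      have e1 : Real.log ‖z‖ = 1 / 2 * Real.log (‖z‖ ^ 2 + 0 ^ 2) := by
        rw [zero_pow (by norm_num), add_zero, Real.log_pow]; push_cast; ring
      rw [e1]
      refine Tendsto.const_mul _ (Tendsto.log ((hlim.pow 2).const_add _) (by positivity))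
  have hB : ∀ n, ∫ z, 1 / 2 * Real.log (‖z‖ ^ 2 + ε n ^ 2) * ψ z
      = ∫ w : ℂ, 2 / (1 + ‖w‖ ^ 2) ^ 2 * φ (ε n • w) := by
    intro n
    have he := hε0 n
    have hsm : ContDiff ℝ ∞ (fun z : ℂ => 1 / 2 * Real.log (‖z‖ ^ 2 + ε n ^ 2)) := by
      refine contDiff_const.mul (ContDiff.log ((contDiff_norm_sq ℝ).add contDiff_const) fun z => ?_)
      positivity
    rw [integral_mul_laplacian hsm hφ hc]
    have hL : ∀ z : ℂ, Laplacian.laplacian (fun z : ℂ => 1 / 2 * Real.log (‖z‖ ^ 2 + ε n ^ 2)) z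
        = 2 * ε n ^ 2 / (‖z‖ ^ 2 + ε n ^ 2) ^ 2 := fun z => by
      rw [laplacian_radial (X := fun s => 1 / 2 * Real.log (s + ε n ^ 2))
        (X₁ := fun s => 1 / 2 * (s + ε n ^ 2)⁻¹) (X₂ := fun s => 1 / 2 * -((s + ε n ^ 2) ^ 2)⁻¹)
        (fun s hs => ?_) (fun s hs => ?_) hsm]
      · field_simp; ring
      · have h1 : HasDerivAt (fun s : ℝ => s + ε n ^ 2) 1 s := (hasDerivAt_id s).add_const _
        have := (h1.log (by positivity)).const_mul (1 / 2)
        simpa [one_div] using this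
      · have h1 : HasDerivAt (fun s : ℝ => s + ε n ^ 2) 1 s := (hasDerivAt_id s).add_const _
        have := (h1.inv (by positivity)).const_mul (1 / 2)
        refine this.congr_deriv ?_
        field_simp
    simp only [hL]
    have hsc := Measure.integral_comp_smul_of_nonneg (volume : Measure ℂ)
      (fun z : ℂ => 2 * ε n ^ 2 / (‖z‖ ^ 2 + ε n ^ 2) ^ 2 * φ z) (ε n) (hR := he.le)
    simp only [Complex.finrank_real_complex, smul_eq_mul] at hsc
    have h3 := (eq_inv_mul_iff_mul_eq₀ (by positivity : ε n ^ 2 ≠ 0)).1 hsc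
    rw [← h3, ← integral_const_mul]
    congr 1; ext w
    rw [norm_smul, Real.norm_of_nonneg he.le]
    field_simp
    ring
  have hC : Tendsto (fun n => ∫ w : ℂ, 2 / (1 + ‖w‖ ^ 2) ^ 2 * φ (ε n • w)) atTop
      (𝓝 (∫ w : ℂ, 2 / (1 + ‖w‖ ^ 2) ^ 2 * φ 0)) := by
    obtain ⟨C, hC⟩ := hc.exists_bound_of_continuous hφ.continuous
    refine tendsto_integral_of_dominated_convergence
      (fun w => 2 / (1 + ‖w‖ ^ 2) ^ 2 * C) (fun n => ?_) (integral_two_div_sq.1.mul_const _)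
      (fun n => Eventually.of_forall fun w => ?_) (Eventually.of_forall fun w => ?_)
    · refine Continuous.aestronglyMeasurable ?_
      refine (Continuous.div (by fun_prop) (by fun_prop) fun w => by positivity).mul ?_
      exact hφ.continuous.comp (by fun_prop)
    · rw [norm_mul, Real.norm_of_nonneg (by positivity)]
      exact mul_le_mul_of_nonneg_left (hC _) (by positivity)
    · refine Tendsto.const_mul _ ?_
      have := (hφ.continuous.tendsto 0).comp
        (show Tendsto (fun n => ε n • w) atTop (𝓝 0) by simpa using hlim.smul_const w)
      exact this
  simp only [hB] at hA
  rw [tendsto_nhds_unique hA hC, integral_mul_const, integral_two_div_sq.2]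

/-- `(2π)⁻¹ log|x - y|` is the fundamental solution of the Laplacian. -/
theorem integral_log_norm_sub_mul_laplacian {φ : ℂ → ℝ} (hφ : ContDiff ℝ ∞ φ)
    (hc : HasCompactSupport φ) (y : ℂ) :
    ∫ z, Real.log ‖z - y‖ * Laplacian.laplacian φ z = 2 * Real.pi * φ y := by
  have h := integral_log_norm_mul_laplacian (φ := fun s => φ (y - s))
    (hφ.comp (contDiff_const.sub contDiff_id)) (hc.comp_homeomorph (Homeomorph.subLeft y))
  simp only [laplacian_comp_const_sub hφ, sub_zero] at h
  rw [← h, ← integral_sub_left_eq_self _ _ y]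
  congr 1; ext s
  simp

lemma integral_laplacian {φ : ℂ → ℝ} (hφ : ContDiff ℝ ∞ φ) (hc : HasCompactSupport φ) :
    ∫ z, Laplacian.laplacian φ z = 0 := by
  have := integral_mul_laplacian (f := fun _ => 1) contDiff_const hφ hc
  simpa using this

end FundamentalSolution

-- Logarithmic potentials of finite measures.

section LogPotential

open scoped ENNReal

/-- The logarithmic kernel, normalised at infinity. -/
noncomputable def logKernel (x y : ℂ) : ℝ := Real.log ‖x - y‖ - Real.log (1 + ‖y‖)

/-- The logarithmic potential of a finite measure. -/
noncomputable def logPot (P : Measure ℂ) (x : ℂ) : ℝ := ∫ y, logKernel x y ∂P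

lemma measurable_logKernel : Measurable (fun p : ℂ × ℂ => logKernel p.1 p.2) := by
  unfold logKernel
  exact (Real.measurable_log.comp (by fun_prop)).sub (Real.measurable_log.comp (by fun_prop))

lemma measurable_logKernel_right (x : ℂ) : Measurable (fun y : ℂ => logKernel x y) :=
  measurable_logKernel.comp (by fun_prop : Measurable fun y : ℂ => (x, y))

/-- This is `|x - y| ≤ (1+|x|)(1+|y|)`. Subtracting `log(1+|y|)` makes the bound uniform in `y`, so
no moment condition on the measure is needed. On the diagonal `log 0 = 0` is harmless. -/
lemma logKernel_le (x y : ℂ) : logKernel x y ≤ Real.log (1 + ‖x‖) := by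
  have hx := norm_nonneg x
  have hy := norm_nonneg y
  unfold logKernel
  rcases eq_or_ne x y with rfl | h
  · simp only [sub_self, norm_zero, Real.log_zero, zero_sub]
    have := Real.log_nonneg (by linarith : (1 : ℝ) ≤ 1 + ‖x‖)
    linarith
  · rw [sub_le_iff_le_add, ← Real.log_mul (by positivity) (by positivity)]
    refine Real.log_le_log (norm_pos_iff.2 (sub_ne_zero.2 h)) ?_
    have := norm_sub_le x y
    nlinarith

lemma integrable_one_add_norm_rpow {τ : ℝ} (hτ : τ < -1) :
    Integrable (fun x : ℂ => (1 + ‖x‖) ^ (2 * τ)) volume := by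
  have := integrable_one_add_norm (E := ℂ) (μ := volume) (r := -(2 * τ)) (by
    rw [Complex.finrank_real_complex]; push_cast; linarith)
  simpa using this

/-- Let `ρ = (1+|y|)/2`. Off the ball of radius `ρ` about `y` the exponential is at most `2^p` and
the weight is integrable. In the ball `1+|x| ≥ ρ`, while `|x-y|^{-p}` integrates to a multiple of
`ρ^{2-p}`. The total power of `ρ` is `2τ+2 < 0`, and `ρ ≥ 1/2`. -/
lemma lintegral_weight_exp_logKernel_le {p τ : ℝ} (hp0 : 0 ≤ p) (hp : p < 2) (hτ : τ < -1) :
    ∃ C : ℝ≥0∞, C < ⊤ ∧ ∀ y : ℂ,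
      ∫⁻ x, ENNReal.ofReal ((1 + ‖x‖) ^ (2 * τ) * Real.exp (p * -logKernel x y)) ≤ C := by
  set A := ∫⁻ x : ℂ, ENNReal.ofReal (2 ^ p * (1 + ‖x‖) ^ (2 * τ)) with hA
  have hAfin : A < ⊤ := ((integrable_one_add_norm_rpow hτ).const_mul _).lintegral_lt_top
  refine ⟨A + ENNReal.ofReal ((1 / 2) ^ (2 * τ + 2) * (2 ^ p * (2 * Real.pi / (2 - p)))),
    ENNReal.add_lt_top.2 ⟨hAfin, ENNReal.ofReal_lt_top⟩, fun y => ?_⟩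
  set ρ := (1 + ‖y‖) / 2 with hρ
  have hρ0 : 0 < ρ := by positivity
  have hρ1 : 1 / 2 ≤ ρ := by rw [hρ]; linarith [norm_nonneg y]
  set g : ℂ → ℝ := fun x => ρ ^ (2 * τ) * (2 * ρ) ^ p * ‖x - y‖ ^ (-p) with hg
  have hpt : ∀ᵐ x : ℂ, ENNReal.ofReal ((1 + ‖x‖) ^ (2 * τ) * Real.exp (p * -logKernel x y))
      ≤ ENNReal.ofReal (2 ^ p * (1 + ‖x‖) ^ (2 * τ))
        + (Metric.ball y ρ).indicator (fun x => ENNReal.ofReal (g x)) x := by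
    have : ∀ᵐ x : ℂ, x ≠ y := by simp [ae_iff]
    filter_upwards [this] with x hx
    have hxy : 0 < ‖x - y‖ := norm_pos_iff.2 (sub_ne_zero.2 hx)
    have he : Real.exp (p * -logKernel x y) = (2 * ρ) ^ p * ‖x - y‖ ^ (-p) := by
      rw [Real.rpow_def_of_pos (by positivity), Real.rpow_def_of_pos hxy, ← Real.exp_add]
      congr 1
      simp only [logKernel, hρ]
      rw [mul_div_cancel₀ _ (by norm_num : (2 : ℝ) ≠ 0)]
      ring
    by_cases hb : x ∈ Metric.ball y ρ
    · rw [indicator_of_mem hb]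
      refine le_trans (ENNReal.ofReal_le_ofReal ?_) le_add_self
      rw [he]
      simp only [hg, mul_assoc]
      refine mul_le_mul_of_nonneg_right ?_ (by positivity)
      refine Real.rpow_le_rpow_of_nonpos hρ0 ?_ (by linarith)
      rw [Metric.mem_ball, dist_eq_norm] at hb
      have := norm_sub_norm_le y x
      rw [norm_sub_rev] at this
      linarith
    · rw [indicator_of_notMem hb, add_zero]
      refine ENNReal.ofReal_le_ofReal ?_
      rw [he, mul_comm]
      refine mul_le_mul_of_nonneg_right ?_ (by positivity)
      rw [Metric.mem_ball, dist_eq_norm, not_lt] at hb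
      rw [Real.rpow_neg hxy.le, ← div_eq_mul_inv, ← Real.div_rpow (by positivity) hxy.le]
      refine Real.rpow_le_rpow (by positivity) ?_ hp0
      rw [div_le_iff₀ hxy]; linarith
  refine (lintegral_mono_ae hpt).trans ?_
  rw [lintegral_add_left (by fun_prop)]
  refine add_le_add le_rfl ?_
  rw [lintegral_indicator measurableSet_ball]
  obtain ⟨hi, hv⟩ := integral_ball_rpow_neg hp hρ0
  have hmp : MeasurePreserving (fun x : ℂ => x - y) (volume.restrict (Metric.ball y ρ))
      (volume.restrict (Metric.ball 0 ρ)) := by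
    have h := (measurePreserving_sub_right (volume : Measure ℂ) y).restrict_preimage
      (s := Metric.ball 0 ρ) measurableSet_ball
    convert h using 2
    ext x; simp [dist_eq_norm]
  have hi' : IntegrableOn g (Metric.ball y ρ) :=
    (hmp.integrable_comp_of_integrable hi).const_mul _
  rw [← ofReal_integral_eq_lintegral_ofReal hi'
    (Eventually.of_forall fun x => by simp only [hg]; positivity)]
  refine ENNReal.ofReal_le_ofReal ?_
  have hv' : ∫ x in Metric.ball y ρ, ‖x - y‖ ^ (-p) = 2 * Real.pi * (ρ ^ (2 - p) / (2 - p)) := by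
    rw [← hv]
    exact hmp.integral_comp' (f := MeasurableEquiv.subRight y) (fun x => ‖x‖ ^ (-p))
  simp only [hg]
  rw [integral_const_mul, hv']
  have h2p : 0 < 2 - p := by linarith
  have e1 : ρ ^ (2 * τ) * (2 * ρ) ^ p * (2 * Real.pi * (ρ ^ (2 - p) / (2 - p)))
      = ρ ^ (2 * τ + 2) * (2 ^ p * (2 * Real.pi / (2 - p))) := by
    rw [Real.mul_rpow (by norm_num) hρ0.le, show 2 * τ + 2 = 2 * τ + p + (2 - p) by ring,
      Real.rpow_add hρ0, Real.rpow_add hρ0]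
    ring
  rw [e1]
  refine mul_le_mul_of_nonneg_right ?_ (by have := Real.pi_pos; positivity)
  exact Real.rpow_le_rpow_of_nonpos (by norm_num) hρ1 (by linarith)

/-- Jensen's inequality for the normalised measure. The summand `1` covers the zero measure and a
non-integrable `g`, whose integral is `0` by convention. -/
lemma exp_integral_le (N : Measure ℂ) [IsFiniteMeasure N] {g : ℂ → ℝ} (hg : Measurable g) :
    ENNReal.ofReal (Real.exp (∫ y, g y ∂N)) ≤
      1 + (N univ)⁻¹ * ∫⁻ y, ENNReal.ofReal (Real.exp (N.real univ * g y)) ∂N := by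
  by_cases hN : N = 0
  · simp [hN]
  have : NeZero N := ⟨hN⟩
  by_cases hi : Integrable g N
  swap
  · rw [integral_undef hi]; simp
  refine le_trans ?_ le_add_self
  set m := N.real univ with hm
  have hm0 : m ≠ 0 := by simp [hm, measureReal_def, ENNReal.toReal_eq_zero_iff, hN]
  by_cases ht : ∫⁻ y, ENNReal.ofReal (Real.exp (m * g y)) ∂N = ⊤
  · rw [ht, ENNReal.mul_top (by simp)]; exact le_top
  have hie : Integrable (fun y => Real.exp (m * g y)) N := by
    refine ⟨(by fun_prop), ?_⟩
    rw [hasFiniteIntegral_iff_ofReal (Eventually.of_forall fun y => (Real.exp_pos _).le)]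
    exact lt_top_iff_ne_top.2 ht
  have hJ := convexOn_exp.map_average_le (μ := N) (f := fun y => m * g y)
    Real.continuous_exp.continuousOn isClosed_univ (by simp) (hi.const_mul m) hie
  rw [average_eq, average_eq, integral_const_mul, smul_eq_mul, smul_eq_mul, ← hm,
    inv_mul_cancel_left₀ hm0] at hJ
  refine (ENNReal.ofReal_le_ofReal hJ).trans ?_
  rw [ENNReal.ofReal_mul (by positivity), ofReal_integral_eq_lintegral_ofReal hie
    (Eventually.of_forall fun y => (Real.exp_pos _).le)]
  gcongr
  rw [ENNReal.ofReal_inv_of_pos (lt_of_le_of_ne measureReal_nonneg (Ne.symm hm0)), ofReal_measureReal]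

lemma neg_logPot (N : Measure ℂ) (x : ℂ) : -2 * logPot N x = ∫ y, 2 * -logKernel x y ∂N := by
  rw [integral_const_mul, integral_neg, logPot]; ring

/-- The exponential of minus twice the potential of a small mass is integrable against weights. -/
lemma lintegral_weight_exp_logPot_lt_top (N : Measure ℂ) [IsFiniteMeasure N]
    (hN : N.real univ < 1) {τ : ℝ} (hτ : τ < -1) :
    ∫⁻ x, ENNReal.ofReal ((1 + ‖x‖) ^ (2 * τ) * Real.exp (-2 * logPot N x)) < ⊤ := by
  set m := N.real univ with hm
  -- Jensen's inequality multiplies the exponent `2` by the mass `m`; the kernel stays integrable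
  -- because `m < 1`.
  obtain ⟨C, hC, hCy⟩ := lintegral_weight_exp_logKernel_le (p := 2 * m) (by positivity)
    (by linarith) hτ
  set w : ℂ → ℝ≥0∞ := fun x => ENNReal.ofReal ((1 + ‖x‖) ^ (2 * τ)) with hw
  have hwm : Measurable w := by fun_prop
  have hmeas : Measurable (fun p : ℂ × ℂ =>
      ENNReal.ofReal ((1 + ‖p.1‖) ^ (2 * τ) * Real.exp (2 * m * -logKernel p.1 p.2))) := by
    have := measurable_logKernel
    fun_prop
  have hpt : ∀ x, ENNReal.ofReal ((1 + ‖x‖) ^ (2 * τ) * Real.exp (-2 * logPot N x))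
      ≤ w x + (N univ)⁻¹ * ∫⁻ y, ENNReal.ofReal
        ((1 + ‖x‖) ^ (2 * τ) * Real.exp (2 * m * -logKernel x y)) ∂N := fun x => by
    have h1 := exp_integral_le N (g := fun y => 2 * -logKernel x y)
      ((measurable_logKernel_right x).neg.const_mul 2)
    rw [neg_logPot, ENNReal.ofReal_mul (by positivity)]
    refine (mul_le_mul_right h1 _).trans (le_of_eq ?_)
    rw [mul_add, mul_one]
    congr 1
    rw [mul_left_comm, ← lintegral_const_mul]
    · congr 1
      refine lintegral_congr fun y => ?_
      rw [← ENNReal.ofReal_mul (by positivity), ← hm]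
      congr 3; ring
    · have := measurable_logKernel_right x
      fun_prop
  refine (lintegral_mono hpt).trans_lt ?_
  rw [lintegral_add_left hwm, lintegral_const_mul _ (by
    exact hmeas.lintegral_prod_right'), lintegral_lintegral_swap hmeas.aemeasurable]
  refine ENNReal.add_lt_top.2 ⟨(integrable_one_add_norm_rpow hτ).lintegral_lt_top, ?_⟩
  by_cases h0 : N = 0
  · simp [h0]
  · refine (mul_le_mul_right (lintegral_mono hCy) _).trans_lt ?_
    rw [lintegral_const, mul_left_comm, ENNReal.inv_mul_cancel (by simpa using h0)
      (measure_ne_top _ _), mul_one]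
    exact hC

lemma measurable_logPot (N : Measure ℂ) [SFinite N] : Measurable (logPot N) :=
  (measurable_logKernel.stronglyMeasurable.integral_prod_right' (ν := N)).measurable

/-- The joint integrability behind every use of Fubini below. The positive part of the kernel is at
most `|x|`, which the weight absorbs; the negative part is at most `exp (-logKernel)`, the case `p =
1` of the exponential estimate. -/
lemma integrable_weight_logKernel (N : Measure ℂ) [IsFiniteMeasure N] :
    Integrable (fun p : ℂ × ℂ => (1 + ‖p.1‖) ^ (2 * (-2 : ℝ)) * logKernel p.1 p.2)
      (volume.prod N) := by
  obtain ⟨C, hC, hCy⟩ := lintegral_weight_exp_logKernel_le (p := 1) (τ := -2) (by norm_num)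
    (by norm_num) (by norm_num)
  have hk := measurable_logKernel
  refine ⟨Measurable.aestronglyMeasurable (by fun_prop), ?_⟩
  rw [hasFiniteIntegral_iff_norm]
  have hpt : ∀ p : ℂ × ℂ, ENNReal.ofReal ‖(1 + ‖p.1‖) ^ (2 * (-2 : ℝ)) * logKernel p.1 p.2‖
      ≤ ENNReal.ofReal ((1 + ‖p.1‖) ^ (2 * (-3 / 2 : ℝ)))
        + ENNReal.ofReal ((1 + ‖p.1‖) ^ (2 * (-2 : ℝ)) * Real.exp (1 * -logKernel p.1 p.2)) := by
    intro p
    rw [← ENNReal.ofReal_add (by positivity) (by positivity)]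
    refine ENNReal.ofReal_le_ofReal ?_
    rw [norm_mul, Real.norm_of_nonneg (by positivity), Real.norm_eq_abs]
    have h0 : 0 < 1 + ‖p.1‖ := by positivity
    have e : (1 + ‖p.1‖) ^ (2 * (-3 / 2 : ℝ)) = (1 + ‖p.1‖) ^ (2 * (-2 : ℝ)) * (1 + ‖p.1‖) := by
      rw [← Real.rpow_add_one h0.ne']; norm_num
    rw [e, ← mul_add]
    refine mul_le_mul_of_nonneg_left ?_ (by positivity)
    have h1 := logKernel_le p.1 p.2
    have h2 := Real.log_le_sub_one_of_pos h0
    have h3 := Real.add_one_le_exp (1 * -logKernel p.1 p.2)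
    have h4 := Real.exp_pos (1 * -logKernel p.1 p.2)
    have h5 := norm_nonneg p.1
    rw [abs_le]; constructor <;> linarith
  refine (lintegral_mono hpt).trans_lt ?_
  rw [lintegral_add_left (by fun_prop)]
  refine ENNReal.add_lt_top.2 ⟨?_, ?_⟩
  · rw [lintegral_prod _ (by fun_prop)]
    simp only [lintegral_const]
    rw [lintegral_mul_const _ (by fun_prop)]
    exact ENNReal.mul_lt_top (integrable_one_add_norm_rpow (by norm_num)).lintegral_lt_top
      (measure_lt_top _ _)
  · rw [lintegral_prod_symm _ (by fun_prop)]
    refine (lintegral_mono hCy).trans_lt ?_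
    rw [lintegral_const]
    exact ENNReal.mul_lt_top hC (measure_lt_top _ _)

lemma ae_integrable_logKernel (N : Measure ℂ) [IsFiniteMeasure N] :
    ∀ᵐ x, Integrable (fun y => logKernel x y) N := by
  filter_upwards [(integrable_weight_logKernel N).prod_right_ae] with x hx
  have h0 : (1 + ‖x‖) ^ (2 * (-2 : ℝ)) ≠ 0 := by positivity
  have := hx.const_mul ((1 + ‖x‖) ^ (2 * (-2 : ℝ)))⁻¹
  simpa only [inv_mul_cancel_left₀ h0] using this

lemma locallyIntegrable_logPot (N : Measure ℂ) [IsFiniteMeasure N] :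
    LocallyIntegrable (logPot N) volume := by
  have h := (integrable_weight_logKernel N).integral_prod_left
  simp only [integral_const_mul] at h
  have h2 := h.locallyIntegrable.continuous_smul (g := fun x : ℂ => (1 + ‖x‖) ^ (2 * (2 : ℝ)))
    (Continuous.rpow_const (by fun_prop) fun x => Or.inr (by norm_num))
  refine h2.congr (Eventually.of_forall fun x => ?_)
  simp only [smul_eq_mul, logPot]
  rw [← mul_assoc, ← Real.rpow_add (by positivity)]
  norm_num

/-- Fubini reduces this to the fundamental solution. The normalising term `log(1+|y|)` does not
depend on `x` and drops out because a Laplacian of a test function has integral zero. -/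
lemma integral_logPot_mul_laplacian (N : Measure ℂ) [IsFiniteMeasure N] {φ : ℂ → ℝ}
    (hφ : ContDiff ℝ ∞ φ) (hc : HasCompactSupport φ) :
    ∫ z, logPot N z * Laplacian.laplacian φ z = 2 * Real.pi * ∫ z, φ z ∂N := by
  set ψ := Laplacian.laplacian φ with hψ
  have hψc : Continuous ψ := continuous_laplacian hφ
  have hψs : HasCompactSupport ψ := hasCompactSupport_laplacian hφ hc
  set b : ℂ → ℝ := fun x => (1 + ‖x‖) ^ (2 * (2 : ℝ)) * ψ x with hb
  have hbc : Continuous b :=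
    (Continuous.rpow_const (by fun_prop) fun x => Or.inr (by norm_num)).mul hψc
  obtain ⟨C, hC⟩ := (hψs.mul_left : HasCompactSupport b).exists_bound_of_continuous hbc
  have hint : Integrable (fun p : ℂ × ℂ => logKernel p.1 p.2 * ψ p.1) (volume.prod N) := by
    have := (integrable_weight_logKernel N).mul_bdd (c := C) (g := fun p : ℂ × ℂ => b p.1)
      (hbc.comp continuous_fst).aestronglyMeasurable (Eventually.of_forall fun p => hC p.1)
    refine this.congr (Eventually.of_forall fun p => ?_)
    simp only [hb]
    have e : (1 + ‖p.1‖) ^ (2 * (-2 : ℝ)) * (1 + ‖p.1‖) ^ (2 * (2 : ℝ)) = 1 := by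
      rw [← Real.rpow_add (by positivity)]; norm_num
    linear_combination (logKernel p.1 p.2 * ψ p.1) * e
  have h1 : ∀ x, logPot N x * ψ x = ∫ y, logKernel x y * ψ x ∂N := fun x => by
    rw [integral_mul_const, logPot]
  simp only [h1]
  rw [integral_integral_swap hint, ← integral_const_mul]
  congr 1; ext y
  rw [← integral_log_norm_sub_mul_laplacian hφ hc y]
  have hs1 : Integrable (fun x => Real.log ‖x - y‖ * ψ x) := by
    have := (locallyIntegrable_log_norm_sub y).integrable_smul_right_of_hasCompactSupport hψc hψs
    simpa only [smul_eq_mul] using this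
  have hs2 : Integrable (fun x => Real.log (1 + ‖y‖) * ψ x) :=
    (hψc.integrable_of_hasCompactSupport hψs).const_mul _
  simp only [logKernel, sub_mul]
  rw [integral_sub hs1 hs2, integral_const_mul, integral_laplacian hφ hc, mul_zero, sub_zero]

lemma logPot_le (P : Measure ℂ) [IsFiniteMeasure P] (x : ℂ) :
    logPot P x ≤ P.real univ * Real.log (1 + ‖x‖) := by
  have h0 : 0 ≤ Real.log (1 + ‖x‖) := Real.log_nonneg (by linarith [norm_nonneg x])
  by_cases hi : Integrable (fun y => logKernel x y) P
  · refine (integral_mono hi (integrable_const _) (logKernel_le x)).trans ?_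
    simp
  · rw [logPot, integral_undef hi]; positivity

lemma le_logPot (P : Measure ℂ) [IsFiniteMeasure P] {x : ℂ} {c : ℝ}
    (h : ∀ᵐ y ∂P, c ≤ logKernel x y) : P.real univ * c ≤ logPot P x := by
  have hi : Integrable (fun y => logKernel x y) P := by
    refine Integrable.of_bound (measurable_logKernel_right x).aestronglyMeasurable
      (|c| + |Real.log (1 + ‖x‖)|) ?_
    filter_upwards [h] with y hy
    have h1 := logKernel_le x y
    rw [Real.norm_eq_abs, abs_le]
    have h2 := neg_abs_le c
    have h3 := le_abs_self (Real.log (1 + ‖x‖))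
    have h4 := abs_nonneg c
    have h5 := abs_nonneg (Real.log (1 + ‖x‖))
    constructor <;> linarith
  refine le_trans ?_ (integral_mono_ae (integrable_const c) hi h)
  simp

/-- For `|y| ≤ R` and `|x| ≥ 2R+1` one has `|x-y| ≥ (1+|x|)/2`, so the upper bound `logPot_le` is
attained up to a constant. -/
lemma le_logPot_of_support_closedBall (P : Measure ℂ) [IsFiniteMeasure P] {R : ℝ}
    (hP : P (Metric.closedBall 0 R)ᶜ = 0) :
    ∃ C, ∀ x : ℂ, 2 * R + 1 ≤ ‖x‖ → P.real univ * Real.log (1 + ‖x‖) - C ≤ logPot P x := by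
  refine ⟨P.real univ * (Real.log 2 + Real.log (1 + R)), fun x hx => ?_⟩
  rw [← mul_sub]
  refine le_logPot P ?_
  have : ∀ᵐ y ∂P, y ∈ Metric.closedBall (0 : ℂ) R := by
    rw [ae_iff]; exact hP
  filter_upwards [this] with y hy
  rw [mem_closedBall_zero_iff] at hy
  have h1 := norm_sub_norm_le x y
  have h2 : (1 + ‖x‖) / 2 ≤ ‖x - y‖ := by linarith
  have h3 := Real.log_le_log (by positivity) h2
  rw [Real.log_div (by positivity) (by norm_num)] at h3
  have h4 : Real.log (1 + ‖y‖) ≤ Real.log (1 + R) := Real.log_le_log (by positivity) (by linarith)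
  unfold logKernel
  linarith

/-- Mass at distance at least `δ` from `x` produces no singularity: the ratio `(1+|y|)/|x-y|` is
bounded uniformly in `y`. -/
lemma le_logPot_of_ball_null (P : Measure ℂ) [IsFiniteMeasure P] {x₀ : ℂ} {δ : ℝ}
    (hδ : 0 < δ) (hP : P (Metric.ball x₀ (2 * δ)) = 0) :
    ∃ C, ∀ x ∈ Metric.ball x₀ δ, C ≤ logPot P x := by
  set K := (1 + ‖x₀‖ + δ) / δ + 1 with hK
  refine ⟨P.real univ * (- Real.log K), fun x hx => ?_⟩
  refine le_logPot P ?_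
  have : ∀ᵐ y ∂P, y ∉ Metric.ball x₀ (2 * δ) := by
    exact measure_eq_zero_iff_ae_notMem.1 hP
  filter_upwards [this] with y hy
  rw [Metric.mem_ball, not_lt] at hy
  rw [Metric.mem_ball] at hx
  have h1 : δ ≤ ‖x - y‖ := by
    have h := dist_triangle y x x₀
    rw [dist_comm y x, dist_eq_norm x y] at h
    linarith
  have h2 : 0 < ‖x - y‖ := by linarith
  have h3 : ‖x‖ ≤ ‖x₀‖ + δ := by
    have := norm_sub_norm_le x x₀
    rw [dist_eq_norm] at hx
    linarith
  have h4 : ‖y‖ ≤ ‖x‖ + ‖x - y‖ := by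
    have := norm_sub_norm_le y x
    rw [norm_sub_rev] at this
    linarith
  have h5 : 1 + ‖y‖ ≤ K * ‖x - y‖ := by
    have : 1 + ‖x₀‖ + δ ≤ (1 + ‖x₀‖ + δ) / δ * ‖x - y‖ := by
      rw [div_mul_eq_mul_div, le_div_iff₀ hδ]
      exact mul_le_mul_of_nonneg_left h1 (by positivity)
    rw [hK, add_mul]; linarith
  have hK0 : 0 < K := by positivity
  have h6 := Real.log_le_log (by positivity) h5
  rw [Real.log_mul hK0.ne' h2.ne'] at h6
  unfold logKernel
  linarith

end LogPotential

-- Potentials of rotation invariant measures of possibly infinite mass.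

section RadialPotential

/-- The average of `logKernel x` over the circle of radius `‖y‖`, up to a function of `‖y‖`. -/
noncomputable def radKernel (x y : ℂ) : ℝ := Real.log (max ‖x‖ ‖y‖) - Real.log (max 1 ‖y‖)

/-- The rotation invariant potential of a rotation invariant measure. -/
noncomputable def radPot (P : Measure ℂ) (x : ℂ) : ℝ := ∫ y, radKernel x y ∂P

lemma measurable_radKernel : Measurable (fun p : ℂ × ℂ => radKernel p.1 p.2) := by
  unfold radKernel
  exact (Real.measurable_log.comp (by fun_prop)).sub (Real.measurable_log.comp (by fun_prop))

/-- This is why `radPot` needs only local finiteness: at `x` only the mass in `|y| ≤ max 1 |x|`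
contributes. -/
lemma radKernel_eq_zero {x y : ℂ} (h1 : 1 ≤ ‖y‖) (hx : ‖x‖ ≤ ‖y‖) : radKernel x y = 0 := by
  simp [radKernel, max_eq_right h1, max_eq_right hx]

lemma radPot_eq_setIntegral (P : Measure ℂ) {x : ℂ} {M : ℝ} (hM : 1 ≤ M) (hx : ‖x‖ ≤ M) :
    radPot P x = ∫ y in Metric.closedBall 0 M, radKernel x y ∂P := by
  rw [radPot, setIntegral_eq_integral_of_forall_compl_eq_zero]
  intro y hy
  rw [mem_closedBall_zero_iff, not_le] at hy
  exact radKernel_eq_zero (by linarith) (by linarith)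

lemma measurable_radPot (P : Measure ℂ) [SFinite P] : Measurable (radPot P) :=
  (measurable_radKernel.stronglyMeasurable.integral_prod_right' (ν := P)).measurable

lemma hasDerivAt_log_max {t s : ℝ} (hs : 0 < s) (hst : s ≠ t) :
    HasDerivAt (fun s => Real.log (max s t)) ((Ici t).indicator (fun s => s⁻¹) s) s := by
  rcases lt_or_gt_of_ne hst with h | h
  · rw [indicator_of_notMem (by simpa using h)]
    refine (hasDerivAt_const s (Real.log t)).congr_of_eventuallyEq ?_
    filter_upwards [eventually_lt_nhds h] with u hu
    rw [max_eq_right hu.le]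
  · rw [indicator_of_mem (by exact h.le)]
    refine (Real.hasDerivAt_log hs.ne').congr_of_eventuallyEq ?_
    filter_upwards [eventually_gt_nhds h] with u hu
    rw [max_eq_left (le_of_lt hu)]

lemma intervalIntegrable_inv_one {r : ℝ} (hr : 0 < r) :
    IntervalIntegrable (fun s : ℝ => s⁻¹) volume 1 r := by
  refine ContinuousOn.intervalIntegrable (ContinuousOn.inv₀ continuousOn_id fun s hs => ?_)
  have := lt_of_lt_of_le (lt_min one_pos hr) hs.1
  exact this.ne'

lemma radKernel_eq_integral {x y : ℂ} (hx : x ≠ 0) :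
    radKernel x y = ∫ s in (1 : ℝ)..‖x‖, (Ici ‖y‖).indicator (fun s => s⁻¹) s := by
  have hx' : 0 < ‖x‖ := norm_pos_iff.2 hx
  have hpos : ∀ s ∈ uIcc 1 ‖x‖, 0 < s := fun s hs => lt_of_lt_of_le (lt_min one_pos hx') hs.1
  rw [integral_eq_of_hasDerivAt_off_countable (fun s => Real.log (max s ‖y‖)) _
    (countable_singleton ‖y‖)]
  · rfl
  · refine ContinuousOn.log (by fun_prop) fun s hs => ?_
    exact (lt_max_of_lt_left (hpos s hs)).ne'
  · rintro s ⟨hs, hs'⟩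
    exact hasDerivAt_log_max (hpos s (Ioo_subset_Icc_self hs)) hs'
  · have := intervalIntegrable_inv_one hx'
    exact ⟨this.1.indicator measurableSet_Ici, this.2.indicator measurableSet_Ici⟩

/-- Newton's theorem: the radial derivative of the potential at radius `s` is the mass of the disc
divided by `s`. It follows by Fubini from the same formula for the kernel. -/
lemma radPot_eq_integral (P : Measure ℂ) [IsLocallyFiniteMeasure P] {x : ℂ} (hx : x ≠ 0) :
    radPot P x = ∫ s in (1 : ℝ)..‖x‖, P.real (Metric.closedBall 0 s) * s⁻¹ := by
  have hx' : 0 < ‖x‖ := norm_pos_iff.2 hx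
  set M := max 1 ‖x‖ with hM
  rw [radPot_eq_setIntegral P (le_max_left 1 ‖x‖) (le_max_right 1 ‖x‖), ← hM]
  simp only [radKernel_eq_integral hx, intervalIntegral.intervalIntegral_eq_integral_uIoc]
  rw [integral_smul]
  congr 1
  have hfin : IsFiniteMeasure (P.restrict (Metric.closedBall 0 M)) :=
    ⟨by rw [Measure.restrict_apply_univ]; exact (isCompact_closedBall 0 M).measure_lt_top⟩
  have hfin2 : IsFiniteMeasure ((volume : Measure ℝ).restrict (uIoc 1 ‖x‖)) :=
    ⟨by rw [Measure.restrict_apply_univ]; simp [uIoc]⟩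
  rw [integral_integral_swap]
  · refine setIntegral_congr_fun measurableSet_uIoc fun s hs => ?_
    have hsM : s ≤ M := hs.2
    have h1 : ∀ y : ℂ, (Ici ‖y‖).indicator (fun s : ℝ => s⁻¹) s
        = (Metric.closedBall (0 : ℂ) s).indicator (fun _ => s⁻¹) y := fun y => by
      simp [indicator]
    simp only [h1]
    rw [integral_indicator measurableSet_closedBall, setIntegral_const,
      measureReal_restrict_apply measurableSet_closedBall, smul_eq_mul,
      inter_eq_left.2 (Metric.closedBall_subset_closedBall hsM)]
  · have hmeas : Measurable (fun p : ℂ × ℝ => (Ici ‖p.1‖).indicator (fun s : ℝ => s⁻¹) p.2) := by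
      have : (fun p : ℂ × ℝ => (Ici ‖p.1‖).indicator (fun s : ℝ => s⁻¹) p.2)
          = {p : ℂ × ℝ | ‖p.1‖ ≤ p.2}.indicator (fun p => p.2⁻¹) := by
        ext p; simp [indicator]
      rw [this]
      exact (measurable_snd.inv).indicator (measurableSet_le (by fun_prop) (by fun_prop))
    refine Integrable.of_bound hmeas.aestronglyMeasurable (min 1 ‖x‖)⁻¹ ?_
    rw [Measure.prod_restrict]
    refine ae_restrict_of_forall_mem
      (measurableSet_closedBall.prod measurableSet_uIoc) fun p hp => ?_
    have hp2 : min 1 ‖x‖ < p.2 := hp.2.1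
    have h0 : 0 < min 1 ‖x‖ := lt_min one_pos hx'
    refine (norm_indicator_le_norm_self _ _).trans ?_
    rw [norm_inv, Real.norm_of_nonneg (h0.trans hp2).le]
    exact inv_anti₀ h0 hp2.le

lemma abs_radKernel_le {x y : ℂ} {M : ℝ} (hM : 1 ≤ M) (hx : ‖x‖ ≤ M) (hx0 : x ≠ 0)
    (hy : ‖y‖ ≤ M) : |radKernel x y| ≤ |Real.log ‖x‖| + 2 * Real.log M := by
  have hx' : 0 < ‖x‖ := norm_pos_iff.2 hx0
  have h1 : Real.log ‖x‖ ≤ Real.log (max ‖x‖ ‖y‖) := Real.log_le_log hx' (le_max_left _ _)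
  have h2 : Real.log (max ‖x‖ ‖y‖) ≤ Real.log M :=
    Real.log_le_log (lt_max_of_lt_left hx') (max_le hx hy)
  have h3 : 0 ≤ Real.log (max 1 ‖y‖) := Real.log_nonneg (le_max_left _ _)
  have h4 : Real.log (max 1 ‖y‖) ≤ Real.log M := Real.log_le_log (by positivity) (max_le hM hy)
  have h5 := neg_abs_le (Real.log ‖x‖)
  have h6 := abs_nonneg (Real.log ‖x‖)
  unfold radKernel
  rw [abs_le]; constructor <;> linarith

lemma integrable_radKernel_prod (P : Measure ℂ) [IsLocallyFiniteMeasure P] {M : ℝ} (hM : 1 ≤ M) :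
    Integrable (fun p : ℂ × ℂ => radKernel p.1 p.2)
      (((volume : Measure ℂ).restrict (Metric.closedBall 0 M)).prod
        (P.restrict (Metric.closedBall 0 M))) := by
  have hfin : IsFiniteMeasure (P.restrict (Metric.closedBall 0 M)) :=
    ⟨by rw [Measure.restrict_apply_univ]; exact (isCompact_closedBall 0 M).measure_lt_top⟩
  have h1 : Integrable (fun x : ℂ => |Real.log ‖x‖| + 2 * Real.log M)
      ((volume : Measure ℂ).restrict (Metric.closedBall 0 M)) := by
    refine Integrable.add ?_ (integrableOn_const (isCompact_closedBall _ _).measure_lt_top.ne)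
    exact (locallyIntegrable_log_norm.integrableOn_isCompact (isCompact_closedBall 0 M)).norm
  refine (h1.comp_fst (P.restrict (Metric.closedBall 0 M))).mono
    measurable_radKernel.aestronglyMeasurable ?_
  rw [Measure.prod_restrict]
  have hae : ∀ᵐ p : ℂ × ℂ ∂(volume : Measure ℂ).prod P, p.1 ≠ 0 :=
    Measure.quasiMeasurePreserving_fst.ae (p := fun x : ℂ => x ≠ 0) (by simp [ae_iff])
  filter_upwards [ae_restrict_mem (measurableSet_closedBall.prod measurableSet_closedBall),
    ae_restrict_of_ae hae] with p hp h0
  refine le_trans ?_ (le_abs_self _)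
  exact abs_radKernel_le hM (by simpa using hp.1) h0 (by simpa using hp.2)

lemma locallyIntegrable_radPot (P : Measure ℂ) [IsLocallyFiniteMeasure P] :
    LocallyIntegrable (radPot P) volume := by
  rw [locallyIntegrable_iff]
  intro K hK
  obtain ⟨M, hM, hKM⟩ := hK.isBounded.subset_closedBall_lt 1 0
  refine IntegrableOn.mono_set ?_ hKM
  refine (integrable_radKernel_prod P hM.le).integral_prod_left.congr ?_
  filter_upwards [ae_restrict_mem measurableSet_closedBall] with x hx
  exact (radPot_eq_setIntegral P hM.le (by simpa using hx)).symm

/-- The uniform probability measure on a circle about the origin. -/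
noncomputable def circleMeasure (R : ℝ) : Measure ℂ :=
  (ENNReal.ofReal (2 * Real.pi)⁻¹ • (volume : Measure ℝ).restrict (Ioc 0 (2 * Real.pi))).map
    (circleMap 0 R)

instance (R : ℝ) : IsFiniteMeasure (circleMeasure R) := by
  unfold circleMeasure
  have : IsFiniteMeasure (ENNReal.ofReal (2 * Real.pi)⁻¹ •
      (volume : Measure ℝ).restrict (Ioc 0 (2 * Real.pi))) :=
    Measure.smul_finite _ ENNReal.ofReal_ne_top
  infer_instance

lemma integral_circleMeasure {R : ℝ} {f : ℂ → ℝ} (hf : Measurable f) :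
    ∫ y, f y ∂circleMeasure R = Real.circleAverage f 0 R := by
  rw [circleMeasure, integral_map (by fun_prop) hf.aestronglyMeasurable, integral_smul_measure,
    Real.circleAverage_def, intervalIntegral.integral_of_le Real.two_pi_pos.le,
    ENNReal.toReal_ofReal (by positivity)]

/-- The circle mean of `log|y - x|` is `log max(|x|, R)`. Hence `radKernel x y` is, up to a constant
in `x`, the potential of the uniform measure on the circle through `y`. -/
lemma logPot_circleMeasure {R : ℝ} (hR : 0 < R) (x : ℂ) :
    logPot (circleMeasure R) x = Real.log (max ‖x‖ R) - Real.log (1 + R) := by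
  rw [logPot, integral_circleMeasure (measurable_logKernel_right x)]
  have h1 : Real.circleAverage (fun y => logKernel x y) 0 R
      = Real.circleAverage (fun y => Real.log ‖y - x‖ - Real.log (1 + R)) 0 R := by
    refine Real.circleAverage_congr_sphere fun y hy => ?_
    rw [mem_sphere_zero_iff_norm, abs_of_pos hR] at hy
    simp only [logKernel, hy, norm_sub_rev]
  rw [h1, Real.circleAverage_fun_sub (circleIntegrable_log_norm_sub_const R)
    (circleIntegrable_const _ _ _), Real.circleAverage_const,
    circleAverage_log_norm_sub_const_eq_log_radius_add_posLog hR.ne',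
    Real.posLog_eq_log_max_one (by positivity), ← Real.log_mul hR.ne' (by positivity),
    mul_max_of_nonneg _ _ hR.le]
  simp [hR.ne', max_comm]

lemma integral_radKernel_mul_laplacian {φ : ℂ → ℝ} (hφ : ContDiff ℝ ∞ φ)
    (hc : HasCompactSupport φ) {y : ℂ} (hy : y ≠ 0) :
    ∫ x, radKernel x y * Laplacian.laplacian φ x
      = 2 * Real.pi * Real.circleAverage φ 0 ‖y‖ := by
  have hy' : 0 < ‖y‖ := norm_pos_iff.2 hy
  have h := integral_logPot_mul_laplacian (circleMeasure ‖y‖) hφ hc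
  rw [integral_circleMeasure hφ.continuous.measurable] at h
  have hψc := continuous_laplacian hφ
  have hψs := hasCompactSupport_laplacian hφ hc
  have h1 : ∀ x, radKernel x y * Laplacian.laplacian φ x
      = logPot (circleMeasure ‖y‖) x * Laplacian.laplacian φ x
        + (Real.log (1 + ‖y‖) - Real.log (max 1 ‖y‖)) * Laplacian.laplacian φ x := fun x => by
    rw [logPot_circleMeasure hy', radKernel]; ring
  simp only [h1]
  rw [integral_add, h, integral_const_mul, integral_laplacian hφ hc, mul_zero, add_zero]
  · have := (locallyIntegrable_logPot
      (circleMeasure ‖y‖)).integrable_smul_right_of_hasCompactSupport hψc hψs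
    simpa only [smul_eq_mul] using this
  · exact (hψc.integrable_of_hasCompactSupport hψs).const_mul _

/-- On a ball containing all supports Fubini produces the circle averages of `φ`, and rotation
invariance replaces them by `φ` itself. The point `y = 0`, whose circle is degenerate, is null by
assumption. -/
lemma integral_radPot_mul_laplacian (P : Measure ℂ) [IsLocallyFiniteMeasure P]
    (hrot : ∀ c : ℂ, ‖c‖ = 1 → P.map (fun z => c * z) = P) (h0 : P {0} = 0) {φ : ℂ → ℝ}
    (hφ : ContDiff ℝ ∞ φ) (hc : HasCompactSupport φ) :
    ∫ x, radPot P x * Laplacian.laplacian φ x = 2 * Real.pi * ∫ z, φ z ∂P := by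
  set ψ := Laplacian.laplacian φ with hψ
  have hψc : Continuous ψ := continuous_laplacian hφ
  have hψs : HasCompactSupport ψ := hasCompactSupport_laplacian hφ hc
  obtain ⟨M, hM, hK⟩ := (hc.isBounded.union hψs.isBounded).subset_closedBall_lt 1 0
  have hφM : ∀ z, z ∉ Metric.closedBall (0 : ℂ) M → φ z = 0 := fun z hz =>
    image_eq_zero_of_notMem_tsupport fun h => hz (hK (Or.inl h))
  have hψM : ∀ z, z ∉ Metric.closedBall (0 : ℂ) M → ψ z = 0 := fun z hz =>
    image_eq_zero_of_notMem_tsupport fun h => hz (hK (Or.inr h))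
  set Q := P.restrict (Metric.closedBall 0 M) with hQ
  have hfin : IsFiniteMeasure Q :=
    ⟨by rw [hQ, Measure.restrict_apply_univ]; exact (isCompact_closedBall 0 M).measure_lt_top⟩
  have hQrot : ∀ c : ℂ, ‖c‖ = 1 → Q.map (fun z => c * z) = Q := fun c hc' => by
    have hm : Measurable (fun z : ℂ => c * z) := by fun_prop
    have hpre : (fun z : ℂ => c * z) ⁻¹' Metric.closedBall 0 M = Metric.closedBall 0 M := by
      ext z; simp [hc']
    rw [hQ]
    conv_lhs => rw [← hpre]
    rw [← Measure.restrict_map hm measurableSet_closedBall, hrot c hc']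
  have hφQ : ∫ z, φ z ∂P = ∫ z, φ z ∂Q :=
    (setIntegral_eq_integral_of_forall_compl_eq_zero hφM).symm
  obtain ⟨C, hC⟩ := hψs.exists_bound_of_continuous hψc
  have hint : Integrable (fun p : ℂ × ℂ => radKernel p.1 p.2 * ψ p.1)
      (((volume : Measure ℂ).restrict (Metric.closedBall 0 M)).prod Q) :=
    (integrable_radKernel_prod P hM.le).mul_bdd (c := C) (g := fun p : ℂ × ℂ => ψ p.1)
      (hψc.comp continuous_fst).aestronglyMeasurable (Eventually.of_forall fun p => hC p.1)
  rw [← setIntegral_eq_integral_of_forall_compl_eq_zero (s := Metric.closedBall 0 M)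
    (fun z hz => by rw [hψM z hz, mul_zero])]
  have h1 : ∀ x ∈ Metric.closedBall (0 : ℂ) M,
      radPot P x * ψ x = ∫ y, radKernel x y * ψ x ∂Q := fun x hx => by
    rw [integral_mul_const, radPot_eq_setIntegral P hM.le (by simpa using hx)]
  rw [setIntegral_congr_fun measurableSet_closedBall h1, integral_integral_swap hint, hφQ,
    ← (integral_circleAverage hQrot hφ.continuous
      (hφ.continuous.integrable_of_hasCompactSupport hc)).2, ← integral_const_mul]
  have hae : ∀ᵐ y ∂Q, y ≠ 0 := by
    refine ae_restrict_of_ae ?_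
    rw [ae_iff]; simpa using h0
  refine integral_congr_ae ?_
  filter_upwards [hae] with y hy
  rw [← integral_radKernel_mul_laplacian hφ hc hy,
    setIntegral_eq_integral_of_forall_compl_eq_zero]
  intro z hz
  change radKernel z y * ψ z = 0
  rw [hψM z hz, mul_zero]

lemma tendsto_measureReal_closedBall_zero (P : Measure ℂ) [IsLocallyFiniteMeasure P]
    (h0 : P {0} = 0) :
    Tendsto (fun s => P.real (Metric.closedBall 0 s)) (𝓝[>] 0) (𝓝 0) := by
  have h := tendsto_measure_cthickening_of_isClosed (μ := P) (s := {(0 : ℂ)})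
    ⟨1, one_pos, by
      rw [Metric.cthickening_singleton _ zero_le_one]
      exact (isCompact_closedBall 0 1).measure_lt_top.ne⟩ isClosed_singleton
  rw [h0] at h
  have h2 := (ENNReal.tendsto_toReal ENNReal.zero_ne_top).comp (h.mono_left (nhdsWithin_le_nhds (s := Ioi 0)))
  rw [ENNReal.toReal_zero] at h2
  refine h2.congr' ?_
  filter_upwards [self_mem_nhdsWithin] with s hs
  simp only [Function.comp_apply]
  rw [Metric.cthickening_singleton _ (le_of_lt hs)]
  rfl

/-- Growth of the difference of two radial potentials in terms of the flux through discs. -/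
lemma radPot_sub_le (P N : Measure ℂ) [IsLocallyFiniteMeasure P] [IsLocallyFiniteMeasure N]
    (hP : P {0} = 0) (hN : N {0} = 0) {a ε : ℝ} (hε : 0 < ε)
    (ha : ∀ᶠ s in atTop, P.real (Metric.closedBall 0 s) - N.real (Metric.closedBall 0 s) ≤ a) :
    ∃ C, ∀ x : ℂ, x ≠ 0 → radPot P x - radPot N x
      ≤ C + a * Real.log (1 + ‖x‖) + ε * (Real.log (1 + ‖x‖) - Real.log ‖x‖) := by
  set D : ℝ → ℝ := fun s => P.real (Metric.closedBall 0 s) - N.real (Metric.closedBall 0 s)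
    with hD
  have hmono : ∀ (Q : Measure ℂ) [IsLocallyFiniteMeasure Q],
      Monotone (fun s => Q.real (Metric.closedBall 0 s)) := fun Q _ s t hst =>
    measureReal_mono (Metric.closedBall_subset_closedBall hst)
      (isCompact_closedBall 0 t).measure_lt_top.ne
  have hint : ∀ (Q : Measure ℂ) [IsLocallyFiniteMeasure Q] (r : ℝ), 0 < r →
      IntervalIntegrable (fun s => Q.real (Metric.closedBall 0 s) * s⁻¹) volume 1 r := by
    intro Q _ r hr
    refine IntervalIntegrable.mul_continuousOn (hmono Q).intervalIntegrable ?_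
    refine ContinuousOn.inv₀ continuousOn_id fun s hs => ?_
    exact (lt_of_lt_of_le (lt_min one_pos hr) hs.1).ne'
  have hrep : ∀ x : ℂ, x ≠ 0 → radPot P x - radPot N x = ∫ s in (1 : ℝ)..‖x‖, D s * s⁻¹ := by
    intro x hx
    rw [radPot_eq_integral P hx, radPot_eq_integral N hx, ← intervalIntegral.integral_sub
      (hint P _ (norm_pos_iff.2 hx)) (hint N _ (norm_pos_iff.2 hx))]
    simp only [hD, sub_mul]
  have hDint : ∀ r : ℝ, 0 < r → IntervalIntegrable (fun s => D s * s⁻¹) volume 1 r := by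
    intro r hr
    simp only [hD, sub_mul]
    exact (hint P r hr).sub (hint N r hr)
  obtain ⟨R₀, hR₀⟩ := eventually_atTop.1 ha
  set R := max R₀ 1 with hRdef
  have hR1 : 1 ≤ R := le_max_right _ _
  set B := P.real (Metric.closedBall 0 R) + N.real (Metric.closedBall 0 R) with hB
  have hB0 : 0 ≤ B := by positivity
  have hDB : ∀ s, s ≤ R → |D s| ≤ B := fun s hs => by
    have h1 := hmono P hs
    have h2 := hmono N hs
    have h3 : 0 ≤ P.real (Metric.closedBall 0 s) := measureReal_nonneg
    have h4 : 0 ≤ N.real (Metric.closedBall 0 s) := measureReal_nonneg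
    simp only at h1 h2
    simp only [hD]
    rw [abs_le]; constructor <;> linarith
  have hD0 : Tendsto D (𝓝[>] 0) (𝓝 0) := by
    have := (tendsto_measureReal_closedBall_zero P hP).sub
      (tendsto_measureReal_closedBall_zero N hN)
    simpa using this
  obtain ⟨δ, hδ, hDδ⟩ : ∃ δ > 0, ∀ s ∈ Ioo 0 δ, |D s| < ε := by
    have h1 := hD0.eventually (Metric.ball_mem_nhds 0 hε)
    rw [eventually_nhdsWithin_iff] at h1
    obtain ⟨δ, hδ, h2⟩ := Metric.eventually_nhds_iff_ball.1 h1
    refine ⟨δ, hδ, fun s hs => ?_⟩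
    have := h2 s (by simpa [abs_of_pos hs.1] using hs.2) hs.1
    simpa using this
  -- On `[1, R]`, where the flux bound `a` is not available, `K / s ≥ B + |a|` dominates. Since `K /
  -- s²` is integrable at infinity, the correction costs only a constant.
  set K := R * (B + |a|) with hK
  have hK0 : 0 ≤ K := by positivity
  have hmaj : ∀ s, 1 ≤ s → D s ≤ a + K * s⁻¹ := fun s hs => by
    have hs0 : 0 < s := by linarith
    rcases le_total s R with h | h
    · have h1 := le_trans (le_abs_self _) (hDB s h)
      have h2 : B + |a| ≤ K * s⁻¹ := by
        rw [hK, ← div_eq_mul_inv, le_div_iff₀ hs0, mul_comm]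
        exact mul_le_mul_of_nonneg_right h (by positivity)
      linarith [neg_abs_le a]
    · have h1 := hR₀ s (le_trans (le_max_left _ _) h)
      have : 0 ≤ K * s⁻¹ := by positivity
      simp only [hD]; linarith
  -- Near the origin the flux is below `ε`, which costs `ε |log r|`; on `[δ, 1]` the linear term
  -- dominates and integrates to a bounded quantity.
  have hmin : ∀ s, 0 < s → s ≤ 1 → -D s ≤ ε + B / δ * s := fun s hs hs1 => by
    have h1 := neg_le_abs (D s)
    have h3 : 0 ≤ B / δ * s := by positivity
    rcases lt_or_ge s δ with h | h
    · have := hDδ s ⟨hs, h⟩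
      linarith
    · have h2 := hDB s (by linarith)
      have h4 : B ≤ B / δ * s := by
        rw [div_mul_eq_mul_div, le_div_iff₀ hδ]
        exact mul_le_mul_of_nonneg_left h hB0
      linarith
  have hlog2 : 0 < Real.log 2 := Real.log_pos (by norm_num)
  refine ⟨K + B / δ + |a| * Real.log 2, fun x hx => ?_⟩
  have hx' : 0 < ‖x‖ := norm_pos_iff.2 hx
  set r := ‖x‖ with hr
  have hlr : Real.log r ≤ Real.log (1 + r) := Real.log_le_log hx' (by linarith)
  have hl0 : 0 ≤ Real.log (1 + r) := Real.log_nonneg (by linarith)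
  have hBδ : 0 ≤ B / δ := by positivity
  rw [hrep x hx]
  rcases le_total 1 r with h | h
  · have hcont : ∀ f : ℝ → ℝ, ContinuousOn f (Ici 1) → IntervalIntegrable f volume 1 r :=
      fun f hf => (hf.mono (by rw [uIcc_of_le h]; exact Icc_subset_Ici_self)).intervalIntegrable
    have hne : ∀ s ∈ Ici (1 : ℝ), s ≠ 0 := fun s hs => by
      have : (1 : ℝ) ≤ s := hs
      positivity
    have h1 : ∫ s in (1 : ℝ)..r, D s * s⁻¹ ≤ ∫ s in (1 : ℝ)..r, (a + K * s⁻¹) * s⁻¹ := by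
      refine intervalIntegral.integral_mono_on h (hDint r hx') (hcont _ ?_) fun s hs => ?_
      · have : ContinuousOn (fun s : ℝ => s⁻¹) (Ici 1) := ContinuousOn.inv₀ continuousOn_id hne
        fun_prop
      · have : 0 < s := lt_of_lt_of_le one_pos hs.1
        exact mul_le_mul_of_nonneg_right (hmaj s hs.1) (by positivity)
    have h2 : ∫ s in (1 : ℝ)..r, (a + K * s⁻¹) * s⁻¹
        = (a * Real.log r - K * r⁻¹) - (a * Real.log 1 - K * 1⁻¹) := by
      refine intervalIntegral.integral_eq_sub_of_hasDerivAt (f := fun s => a * Real.log s - K * s⁻¹)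
        (fun s hs => ?_) (hcont _ ?_)
      · rw [uIcc_of_le h] at hs
        have hs0 : s ≠ 0 := hne s hs.1
        refine (((Real.hasDerivAt_log hs0).const_mul a).sub
          ((hasDerivAt_inv hs0).const_mul K)).congr_deriv ?_
        field_simp
        ring
      · have : ContinuousOn (fun s : ℝ => s⁻¹) (Ici 1) := ContinuousOn.inv₀ continuousOn_id hne
        fun_prop
    have h3 : Real.log (1 + r) ≤ Real.log r + Real.log 2 := by
      rw [← Real.log_mul hx'.ne' (by norm_num)]
      exact Real.log_le_log (by linarith) (by linarith)
    have h4 : a * Real.log r ≤ a * Real.log (1 + r) + |a| * Real.log 2 := by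
      have : a * (Real.log r - Real.log (1 + r)) ≤ |a| * Real.log 2 := by
        refine (le_abs_self _).trans ?_
        rw [abs_mul]
        refine mul_le_mul_of_nonneg_left ?_ (abs_nonneg _)
        rw [abs_le]; constructor <;> linarith
      linarith
    have h5 : 0 ≤ K * r⁻¹ := by positivity
    have h6 : 0 ≤ ε * (Real.log (1 + r) - Real.log r) := mul_nonneg hε.le (by linarith)
    rw [h2] at h1
    simp only [Real.log_one, inv_one] at h1
    linarith
  · have hcont : ∀ f : ℝ → ℝ, ContinuousOn f (Ioi 0) → IntervalIntegrable f volume r 1 :=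
      fun f hf => (hf.mono (by
        rw [uIcc_of_le h]; exact fun s hs => lt_of_lt_of_le hx' hs.1)).intervalIntegrable
    have hcinv : ContinuousOn (fun s : ℝ => s⁻¹) (Ioi 0) :=
      ContinuousOn.inv₀ continuousOn_id fun s hs => (ne_of_gt hs)
    have h1 : ∫ s in r..(1 : ℝ), -D s * s⁻¹ ≤ ∫ s in r..(1 : ℝ), (ε + B / δ * s) * s⁻¹ := by
      refine intervalIntegral.integral_mono_on h ?_ (hcont _ (by fun_prop)) fun s hs => ?_
      · simpa only [neg_mul, Pi.neg_def] using (hDint r hx').symm.neg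
      · have : 0 < s := lt_of_lt_of_le hx' hs.1
        exact mul_le_mul_of_nonneg_right (hmin s this hs.2) (by positivity)
    have h2 : ∫ s in r..(1 : ℝ), (ε + B / δ * s) * s⁻¹
        = (ε * Real.log 1 + B / δ * 1) - (ε * Real.log r + B / δ * r) := by
      refine intervalIntegral.integral_eq_sub_of_hasDerivAt
        (f := fun s => ε * Real.log s + B / δ * s) (fun s hs => ?_) (hcont _ (by fun_prop))
      rw [uIcc_of_le h] at hs
      have hs0 : s ≠ 0 := (lt_of_lt_of_le hx' hs.1).ne'
      refine (((Real.hasDerivAt_log hs0).const_mul ε).add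
        ((hasDerivAt_id s).const_mul (B / δ))).congr_deriv ?_
      field_simp
    have h3 : ∫ s in (1 : ℝ)..r, D s * s⁻¹ = ∫ s in r..(1 : ℝ), -D s * s⁻¹ := by
      rw [intervalIntegral.integral_symm, ← intervalIntegral.integral_neg]
      simp only [neg_mul]
    have h4 : Real.log (1 + r) ≤ Real.log 2 := Real.log_le_log (by linarith) (by linarith)
    have h5 : 0 ≤ a * Real.log (1 + r) + |a| * Real.log 2 := by
      have : -(a * Real.log (1 + r)) ≤ |a| * Real.log 2 := by
        refine (neg_le_abs _).trans ?_
        rw [abs_mul, abs_of_nonneg hl0]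
        exact mul_le_mul_of_nonneg_left h4 (abs_nonneg _)
      linarith
    have h6 : 0 ≤ ε * Real.log (1 + r) := by positivity
    have h7 : 0 ≤ B / δ * r := by positivity
    rw [h2] at h1
    rw [Real.log_one] at h1
    rw [h3]
    linarith

end RadialPotential

-- Integrability of `e^{±2h}` against power weights.

section Growth

open scoped ENNReal

lemma logPot_restrict_add_compl (N : Measure ℂ) [IsFiniteMeasure N] {S : Set ℂ}
    (hS : MeasurableSet S) :
    ∀ᵐ x, logPot N x = logPot (N.restrict S) x + logPot (N.restrict Sᶜ) x := by
  filter_upwards [ae_integrable_logKernel N] with x hx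
  exact (integral_add_compl hS hx).symm

lemma exists_ball_measureReal_lt_one (N : Measure ℂ) [IsFiniteMeasure N] {x₀ : ℂ}
    (h : N.real {x₀} < 1) : ∃ δ > 0, N.real (Metric.ball x₀ (2 * δ)) < 1 := by
  have h1 := tendsto_measure_cthickening_of_isClosed (μ := N) (s := {x₀})
    ⟨1, one_pos, measure_ne_top _ _⟩ isClosed_singleton
  have h2 := (ENNReal.tendsto_toReal (measure_ne_top N {x₀})).comp h1
  have h3 := h2.eventually (gt_mem_nhds h)
  obtain ⟨δ, hδ, h4⟩ := Metric.eventually_nhds_iff_ball.1 h3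
  refine ⟨δ / 4, by positivity, ?_⟩
  have h5 := h4 (δ / 2) (by
    rw [Metric.mem_ball, Real.dist_eq, sub_zero, abs_of_pos (by positivity)]; linarith)
  refine lt_of_le_of_lt ?_ h5
  simp only [Function.comp_apply]
  rw [Metric.cthickening_singleton _ (by positivity)]
  refine ENNReal.toReal_mono (measure_ne_top _ _) (measure_mono ?_)
  exact (Metric.ball_subset_ball (by linarith)).trans Metric.ball_subset_closedBall

/-- An atom below one leaves a neighbourhood of mass below one, to which the estimate for small
masses applies. The remaining mass has a potential bounded below near `x₀`. -/
lemma lintegral_exp_logPot_nhds (N : Measure ℂ) [IsFiniteMeasure N] {x₀ : ℂ}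
    (h : N.real {x₀} < 1) : ∃ δ > 0,
      ∫⁻ x in Metric.ball x₀ δ, ENNReal.ofReal (Real.exp (-2 * logPot N x)) < ⊤ := by
  obtain ⟨δ, hδ, hN⟩ := exists_ball_measureReal_lt_one N h
  refine ⟨δ, hδ, ?_⟩
  obtain ⟨C, hC⟩ := le_logPot_of_ball_null (N.restrict (Metric.ball x₀ (2 * δ))ᶜ) hδ
    (by rw [Measure.restrict_apply measurableSet_ball, inter_compl_self, measure_empty])
  have hJ := lintegral_weight_exp_logPot_lt_top (N.restrict (Metric.ball x₀ (2 * δ))) (τ := -2)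
    (by simpa using hN) (by norm_num)
  set K := Real.exp (-2 * C) * (1 + ‖x₀‖ + δ) ^ (4 : ℝ) with hK
  refine lt_of_le_of_lt ?_ (ENNReal.mul_lt_top (ENNReal.ofReal_lt_top (r := K)) hJ)
  rw [← lintegral_const_mul _ (by
    have := measurable_logPot (N.restrict (Metric.ball x₀ (2 * δ)))
    fun_prop)]
  refine le_trans ?_ (setLIntegral_le_lintegral (Metric.ball x₀ δ) _)
  refine lintegral_mono_ae ?_
  filter_upwards [ae_restrict_mem measurableSet_ball,
    ae_restrict_of_ae (logPot_restrict_add_compl N (measurableSet_ball (x := x₀) (ε := 2 * δ)))]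
    with x hx hadd
  rw [← ENNReal.ofReal_mul (by positivity)]
  refine ENNReal.ofReal_le_ofReal ?_
  have h1 := hC x hx
  have h2 : Real.exp (-2 * logPot N x) ≤ Real.exp (-2 * C) *
      Real.exp (-2 * logPot (N.restrict (Metric.ball x₀ (2 * δ))) x) := by
    rw [← Real.exp_add, hadd]
    exact Real.exp_le_exp.2 (by linarith)
  have h3 : 1 ≤ (1 + ‖x₀‖ + δ) ^ (4 : ℝ) * (1 + ‖x‖) ^ (2 * (-2 : ℝ)) := by
    have : (1 + ‖x‖) ^ (4 : ℝ) ≤ (1 + ‖x₀‖ + δ) ^ (4 : ℝ) := by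
      refine Real.rpow_le_rpow (by positivity) ?_ (by norm_num)
      have := norm_sub_norm_le x x₀
      rw [Metric.mem_ball, dist_eq_norm] at hx
      linarith
    rw [show (2 * (-2 : ℝ)) = -4 by norm_num, Real.rpow_neg (by positivity), ← div_eq_mul_inv,
      one_le_div (by positivity)]
    exact this
  refine h2.trans ?_
  rw [hK]
  calc _ = Real.exp (-2 * C) * 1
        * Real.exp (-2 * logPot (N.restrict (Metric.ball x₀ (2 * δ))) x) := by ring
    _ ≤ Real.exp (-2 * C) * ((1 + ‖x₀‖ + δ) ^ (4 : ℝ) * (1 + ‖x‖) ^ (2 * (-2 : ℝ)))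
        * Real.exp (-2 * logPot (N.restrict (Metric.ball x₀ (2 * δ))) x) := by gcongr
    _ = _ := by ring

lemma lintegral_exp_logPot_compact (N : Measure ℂ) [IsFiniteMeasure N]
    (h : ∀ z, N.real {z} < 1) {K : Set ℂ} (hK : IsCompact K) :
    ∫⁻ x in K, ENNReal.ofReal (Real.exp (-2 * logPot N x)) < ⊤ := by
  refine hK.induction_on (p := fun S =>
    ∫⁻ x in S, ENNReal.ofReal (Real.exp (-2 * logPot N x)) < ⊤) (by simp)
    (fun S T hST hT => (lintegral_mono_set hST).trans_lt hT)
    (fun S T hS hT => (lintegral_union_le _ S T).trans_lt (ENNReal.add_lt_top.2 ⟨hS, hT⟩))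
    fun x _ => ?_
  obtain ⟨δ, hδ, hfin⟩ := lintegral_exp_logPot_nhds N (h x)
  exact ⟨_, mem_nhdsWithin_of_mem_nhds (Metric.ball_mem_nhds x hδ), hfin⟩

lemma tendsto_measureReal_closedBall_atTop (N : Measure ℂ) [IsFiniteMeasure N] :
    Tendsto (fun R => N.real (Metric.closedBall 0 R)) atTop (𝓝 (N.real univ)) := by
  have hmono : Monotone (fun R : ℝ => Metric.closedBall (0 : ℂ) R) := fun _ _ h =>
    Metric.closedBall_subset_closedBall h
  have h := tendsto_measure_iUnion_atTop (μ := N) hmono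
  rw [iUnion_eq_univ_iff.2 fun x => ⟨‖x‖, by simp⟩] at h
  exact (ENNReal.tendsto_toReal (measure_ne_top _ _)).comp h

/-- Choose a disc carrying a mass `n > σ + 1` and leaving less than one outside. Far away the inner
mass contributes the power `-n`, so the outer mass meets the weight exponent `τ = σ - n < -1`. On
the remaining compact set only the bound on the atoms matters. -/
lemma lintegral_weight_exp_neg_logPot (N : Measure ℂ) [IsFiniteMeasure N]
    (hN : ∀ z, N.real {z} < 1) {σ : ℝ} (hσ : σ - N.real univ < -1) :
    ∫⁻ x, ENNReal.ofReal ((1 + ‖x‖) ^ (2 * σ) * Real.exp (-2 * logPot N x)) < ⊤ := by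
  have hlim := tendsto_measureReal_closedBall_atTop N
  obtain ⟨R, hR1, hR2, hR0⟩ := ((hlim.eventually (lt_mem_nhds (show σ + 1 < N.real univ by
    linarith))).and ((hlim.eventually (lt_mem_nhds (show N.real univ - 1 < N.real univ by
    linarith))).and (eventually_ge_atTop 0))).exists
  set S := Metric.closedBall (0 : ℂ) R with hS
  have hSm : MeasurableSet S := measurableSet_closedBall
  set n := N.real S with hn
  have hcompl : N.real Sᶜ < 1 := by
    rw [measureReal_compl hSm]; linarith
  obtain ⟨C, hC⟩ := le_logPot_of_support_closedBall (N.restrict S) (R := R)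
    (by rw [Measure.restrict_apply hSm.compl]; simp [hS])
  have hJ := lintegral_weight_exp_logPot_lt_top (N.restrict Sᶜ) (τ := σ - n)
    (by simpa using hcompl) (by linarith)
  rw [← lintegral_add_compl _ (measurableSet_closedBall (x := (0 : ℂ)) (ε := 2 * R + 1))]
  refine ENNReal.add_lt_top.2 ⟨?_, ?_⟩
  · have hcpt := lintegral_exp_logPot_compact N hN (isCompact_closedBall 0 (2 * R + 1))
    have hcont : Continuous (fun x : ℂ => (1 + ‖x‖) ^ (2 * σ)) :=
      Continuous.rpow_const (by fun_prop) fun x => Or.inl (by positivity)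
    obtain ⟨B, hB⟩ := (isCompact_closedBall (0 : ℂ) (2 * R + 1)).exists_bound_of_continuousOn
      hcont.continuousOn
    refine lt_of_le_of_lt ?_ (ENNReal.mul_lt_top (ENNReal.ofReal_lt_top (r := B)) hcpt)
    rw [← lintegral_const_mul _ (by
      have := measurable_logPot N
      fun_prop)]
    refine setLIntegral_mono' measurableSet_closedBall fun x hx => ?_
    rw [ENNReal.ofReal_mul (by positivity)]
    gcongr
    exact (le_abs_self _).trans (hB x hx)
  · refine lt_of_le_of_lt ?_ (ENNReal.mul_lt_top
      (ENNReal.ofReal_lt_top (r := Real.exp (2 * C))) hJ)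
    rw [← lintegral_const_mul _ (by
      have := measurable_logPot (N.restrict Sᶜ)
      fun_prop)]
    refine le_trans ?_ (setLIntegral_le_lintegral (Metric.closedBall (0 : ℂ) (2 * R + 1))ᶜ _)
    refine lintegral_mono_ae ?_
    filter_upwards [ae_restrict_mem measurableSet_closedBall.compl,
      ae_restrict_of_ae (logPot_restrict_add_compl N hSm)] with x hx hadd
    rw [← ENNReal.ofReal_mul (by positivity)]
    refine ENNReal.ofReal_le_ofReal ?_
    rw [mem_compl_iff, mem_closedBall_zero_iff, not_le] at hx
    have h1 := hC x hx.le
    have hm : (N.restrict S).real univ = n := by simp [hn]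
    rw [hm] at h1
    have h0 : 0 < 1 + ‖x‖ := by positivity
    rw [Real.rpow_def_of_pos h0, Real.rpow_def_of_pos h0, ← Real.exp_add, ← Real.exp_add,
      ← Real.exp_add, hadd]
    refine Real.exp_le_exp.2 ?_
    linarith

/-- The potential of `P` is bounded above pointwise, so `P` only shifts the weight exponent; its
atoms are irrelevant. -/
lemma lintegral_weight_exp_logPot_sub (P N : Measure ℂ) [IsFiniteMeasure P] [IsFiniteMeasure N]
    (hN : ∀ z, N.real {z} < 1) {s : ℝ} (hs : s + P.real univ - N.real univ < -1) :
    ∫⁻ x, ENNReal.ofReal ((1 + ‖x‖) ^ (2 * s) * Real.exp (2 * (logPot P x - logPot N x))) < ⊤ := by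
  refine lt_of_le_of_lt (lintegral_mono fun x => ENNReal.ofReal_le_ofReal ?_)
    (lintegral_weight_exp_neg_logPot N hN hs)
  have h0 : 0 < 1 + ‖x‖ := by positivity
  rw [Real.rpow_def_of_pos h0, Real.rpow_def_of_pos h0, ← Real.exp_add, ← Real.exp_add]
  refine Real.exp_le_exp.2 ?_
  have := logPot_le P x
  linarith

/-- The exponential weight `e^h` has the growth of `|x|^Φ` in the integrated sense. -/
structure RegularWeight (h : ℂ → ℝ) (Φ : EReal) : Prop where
  meas : AEStronglyMeasurable h volume
  up : ∀ s : ℝ, (s : EReal) + Φ < ((-1 : ℝ) : EReal) →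
    MemLp (fun x : ℂ => (1 + ‖x‖) ^ s * Real.exp (h x)) 2 volume
  down : ∀ s : ℝ, (s : EReal) + -Φ < ((-1 : ℝ) : EReal) →
    MemLp (fun x : ℂ => (1 + ‖x‖) ^ s * Real.exp (-h x)) 2 volume

lemma RegularWeight.neg {h : ℂ → ℝ} {Φ : EReal} (H : RegularWeight h Φ) :
    RegularWeight (fun x => -h x) (-Φ) :=
  ⟨H.meas.neg, H.down, fun s hs => by
    rw [neg_neg] at hs
    simpa using H.up s hs⟩

lemma RegularWeight.comp_conj {h : ℂ → ℝ} {Φ : EReal} (H : RegularWeight h Φ) :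
    RegularWeight (fun x => h (starRingEnd ℂ x)) Φ := by
  have hmp : MeasurePreserving (starRingEnd ℂ) (volume : Measure ℂ) volume :=
    Complex.conjLIE.measurePreserving
  refine ⟨H.meas.comp_measurePreserving hmp, fun s hs => ?_, fun s hs => ?_⟩
  · have := (H.up s hs).comp_measurePreserving hmp
    simpa [Function.comp_def] using this
  · have := (H.down s hs).comp_measurePreserving hmp
    simpa [Function.comp_def] using this

/-- The potential generating the field `Pr - Nr + Pt - Nt`. -/
noncomputable def fieldPot (Pr Nr Pt Nt : Measure ℂ) (x : ℂ) : ℝ :=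
  (2 * Real.pi)⁻¹ * (radPot Pr x - radPot Nr x + (logPot Pt x - logPot Nt x))

lemma fieldPot_neg (Pr Nr Pt Nt : Measure ℂ) (x : ℂ) :
    -fieldPot Pr Nr Pt Nt x = fieldPot Nr Pr Nt Pt x := by
  unfold fieldPot; ring

lemma logPot_smul (c : ℝ≥0∞) (P : Measure ℂ) (x : ℂ) :
    logPot (c • P) x = c.toReal * logPot P x := by
  simp [logPot, integral_smul_measure]

/-- The radial bound leaves a singularity `-(1/4) log|x|` at the origin. It is absorbed by adding a
point mass `1/4` at `0` to the negative measure: the atoms stay below `1/2 + 1/4 < 1`, and at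
infinity the added mass cancels the extra `(1/4) log(1+|x|)` of the same bound. -/
lemma memLp_weight_exp_fieldPot (Pr Nr Pt Nt : Measure ℂ) [IsLocallyFiniteMeasure Pr]
    [IsLocallyFiniteMeasure Nr] [IsFiniteMeasure Pt] [IsFiniteMeasure Nt] (hPr : Pr {0} = 0)
    (hNr : Nr {0} = 0) (hNt : ∀ z, Nt.real {z} ≤ Real.pi) {Φrad : EReal}
    (hlim : Tendsto (fun R : ℝ => (((Pr.real (Metric.closedBall 0 R)
      - Nr.real (Metric.closedBall 0 R)) / (2 * Real.pi) : ℝ) : EReal)) atTop (𝓝 Φrad)) {s : ℝ}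
    (hs : (s : EReal) + (Φrad + (((Pt.real univ - Nt.real univ) / (2 * Real.pi) : ℝ) : EReal))
      < ((-1 : ℝ) : EReal)) :
    MemLp (fun x : ℂ => (1 + ‖x‖) ^ s * Real.exp (fieldPot Pr Nr Pt Nt x)) 2 volume := by
  have hπ := Real.pi_pos
  set t := (Pt.real univ - Nt.real univ) / (2 * Real.pi) with ht
  -- The strict inequality leaves room for a real `a` above `Φrad`, which then bounds the flux
  -- through all large discs. This also treats `Φrad = -∞`.
  obtain ⟨a, ha1, ha2⟩ : ∃ a : ℝ, Φrad < a ∧ s + a + t < -1 := by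
    induction Φrad with
    | bot => exact ⟨-2 - s - t, EReal.bot_lt_coe _, by linarith⟩
    | top =>
      rw [EReal.top_add_coe, EReal.coe_add_top] at hs
      exact absurd hs (by simp)
    | coe r =>
      rw [← EReal.coe_add, ← EReal.coe_add, EReal.coe_lt_coe_iff] at hs
      refine ⟨r + (-1 - (s + (r + t))) / 2, ?_, by linarith⟩
      rw [EReal.coe_lt_coe_iff]; linarith
  have hev : ∀ᶠ R in atTop, Pr.real (Metric.closedBall 0 R) - Nr.real (Metric.closedBall 0 R)
      ≤ 2 * Real.pi * a := by
    filter_upwards [hlim.eventually (gt_mem_nhds ha1)] with R hR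
    rw [EReal.coe_lt_coe_iff, div_lt_iff₀ (by positivity)] at hR
    linarith
  obtain ⟨C, hC⟩ := radPot_sub_le Pr Nr hPr hNr (ε := 2 * Real.pi * (1 / 4)) (by positivity) hev
  set c : ℝ≥0∞ := ENNReal.ofReal (2 * Real.pi)⁻¹ with hc
  have hcr : c.toReal = (2 * Real.pi)⁻¹ := ENNReal.toReal_ofReal (by positivity)
  have hctop : c ≠ ⊤ := ENNReal.ofReal_ne_top
  set e : ℝ≥0∞ := ENNReal.ofReal (1 / 4) with he
  have her : e.toReal = 1 / 4 := ENNReal.toReal_ofReal (by norm_num)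
  set P := c • Pt with hP
  set N := c • Nt + e • Measure.dirac (0 : ℂ) with hN
  have hPf : IsFiniteMeasure P := Measure.smul_finite _ hctop
  have hNf1 : IsFiniteMeasure (c • Nt) := Measure.smul_finite _ hctop
  have hNf2 : IsFiniteMeasure (e • Measure.dirac (0 : ℂ)) :=
    Measure.smul_finite _ ENNReal.ofReal_ne_top
  have hNreal : ∀ A, MeasurableSet A → N.real A = (2 * Real.pi)⁻¹ * Nt.real A
      + 1 / 4 * (Measure.dirac (0 : ℂ)).real A := fun A hA => by
    rw [hN, measureReal_add_apply, measureReal_ennreal_smul_apply, measureReal_ennreal_smul_apply,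
      hcr, her]
  have hatom : ∀ z, N.real {z} < 1 := fun z => by
    rw [hNreal _ (measurableSet_singleton z)]
    have h1 : (2 * Real.pi)⁻¹ * Nt.real {z} ≤ 1 / 2 := by
      rw [inv_mul_le_iff₀ (by positivity)]; linarith [hNt z]
    have h2 : (Measure.dirac (0 : ℂ)).real {z} ≤ 1 := measureReal_le_one
    linarith
  have hmass : s + (a + 1 / 4) + P.real univ - N.real univ < -1 := by
    rw [hNreal _ MeasurableSet.univ, hP, measureReal_ennreal_smul_apply, hcr]
    have h2 : (Measure.dirac (0 : ℂ)).real univ = 1 := by simp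
    rw [h2]
    have : t = (2 * Real.pi)⁻¹ * Pt.real univ - (2 * Real.pi)⁻¹ * Nt.real univ := by
      rw [ht]; field_simp
    linarith
  have hfin := lintegral_weight_exp_logPot_sub P N hatom hmass
  have hmeas : Measurable (fun x : ℂ => fieldPot Pr Nr Pt Nt x) :=
    (((measurable_radPot Pr).sub (measurable_radPot Nr)).add
      ((measurable_logPot Pt).sub (measurable_logPot Nt))).const_mul _
  have hm2 : Measurable (fun x : ℂ => (1 + ‖x‖) ^ s * Real.exp (fieldPot Pr Nr Pt Nt x)) := by
    fun_prop
  rw [memLp_two_iff_integrable_sq hm2.aestronglyMeasurable]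
  refine ⟨(hm2.pow_const 2).aestronglyMeasurable, ?_⟩
  rw [hasFiniteIntegral_iff_ofReal (Eventually.of_forall fun x => by positivity)]
  refine lt_of_le_of_lt ?_ (ENNReal.mul_lt_top
    (ENNReal.ofReal_lt_top (r := Real.exp (2 * ((2 * Real.pi)⁻¹ * C)))) hfin)
  rw [← lintegral_const_mul _ (by
      have := measurable_logPot P
      have := measurable_logPot N
      fun_prop)]
  have hx0 : ∀ᵐ x : ℂ, x ≠ 0 := by simp [ae_iff]
  refine lintegral_mono_ae ?_
  filter_upwards [hx0, ae_integrable_logKernel (c • Nt),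
    ae_integrable_logKernel (e • Measure.dirac (0 : ℂ))] with x hx hi1 hi2
  rw [← ENNReal.ofReal_mul (by positivity)]
  refine ENNReal.ofReal_le_ofReal ?_
  have hN' : logPot N x = (2 * Real.pi)⁻¹ * logPot Nt x + 1 / 4 * Real.log ‖x‖ := by
    rw [hN, logPot, integral_add_measure hi1 hi2]
    change logPot (c • Nt) x + logPot (e • Measure.dirac (0 : ℂ)) x = _
    rw [logPot_smul, logPot_smul, hcr, her]
    simp [logPot, logKernel]
  have hP' : logPot P x = (2 * Real.pi)⁻¹ * logPot Pt x := by rw [hP, logPot_smul, hcr]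
  have h1 := mul_le_mul_of_nonneg_left (hC x hx) (by positivity : 0 ≤ (2 * Real.pi)⁻¹)
  have h2 : (2 * Real.pi)⁻¹ * (C + 2 * Real.pi * a * Real.log (1 + ‖x‖)
      + 2 * Real.pi * (1 / 4) * (Real.log (1 + ‖x‖) - Real.log ‖x‖))
      = (2 * Real.pi)⁻¹ * C + a * Real.log (1 + ‖x‖)
        + 1 / 4 * (Real.log (1 + ‖x‖) - Real.log ‖x‖) := by
    field_simp
  rw [h2] at h1
  have h0 : 0 < 1 + ‖x‖ := by positivity
  rw [mul_pow, ← Real.rpow_natCast, ← Real.rpow_mul h0.le, ← Real.exp_nat_mul,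
    Real.rpow_def_of_pos h0, Real.rpow_def_of_pos h0, ← Real.exp_add, ← Real.exp_add,
    ← Real.exp_add]
  refine Real.exp_le_exp.2 ?_
  rw [hP', hN', fieldPot]
  push_cast
  linarith

theorem regularWeight_fieldPot (Pr Nr Pt Nt : Measure ℂ) [IsLocallyFiniteMeasure Pr]
    [IsLocallyFiniteMeasure Nr] [IsFiniteMeasure Pt] [IsFiniteMeasure Nt] (hPr : Pr {0} = 0)
    (hNr : Nr {0} = 0) (hPt : ∀ z, Pt.real {z} ≤ Real.pi) (hNt : ∀ z, Nt.real {z} ≤ Real.pi)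
    {Φrad : EReal}
    (hlim : Tendsto (fun R : ℝ => (((Pr.real (Metric.closedBall 0 R)
      - Nr.real (Metric.closedBall 0 R)) / (2 * Real.pi) : ℝ) : EReal)) atTop (𝓝 Φrad)) :
    RegularWeight (fieldPot Pr Nr Pt Nt)
      (Φrad + (((Pt.real univ - Nt.real univ) / (2 * Real.pi) : ℝ) : EReal)) := by
  have hmeas : Measurable (fun x : ℂ => fieldPot Pr Nr Pt Nt x) :=
    (((measurable_radPot Pr).sub (measurable_radPot Nr)).add
      ((measurable_logPot Pt).sub (measurable_logPot Nt))).const_mul _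
  refine ⟨hmeas.aestronglyMeasurable, fun s hs => memLp_weight_exp_fieldPot Pr Nr Pt Nt hPr hNr
    hNt hlim hs, fun s hs => ?_⟩
  simp only [fieldPot_neg]
  refine memLp_weight_exp_fieldPot Nr Pr Nt Pt hNr hPr hPt (Φrad := -Φrad) ?_ ?_
  · have := (continuous_neg.tendsto Φrad).comp hlim
    refine this.congr fun R => ?_
    simp only [Function.comp_apply]
    rw [← EReal.coe_neg, ← neg_div, neg_sub]
  · rw [EReal.neg_add (Or.inr (EReal.coe_ne_top _)) (Or.inr (EReal.coe_ne_bot _)),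
      sub_eq_add_neg, ← EReal.coe_neg, ← neg_div, neg_sub] at hs
    exact hs

end Growth

-- Entire functions square integrable against `e^{2h}`.

section Dimension

open scoped Nat

/-- Entire functions that are square integrable against `e^{2h}`. -/
noncomputable def HolL2 (h : ℂ → ℝ) : Submodule ℂ (ℂ → ℂ) where
  carrier := {f | Differentiable ℂ f ∧ MemLp (fun z => (Real.exp (h z) : ℂ) * f z) 2 volume}
  add_mem' := fun {f g} hf hg => ⟨hf.1.add hg.1, by
    have := hf.2.add hg.2
    simp only [Pi.add_def, ← mul_add] at this
    exact this⟩
  zero_mem' := ⟨differentiable_const 0, by simp⟩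
  smul_mem' := fun c f hf => ⟨hf.1.const_smul c, by
    have := hf.2.const_mul c
    simp only [mul_left_comm c] at this
    exact this⟩

/-- The dimension of `HolL2 h`. -/
noncomputable def dimHol (h : ℂ → ℝ) : ℕ∞ := Cardinal.toENat (Module.rank ℂ (HolL2 h))

/-- Cauchy's estimate with the circle mean of `|f|` instead of its maximum, so that it can be
integrated over the radii. -/
lemma norm_iteratedDeriv_mul_pow_le {f : ℂ → ℂ} (hf : Differentiable ℂ f) (k : ℕ) {R : ℝ}
    (hR : 0 < R) : ‖iteratedDeriv k f 0‖ / k ! * R ^ k ≤ Real.circleAverage (fun z => ‖f z‖) 0 R := by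
  lift R to NNReal using hR.le
  have hps := hf.hasFPowerSeriesOnBall 0 (R := R) (by exact_mod_cast hR)
  have h1 := hps.factorial_smul 1 k
  have h2 := norm_cauchyPowerSeries_le f 0 R k
  have h3 : ‖iteratedDeriv k f 0‖ ≤ k ! * ‖cauchyPowerSeries f 0 R k‖ := by
    rw [iteratedDeriv_eq_iteratedFDeriv, ← h1, nsmul_eq_mul, norm_mul, Complex.norm_natCast]
    refine mul_le_mul_of_nonneg_left ?_ (by positivity)
    refine (ContinuousMultilinearMap.le_opNorm _ _).trans ?_
    simp
  rw [abs_of_pos hR] at h2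
  have h4 : ‖iteratedDeriv k f 0‖ / k ! ≤ ‖cauchyPowerSeries f 0 R k‖ := by
    rw [div_le_iff₀ (by positivity), mul_comm]; exact h3
  refine (mul_le_mul_of_nonneg_right (h4.trans h2) (by positivity)).trans (le_of_eq ?_)
  rw [Real.circleAverage_def, smul_eq_mul, mul_assoc _ _ ((R : ℝ) ^ k), ← mul_pow,
    inv_mul_cancel₀ hR.ne', one_pow, mul_one]

lemma not_integrable_pow_mul_rpow {k : ℕ} {s : ℝ} (hks : -2 ≤ k + s) :
    ¬ Integrable (fun x : ℂ => ‖x‖ ^ k * (1 + ‖x‖) ^ s) := by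
  intro h
  rw [integrable_radial_iff (f := fun r => r ^ k * (1 + r) ^ s)] at h
  refine not_integrableOn_Ioi_inv (a := 1) ?_
  -- For `r > 1` the ratio `(1+r)/r` lies between `1` and `2`, so `min 1 (2^s)` bounds `((1+r)/r)^s`
  -- from below for either sign of `s`.
  have h1 := (h.mono_set (Ioi_subset_Ioi zero_le_one)).const_mul (min 1 (2 ^ s))⁻¹
  refine h1.mono' (by fun_prop) ?_
  filter_upwards [ae_restrict_mem measurableSet_Ioi] with r hr
  have hr1 : 1 < r := hr
  have hr0 : 0 < r := by linarith
  have hmin : 0 < min (1 : ℝ) (2 ^ s) := lt_min one_pos (by positivity)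
  have h2 : min 1 (2 ^ s) * r ^ s ≤ (1 + r) ^ s := by
    rcases le_total 0 s with hs | hs
    · refine (mul_le_mul_of_nonneg_right (min_le_left _ _) (by positivity)).trans ?_
      rw [one_mul]
      exact Real.rpow_le_rpow hr0.le (by linarith) hs
    · refine (mul_le_mul_of_nonneg_right (min_le_right _ _) (by positivity)).trans ?_
      rw [← Real.mul_rpow (by norm_num) hr0.le]
      exact Real.rpow_le_rpow_of_nonpos (by positivity) (by linarith) hs
  rw [Real.norm_of_nonneg (by positivity)]
  have h3 : r⁻¹ ≤ r * (r ^ k * r ^ s) := by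
    have : r * (r ^ k * r ^ s) = r ^ (1 + (k + s)) := by
      rw [Real.rpow_add hr0, Real.rpow_add hr0, Real.rpow_one, Real.rpow_natCast]
    rw [this, ← Real.rpow_neg_one]
    exact Real.rpow_le_rpow_of_exponent_le hr1.le (by linarith)
  refine h3.trans ?_
  rw [le_inv_mul_iff₀ hmin]
  calc _ = r * (r ^ k * (min 1 (2 ^ s) * r ^ s)) := by ring
    _ ≤ _ := by gcongr

/-- An entire function integrable against a power weight is a polynomial. -/
lemma iteratedDeriv_eq_zero_of_integrable {f : ℂ → ℂ} (hf : Differentiable ℂ f) {k : ℕ} {s : ℝ}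
    (hks : -2 ≤ k + s) (hi : Integrable (fun x : ℂ => (1 + ‖x‖) ^ s * ‖f x‖)) :
    iteratedDeriv k f 0 = 0 := by
  by_contra hne
  have hcont : Continuous (fun x : ℂ => (1 + ‖x‖) ^ s * ‖f x‖) :=
    (Continuous.rpow_const (by fun_prop) fun x => Or.inl (by positivity)).mul hf.continuous.norm
  have h1 := (integral_circleAverage volume_rotate hcont hi).1
  have hc : 0 < ‖iteratedDeriv k f 0‖ / k ! := by positivity
  refine not_integrable_pow_mul_rpow hks ((h1.const_mul (‖iteratedDeriv k f 0‖ / k !)⁻¹).mono' ?_ ?_)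
  · exact (Continuous.mul (by fun_prop) (Continuous.rpow_const (by fun_prop) fun x =>
      Or.inl (by positivity))).aestronglyMeasurable
  have hx0 : ∀ᵐ x : ℂ, x ≠ 0 := by simp [ae_iff]
  filter_upwards [hx0] with x hx
  have hx' : 0 < ‖x‖ := norm_pos_iff.2 hx
  rw [Real.norm_of_nonneg (by positivity), le_inv_mul_iff₀ hc]
  have h2 : Real.circleAverage (fun z : ℂ => (1 + ‖z‖) ^ s * ‖f z‖) 0 ‖x‖
      = (1 + ‖x‖) ^ s * Real.circleAverage (fun z => ‖f z‖) 0 ‖x‖ := by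
    rw [← smul_eq_mul, ← Real.circleAverage_fun_smul]
    refine Real.circleAverage_congr_sphere fun z hz => ?_
    rw [mem_sphere_zero_iff_norm, abs_norm] at hz
    simp [hz]
  rw [h2]
  have h3 := mul_le_mul_of_nonneg_left (norm_iteratedDeriv_mul_pow_le hf k hx')
    (by positivity : 0 ≤ (1 + ‖x‖) ^ s)
  linarith

/-- Cauchy–Schwarz for the product of `e^h f` and `(1+|x|)^{-2-k} e^{-h}`; the second factor is
square integrable because `-2 - k - Φ < -1`. -/
lemma RegularWeight.iteratedDeriv_eq_zero {h : ℂ → ℝ} {Φ : EReal} (H : RegularWeight h Φ)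
    {f : ℂ → ℂ} (hf : f ∈ HolL2 h) {k : ℕ} (hk : ((-1 : ℝ) : EReal) < ((k : ℝ) : EReal) + Φ) :
    iteratedDeriv k f 0 = 0 := by
  refine iteratedDeriv_eq_zero_of_integrable hf.1 (s := -2 - k) (by linarith) ?_
  have h1 := H.down (-2 - k) (by
    induction Φ with
    | bot => simp at hk
    | top => simpa using EReal.bot_lt_coe (-1)
    | coe r =>
      rw [← EReal.coe_add, EReal.coe_lt_coe_iff] at hk
      rw [← EReal.coe_neg, ← EReal.coe_add, EReal.coe_lt_coe_iff]
      linarith)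
  have h2 := h1.integrable_mul hf.2.norm
  refine h2.congr (Eventually.of_forall fun x => ?_)
  simp only [Pi.mul_apply, norm_mul, Complex.norm_real, Real.norm_eq_abs, Real.abs_exp,
    Real.exp_neg]
  field_simp

lemma RegularWeight.pow_mem {h : ℂ → ℝ} {Φ : EReal} (H : RegularWeight h Φ) {k : ℕ}
    (hk : ((k : ℝ) : EReal) + Φ < ((-1 : ℝ) : EReal)) : (fun z : ℂ => z ^ k) ∈ HolL2 h := by
  refine ⟨differentiable_pow k, (H.up k hk).mono ?_ (Eventually.of_forall fun x => ?_)⟩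
  · have := H.meas
    refine AEStronglyMeasurable.mul ?_ (by fun_prop)
    exact Complex.continuous_ofReal.comp_aestronglyMeasurable
      (Real.continuous_exp.comp_aestronglyMeasurable this)
  · rw [norm_mul, norm_mul, Complex.norm_real, mul_comm, norm_pow, Real.rpow_natCast,
      Real.norm_of_nonneg (by positivity : 0 ≤ (1 + ‖x‖) ^ k)]
    gcongr
    linarith

lemma iteratedDeriv_add_apply {f g : ℂ → ℂ} (hf : Differentiable ℂ f) (hg : Differentiable ℂ g)
    (k : ℕ) : iteratedDeriv k (f + g) 0 = iteratedDeriv k f 0 + iteratedDeriv k g 0 :=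
  iteratedDeriv_add hf.contDiff.contDiffAt hg.contDiff.contDiffAt

/-- The first `K` Taylor coefficients (without the factorials). -/
noncomputable def taylorMap (h : ℂ → ℝ) (K : ℕ) : HolL2 h →ₗ[ℂ] (Fin K → ℂ) where
  toFun f i := iteratedDeriv i (f : ℂ → ℂ) 0
  map_add' f g := by
    ext i
    exact iteratedDeriv_add_apply f.2.1 g.2.1 i
  map_smul' c f := by
    ext i
    simp [iteratedDeriv_const_smul_field]

lemma taylorMap_surjective {h : ℂ → ℝ} {K : ℕ} (hmem : ∀ k < K, (fun z : ℂ => z ^ k) ∈ HolL2 h) :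
    Function.Surjective (taylorMap h K) := by
  intro c
  refine ⟨∑ j : Fin K, (c j / ((j : ℕ)! : ℂ)) • ⟨fun z => z ^ (j : ℕ), hmem j j.2⟩, ?_⟩
  rw [map_sum]
  ext i
  simp only [map_smul, Finset.sum_apply, Pi.smul_apply, smul_eq_mul, taylorMap, LinearMap.coe_mk,
    AddHom.coe_mk, iteratedDeriv_fun_pow_zero]
  rw [Finset.sum_eq_single i]
  · simp [Nat.factorial_ne_zero]
  · intro j _ hj
    have : (i : ℕ) ≠ j := fun h => hj (Fin.ext h.symm)
    simp [this]
  · simp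

/-- The first `K` Taylor coefficients are coordinates: they determine `f` because the others vanish,
and the monomials realise all values. -/
lemma dimHol_eq_of_pow_mem {h : ℂ → ℝ} {K : ℕ} (hmem : ∀ k < K, (fun z : ℂ => z ^ k) ∈ HolL2 h)
    (hz : ∀ f ∈ HolL2 h, ∀ k, K ≤ k → iteratedDeriv k f 0 = 0) : dimHol h = K := by
  have hinj : Function.Injective (taylorMap h K) := by
    rw [← LinearMap.ker_eq_bot, LinearMap.ker_eq_bot']
    intro f hf
    have h0 : ∀ k, iteratedDeriv k (f : ℂ → ℂ) 0 = 0 := fun k => by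
      rcases lt_or_ge k K with hk | hk
      · exact congrFun hf ⟨k, hk⟩
      · exact hz f f.2 k hk
    ext z
    have := Complex.taylorSeries_eq_of_entire' 0 z f.2.1
    rw [← this]
    simp [h0]
  have e := LinearEquiv.ofBijective (taylorMap h K) ⟨hinj, taylorMap_surjective hmem⟩
  rw [dimHol, e.rank_eq]
  simp

lemma le_dimHol {h : ℂ → ℝ} {K : ℕ} (hmem : ∀ k < K, (fun z : ℂ => z ^ k) ∈ HolL2 h) :
    (K : ℕ∞) ≤ dimHol h := by
  have := (taylorMap h K).rank_le_of_surjective (taylorMap_surjective hmem)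
  have h2 := Cardinal.toENat.monotone' this
  simpa [dimHol] using h2

lemma dimHol_eq_top {h : ℂ → ℝ} (hmem : ∀ k : ℕ, (fun z : ℂ => z ^ k) ∈ HolL2 h) :
    dimHol h = ⊤ :=
  ENat.eq_top_iff_forall_ge.2 fun _ => le_dimHol fun k _ => hmem k

lemma RegularWeight.dimHol_bot {h : ℂ → ℝ} (H : RegularWeight h ⊥) : dimHol h = ⊤ :=
  dimHol_eq_top fun k => H.pow_mem (by simpa using EReal.bot_lt_coe (-1))

lemma RegularWeight.dimHol_eq_zero {h : ℂ → ℝ} {Φ : EReal} (H : RegularWeight h Φ)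
    (hΦ : ((-1 : ℝ) : EReal) < Φ) : dimHol h = 0 := by
  refine dimHol_eq_of_pow_mem (K := 0) (by simp) fun f hf k _ => H.iteratedDeriv_eq_zero hf ?_
  refine hΦ.trans_le ?_
  have : (0 : EReal) ≤ ((k : ℝ) : EReal) := by exact_mod_cast Nat.cast_nonneg (α := ℝ) k
  simpa using add_le_add_left this Φ

lemma RegularWeight.dimHol_eq {h : ℂ → ℝ} {r : ℝ} (H : RegularWeight h r) {K : ℕ}
    (h1 : K + r < 0) (h2 : -1 < K + r) : dimHol h = K := by
  refine dimHol_eq_of_pow_mem (fun k hk => H.pow_mem ?_) fun f hf k hk =>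
    H.iteratedDeriv_eq_zero hf ?_
  · rw [← EReal.coe_add, EReal.coe_lt_coe_iff]
    have : (k : ℝ) + 1 ≤ K := by exact_mod_cast hk
    linarith
  · rw [← EReal.coe_add, EReal.coe_lt_coe_iff]
    have : (K : ℝ) ≤ k := by exact_mod_cast hk
    linarith

lemma RegularWeight.dimHol_integer_of_mem {h : ℂ → ℝ} {K : ℕ}
    (H : RegularWeight h ((-(K + 1) : ℝ) : EReal))
    (hmem : (fun z : ℂ => z ^ K) ∈ HolL2 h) : dimHol h = (K + 1 : ℕ) := by
  refine dimHol_eq_of_pow_mem (fun k hk => ?_) fun f hf k hk => H.iteratedDeriv_eq_zero hf ?_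
  · rcases (Nat.lt_succ_iff_lt_or_eq.1 hk) with hk | rfl
    · refine H.pow_mem ?_
      rw [← EReal.coe_add, EReal.coe_lt_coe_iff]
      have : (k : ℝ) < K := by exact_mod_cast hk
      linarith
    · exact hmem
  · rw [← EReal.coe_add, EReal.coe_lt_coe_iff]
    have : (K + 1 : ℝ) ≤ k := by exact_mod_cast hk
    linarith

/-- The space consists of polynomials of degree at most `K`. From one of exact degree `K`,
subtracting the admissible lower monomials would produce `z^K`. -/
lemma RegularWeight.dimHol_integer_of_notMem {h : ℂ → ℝ} {K : ℕ}
    (H : RegularWeight h ((-(K + 1) : ℝ) : EReal))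
    (hmem : (fun z : ℂ => z ^ K) ∉ HolL2 h) : dimHol h = K := by
  have hlow : ∀ k < K, (fun z : ℂ => z ^ k) ∈ HolL2 h := fun k hk => H.pow_mem (by
    rw [← EReal.coe_add, EReal.coe_lt_coe_iff]
    have : (k : ℝ) < K := by exact_mod_cast hk
    linarith)
  have hhigh : ∀ f ∈ HolL2 h, ∀ k, K + 1 ≤ k → iteratedDeriv k f 0 = 0 := fun f hf k hk =>
    H.iteratedDeriv_eq_zero hf (by
      rw [← EReal.coe_add, EReal.coe_lt_coe_iff]
      have : (K + 1 : ℝ) ≤ k := by exact_mod_cast hk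
      linarith)
  refine dimHol_eq_of_pow_mem hlow fun f hf k hk => ?_
  rcases hk.eq_or_lt with rfl | hk
  swap
  · exact hhigh f hf k hk
  by_contra hne
  apply hmem
  have hsum : f = fun z => ∑ j ∈ Finset.range (K + 1),
      ((j ! : ℂ)⁻¹ * iteratedDeriv j f 0) * z ^ j := by
    funext z
    rw [← Complex.taylorSeries_eq_of_entire' 0 z hf.1, tsum_eq_sum (s := Finset.range (K + 1))]
    · simp
    · intro j hj
      rw [hhigh f hf j (by simpa using hj)]; simp
  set a : ℂ := (K ! : ℂ)⁻¹ * iteratedDeriv K f 0 with ha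
  have ha0 : a ≠ 0 := mul_ne_zero (inv_ne_zero (by exact_mod_cast Nat.factorial_ne_zero K)) hne
  have hrest : (f - ∑ j ∈ Finset.range K,
      ((j ! : ℂ)⁻¹ * iteratedDeriv j f 0) • (fun z : ℂ => z ^ j)) ∈ HolL2 h :=
    (HolL2 h).sub_mem hf ((HolL2 h).sum_mem fun j hj =>
      (HolL2 h).smul_mem _ (hlow j (by simpa using hj)))
  have hfin := (HolL2 h).smul_mem a⁻¹ hrest
  convert hfin using 1
  funext z
  have hz := congrFun hsum z
  rw [Finset.sum_range_succ, ← ha] at hz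
  simp only [Pi.smul_apply, Pi.sub_apply, Finset.sum_apply, smul_eq_mul]
  rw [hz]
  simp only [add_sub_cancel_left]
  rw [inv_mul_cancel_left₀ ha0]

/-- The lower bound makes the squared density at least a multiple of `|z|^{2K} (1+|z|)^{-2K-2}`,
whose integral diverges logarithmically. -/
lemma pow_notMem_HolL2 {h : ℂ → ℝ} {K : ℕ} {C R : ℝ}
    (hlow : ∀ x : ℂ, R ≤ ‖x‖ → -(K + 1) * Real.log (1 + ‖x‖) - C ≤ h x) :
    (fun z : ℂ => z ^ K) ∉ HolL2 h := by
  intro hmem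
  have h2 := hmem.2.norm
  have h3 := (memLp_two_iff_integrable_sq h2.1).1 h2
  refine not_integrable_pow_mul_rpow (k := 2 * K) (s := -2 * (K + 1)) (by push_cast; linarith) ?_
  have hcont : Continuous (fun x : ℂ => ‖x‖ ^ (2 * K) * (1 + ‖x‖) ^ (-2 * (K + 1) : ℝ)) :=
    Continuous.mul (by fun_prop) (Continuous.rpow_const (by fun_prop) fun x =>
      Or.inl (by positivity))
  rw [← integrableOn_univ, ← union_compl_self (Metric.closedBall (0 : ℂ) R)]
  refine IntegrableOn.union (hcont.continuousOn.integrableOn_compact (isCompact_closedBall 0 R)) ?_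
  refine ((h3.const_mul (Real.exp (2 * C))).integrableOn).mono' hcont.aestronglyMeasurable ?_
  filter_upwards [ae_restrict_mem measurableSet_closedBall.compl] with x hx
  rw [mem_compl_iff, mem_closedBall_zero_iff, not_le] at hx
  have h4 := hlow x hx.le
  have h0 : 0 < 1 + ‖x‖ := by positivity
  rw [Real.norm_of_nonneg (by positivity), norm_mul, Complex.norm_real, norm_pow,
    Real.norm_eq_abs, Real.abs_exp, mul_pow, ← pow_mul, mul_comm K 2, ← Real.exp_nat_mul,
    mul_comm (‖x‖ ^ _), ← mul_assoc]
  refine mul_le_mul_of_nonneg_right ?_ (by positivity)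
  rw [Real.rpow_def_of_pos h0, ← Real.exp_add]
  refine Real.exp_le_exp.2 ?_
  push_cast
  linarith

/-- Changing the potential by the real part of an entire function does not change the dimension. -/
lemma dimHol_congr {h h' : ℂ → ℝ} {E : ℂ → ℂ} (hE : Differentiable ℂ E)
    (hh : ∀ᵐ z, h z = h' z + (E z).re) : dimHol h = dimHol h' := by
  have key : ∀ {h h' : ℂ → ℝ} {E : ℂ → ℂ}, Differentiable ℂ E → (∀ᵐ z, h z = h' z + (E z).re) →
      ∀ f ∈ HolL2 h, (fun z => Complex.exp (E z) * f z) ∈ HolL2 h' := by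
    intro h h' E hE hh f hf
    refine ⟨hE.cexp.mul hf.1, ?_⟩
    -- The factor `exp (E - Re E)` is unimodular and turns `e^h f` into `e^{h'} exp(E) f`, so the
    -- norm is preserved.
    have hcont : Continuous (fun z => Complex.exp (E z - (E z).re)) :=
      Complex.continuous_exp.comp (hE.continuous.sub
        (Complex.continuous_ofReal.comp (Complex.continuous_re.comp hE.continuous)))
    have heq : (fun z => Complex.exp (E z - (E z).re) * ((Real.exp (h z) : ℂ) * f z))
        =ᵐ[volume] fun z => (Real.exp (h' z) : ℂ) * (Complex.exp (E z) * f z) := by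
      filter_upwards [hh] with z hz
      rw [hz, Real.exp_add, Complex.exp_sub]
      push_cast
      field_simp
    refine (hf.2.congr_norm (hcont.aestronglyMeasurable.mul hf.2.1)
      (Eventually.of_forall fun z => ?_)).ae_eq heq
    simp only [Pi.mul_apply, norm_mul, Complex.norm_exp]
    simp
  have hh' : ∀ᵐ z, h' z = h z + ((fun z => -E z) z).re := by
    filter_upwards [hh] with z hz
    rw [hz]; simp
  let e : HolL2 h ≃ₗ[ℂ] HolL2 h' :=
    { toFun := fun f => ⟨_, key hE hh f f.2⟩
      invFun := fun f => ⟨_, key hE.neg hh' f f.2⟩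
      map_add' := fun f g => by ext z; simp [mul_add]
      map_smul' := fun c f => by ext z; simp; ring
      left_inv := fun f => by ext z; simp [← mul_assoc, ← Complex.exp_add]
      right_inv := fun f => by ext z; simp [← mul_assoc, ← Complex.exp_add] }
  rw [dimHol, dimHol, e.rank_eq]

end Dimension

-- Calculus of the weak derivatives `∂_z̄` and `∂_z`.

section WeakDerivatives

lemma continuous_dbar {φ : ℂ → ℂ} (hφ : ContDiff ℝ ∞ φ) : Continuous (dbar φ) := by
  have h1 := (contDiff_fderiv_apply hφ 1).continuous
  have h2 := (contDiff_fderiv_apply hφ Complex.I).continuous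
  unfold dbar
  fun_prop

lemma hasCompactSupport_dbar {φ : ℂ → ℂ} (hc : HasCompactSupport φ) :
    HasCompactSupport (dbar φ) := by
  have h1 : HasCompactSupport (fun z => fderiv ℝ φ z 1) := hc.fderiv_apply ℝ 1
  have h2 : HasCompactSupport (fun z => fderiv ℝ φ z Complex.I) := hc.fderiv_apply ℝ Complex.I
  have : dbar φ = fun z => (2 : ℂ)⁻¹ * (fderiv ℝ φ z 1 + Complex.I * fderiv ℝ φ z Complex.I) := by
    ext z; simp only [dbar]; ring
  rw [this]
  exact (h1.add h2.mul_left).mul_left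

lemma contDiff_ofReal_comp {g : ℂ → ℝ} (hg : ContDiff ℝ ∞ g) :
    ContDiff ℝ ∞ (fun z => (g z : ℂ)) := Complex.ofRealCLM.contDiff.comp hg

lemma hasCompactSupport_ofReal_comp {g : ℂ → ℝ} (hc : HasCompactSupport g) :
    HasCompactSupport (fun z => (g z : ℂ)) :=
  hc.comp_left (g := fun r : ℝ => (r : ℂ)) (by simp)

lemma IsWeakDbar.ae_unique {f f' u u' : ℂ → ℂ} (h : IsWeakDbar f u) (h' : IsWeakDbar f' u')
    (hf : f =ᵐ[volume] f') : u =ᵐ[volume] u' := by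
  refine ae_eq_of_integral_contDiff_smul_eq h.2.1 h'.2.1 fun g hg hgc => ?_
  have h1 := h.2.2 _ (contDiff_ofReal_comp hg) (hasCompactSupport_ofReal_comp hgc)
  have h2 := h'.2.2 _ (contDiff_ofReal_comp hg) (hasCompactSupport_ofReal_comp hgc)
  have h3 : ∫ z, f z * dbar (fun z => (g z : ℂ)) z = ∫ z, f' z * dbar (fun z => (g z : ℂ)) z :=
    integral_congr_ae (by filter_upwards [hf] with z hz; rw [hz])
  rw [h1, h2, neg_inj] at h3
  simpa only [Complex.real_smul, mul_comm] using h3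

lemma IsWeakDbar.congr {f f' u u' : ℂ → ℂ} (h : IsWeakDbar f u) (hf : f =ᵐ[volume] f')
    (hu : u =ᵐ[volume] u') : IsWeakDbar f' u' := by
  refine ⟨h.1.congr hf, h.2.1.congr hu, fun φ hφ hc => ?_⟩
  rw [integral_congr_ae (g := fun z => f z * dbar φ z)
    (by filter_upwards [hf] with z hz; rw [hz]), h.2.2 φ hφ hc]
  congr 1
  exact integral_congr_ae (by filter_upwards [hu] with z hz; rw [hz])

lemma IsWeakDbar.add {f f' u u' : ℂ → ℂ} (h : IsWeakDbar f u) (h' : IsWeakDbar f' u') :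
    IsWeakDbar (f + f') (u + u') := by
  refine ⟨h.1.add h'.1, h.2.1.add h'.2.1, fun φ hφ hc => ?_⟩
  have hi : ∀ {w : ℂ → ℂ}, LocallyIntegrable w volume → Integrable (fun z => w z * dbar φ z) :=
    fun hw => hw.integrable_smul_right_of_hasCompactSupport (continuous_dbar hφ)
      (hasCompactSupport_dbar hc)
  have hj : ∀ {w : ℂ → ℂ}, LocallyIntegrable w volume → Integrable (fun z => w z * φ z) :=
    fun hw => hw.integrable_smul_right_of_hasCompactSupport hφ.continuous hc
  simp only [Pi.add_apply, add_mul]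
  rw [integral_add (hi h.1) (hi h'.1), integral_add (hj h.2.1) (hj h'.2.1), h.2.2 φ hφ hc,
    h'.2.2 φ hφ hc, neg_add]

lemma IsWeakDbar.const_smul {f u : ℂ → ℂ} (h : IsWeakDbar f u) (c : ℂ) :
    IsWeakDbar (c • f) (c • u) := by
  refine ⟨h.1.smul c, h.2.1.smul c, fun φ hφ hc => ?_⟩
  simp only [Pi.smul_apply, smul_eq_mul, mul_assoc]
  rw [integral_const_mul, integral_const_mul, h.2.2 φ hφ hc, mul_neg]

lemma isWeakDbar_of_contDiff {f : ℂ → ℂ} (hf : ContDiff ℝ ∞ f) : IsWeakDbar f (dbar f) := by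
  refine ⟨hf.continuous.locallyIntegrable, (continuous_dbar hf).locallyIntegrable,
    fun φ hφ hc => ?_⟩
  have key : ∀ v, ∫ z, f z * fderiv ℝ φ z v = - ∫ z, fderiv ℝ f z v * φ z := fun v =>
    integral_mul_fderiv_eq_neg_fderiv_mul_of_integrable
      (((contDiff_fderiv_apply hf v).continuous.mul
        hφ.continuous).integrable_of_hasCompactSupport hc.mul_left)
      ((hf.continuous.mul (contDiff_fderiv_apply hφ v).continuous).integrable_of_hasCompactSupport
        (HasCompactSupport.mul_left (hc.fderiv_apply ℝ v)))
      ((hf.continuous.mul hφ.continuous).integrable_of_hasCompactSupport hc.mul_left)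
      (fun x _ => hf.differentiable (by simp) x) (fun x _ => hφ.differentiable (by simp) x)
  have hi : ∀ v, Integrable (fun z => f z * fderiv ℝ φ z v) := fun v =>
    (hf.continuous.mul (contDiff_fderiv_apply hφ v).continuous).integrable_of_hasCompactSupport
        (HasCompactSupport.mul_left (hc.fderiv_apply ℝ v))
  have hj : ∀ v, Integrable (fun z => fderiv ℝ f z v * φ z) := fun v =>
    ((contDiff_fderiv_apply hf v).continuous.mul
        hφ.continuous).integrable_of_hasCompactSupport hc.mul_left
  have e1 : ∀ z, f z * dbar φ z = (2 : ℂ)⁻¹ * (f z * fderiv ℝ φ z 1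
      + Complex.I * (f z * fderiv ℝ φ z Complex.I)) := fun z => by simp only [dbar]; ring
  have e2 : ∀ z, dbar f z * φ z = (2 : ℂ)⁻¹ * (fderiv ℝ f z 1 * φ z
      + Complex.I * (fderiv ℝ f z Complex.I * φ z)) := fun z => by simp only [dbar]; ring
  simp only [e1, e2]
  rw [integral_const_mul, integral_const_mul, integral_add (hi 1) ((hi _).const_mul _),
    integral_add (hj 1) ((hj _).const_mul _), integral_const_mul, integral_const_mul, key, key]
  ring

lemma dbar_eq_zero {f : ℂ → ℂ} (hf : Differentiable ℂ f) : dbar f = 0 := by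
  ext z
  have h := ((hf z).hasFDerivAt.restrictScalars ℝ).fderiv
  have h1 : fderiv ℝ f z Complex.I = Complex.I * fderiv ℝ f z 1 := by
    rw [h]
    simp
  simp only [dbar, h1, ← mul_assoc, Complex.I_mul_I]
  simp

lemma isWeakDbar_entire {f : ℂ → ℂ} (hf : Differentiable ℂ f) : IsWeakDbar f 0 := by
  rw [← dbar_eq_zero hf]
  exact isWeakDbar_of_contDiff (hf.contDiff.restrict_scalars ℝ)

lemma measurePreserving_conj : MeasurePreserving (starRingEnd ℂ) (volume : Measure ℂ) volume :=
  Complex.conjLIE.measurePreserving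

lemma measurableEmbedding_conj : MeasurableEmbedding (starRingEnd ℂ) :=
  Complex.conjLIE.toHomeomorph.measurableEmbedding

lemma dz_comp_conj {φ : ℂ → ℂ} (hφ : ContDiff ℝ ∞ φ) (z : ℂ) :
    dz (fun w => φ (starRingEnd ℂ w)) z = dbar φ (starRingEnd ℂ z) := by
  have h (v : ℂ) : fderiv ℝ (fun w => φ (starRingEnd ℂ w)) z v
      = fderiv ℝ φ (starRingEnd ℂ z) (starRingEnd ℂ v) := by
    have := ((hφ.differentiable (by simp) (Complex.conjCLE z)).hasFDerivAt.comp z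
      Complex.conjCLE.hasFDerivAt).fderiv
    simp only [Function.comp_def, Complex.conjCLE_apply] at this
    rw [this]; simp
  simp only [dz, dbar, h]
  simp

lemma locallyIntegrable_comp_conj {f : ℂ → ℂ} (hf : LocallyIntegrable f volume) :
    LocallyIntegrable (fun z => f (starRingEnd ℂ z)) volume := by
  rw [locallyIntegrable_iff] at hf ⊢
  intro K hK
  have hK' := hf (starRingEnd ℂ '' K) (hK.image Complex.continuous_conj)
  have := (measurePreserving_conj.integrableOn_image measurableEmbedding_conj).1 hK'
  exact this

/-- Conjugation preserves Lebesgue measure and exchanges `∂_z` with `∂_z̄`; the facts about `∂_z`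
below are transported from `∂_z̄` in this way. -/
lemma IsWeakDz.comp_conj {f u : ℂ → ℂ} (h : IsWeakDz f u) :
    IsWeakDbar (fun z => f (starRingEnd ℂ z)) (fun z => u (starRingEnd ℂ z)) := by
  refine ⟨locallyIntegrable_comp_conj h.1, locallyIntegrable_comp_conj h.2.1, fun φ hφ hc => ?_⟩
  have h1 := h.2.2 (fun w => φ (starRingEnd ℂ w)) (hφ.comp Complex.conjCLE.contDiff)
    (hc.comp_homeomorph Complex.conjLIE.toHomeomorph)
  rw [← measurePreserving_conj.integral_comp measurableEmbedding_conj,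
    ← measurePreserving_conj.integral_comp measurableEmbedding_conj (fun z => u z * _)] at h1
  simpa only [dz_comp_conj hφ, Complex.conj_conj] using h1

lemma IsWeakDbar.comp_conj {f u : ℂ → ℂ} (h : IsWeakDbar f u) :
    IsWeakDz (fun z => f (starRingEnd ℂ z)) (fun z => u (starRingEnd ℂ z)) := by
  refine ⟨locallyIntegrable_comp_conj h.1, locallyIntegrable_comp_conj h.2.1, fun φ hφ hc => ?_⟩
  have h1 := h.2.2 (fun w => φ (starRingEnd ℂ w)) (hφ.comp Complex.conjCLE.contDiff)
    (hc.comp_homeomorph Complex.conjLIE.toHomeomorph)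
  rw [← measurePreserving_conj.integral_comp measurableEmbedding_conj,
    ← measurePreserving_conj.integral_comp measurableEmbedding_conj (fun z => u z * _)] at h1
  have h2 : ∀ z, dz φ z = dbar (fun w => φ (starRingEnd ℂ w)) (starRingEnd ℂ z) := fun z => by
    have := dz_comp_conj (φ := fun w => φ (starRingEnd ℂ w))
      (hφ.comp Complex.conjCLE.contDiff) z
    simpa only [Complex.conj_conj] using this
  simp only [h2]
  simpa only [Complex.conj_conj] using h1

lemma ae_comp_conj {p : ℂ → Prop} (h : ∀ᵐ z, p z) : ∀ᵐ z, p (starRingEnd ℂ z) :=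
  measurePreserving_conj.quasiMeasurePreserving.ae h

lemma IsWeakDz.of_comp_conj {f u : ℂ → ℂ}
    (h : IsWeakDbar (fun z => f (starRingEnd ℂ z)) (fun z => u (starRingEnd ℂ z))) :
    IsWeakDz f u := by
  simpa only [Complex.conj_conj] using h.comp_conj

lemma IsWeakDz.ae_unique {f f' u u' : ℂ → ℂ} (h : IsWeakDz f u) (h' : IsWeakDz f' u')
    (hf : f =ᵐ[volume] f') : u =ᵐ[volume] u' := by
  have := ae_comp_conj (h.comp_conj.ae_unique h'.comp_conj (ae_comp_conj hf))
  have h2 : ∀ᵐ z, u z = u' z := by simpa only [Complex.conj_conj] using this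
  exact h2

lemma IsWeakDz.congr {f f' u u' : ℂ → ℂ} (h : IsWeakDz f u) (hf : f =ᵐ[volume] f')
    (hu : u =ᵐ[volume] u') : IsWeakDz f' u' :=
  .of_comp_conj (h.comp_conj.congr (ae_comp_conj hf) (ae_comp_conj hu))

lemma IsWeakDz.add {f f' u u' : ℂ → ℂ} (h : IsWeakDz f u) (h' : IsWeakDz f' u') :
    IsWeakDz (f + f') (u + u') :=
  .of_comp_conj (h.comp_conj.add h'.comp_conj)

lemma IsWeakDz.const_smul {f u : ℂ → ℂ} (h : IsWeakDz f u) (c : ℂ) :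
    IsWeakDz (c • f) (c • u) :=
  .of_comp_conj (h.comp_conj.const_smul c)

lemma IsWeakDbar.weakDbar {f u : ℂ → ℂ} (h : IsWeakDbar f u) : IsWeakDbar f (weakDbar f) := by
  have hf : ∃ u, IsWeakDbar f u := ⟨u, h⟩
  rw [PauliMeasure.weakDbar, dif_pos hf]
  exact hf.choose_spec

/-- `weakDbar` is a chosen representative; uniqueness almost everywhere allows any known derivative
to replace it. -/
lemma IsWeakDbar.weakDbar_ae_eq {f u : ℂ → ℂ} (h : IsWeakDbar f u) :
    PauliMeasure.weakDbar f =ᵐ[volume] u :=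
  h.weakDbar.ae_unique h (ae_eq_refl f)

lemma IsWeakDz.weakDz {f u : ℂ → ℂ} (h : IsWeakDz f u) : IsWeakDz f (weakDz f) := by
  have hf : ∃ u, IsWeakDz f u := ⟨u, h⟩
  rw [PauliMeasure.weakDz, dif_pos hf]
  exact hf.choose_spec

lemma IsWeakDz.weakDz_ae_eq {f u : ℂ → ℂ} (h : IsWeakDz f u) :
    PauliMeasure.weakDz f =ᵐ[volume] u :=
  h.weakDz.ae_unique h (ae_eq_refl f)

end WeakDerivatives

-- Zero modes and the kernel of a Pauli operator.

section Kernel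

lemma memLp_spinor_apply (ψ : Spinor) (i : Fin 2) : MemLp (fun z => ψ z i) 2 volume :=
  (EuclideanSpace.proj (𝕜 := ℂ) i).comp_memLp' (Lp.memLp ψ)

lemma memLp_spinor {a b : ℂ → ℂ} (ha : MemLp a 2 volume) (hb : MemLp b 2 volume) :
    MemLp (fun z => a z • EuclideanSpace.single (0 : Fin 2) (1 : ℂ)
      + b z • EuclideanSpace.single (1 : Fin 2) (1 : ℂ)) 2 volume :=
  ((ContinuousLinearMap.toSpanSingleton ℂ
    (EuclideanSpace.single (0 : Fin 2) (1 : ℂ))).comp_memLp' ha).add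
    ((ContinuousLinearMap.toSpanSingleton ℂ
      (EuclideanSpace.single (1 : Fin 2) (1 : ℂ))).comp_memLp' hb)

/-- The spinor with given components. -/
noncomputable def spinorOf {a b : ℂ → ℂ} (ha : MemLp a 2 volume) (hb : MemLp b 2 volume) :
    Spinor := (memLp_spinor ha hb).toLp _

lemma spinorOf_zero_ae {a b : ℂ → ℂ} (ha : MemLp a 2 volume) (hb : MemLp b 2 volume) :
    ∀ᵐ z, spinorOf ha hb z 0 = a z := by
  filter_upwards [(memLp_spinor ha hb).coeFn_toLp] with z hz
  rw [spinorOf, hz]; simp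

lemma spinorOf_one_ae {a b : ℂ → ℂ} (ha : MemLp a 2 volume) (hb : MemLp b 2 volume) :
    ∀ᵐ z, spinorOf ha hb z 1 = b z := by
  filter_upwards [(memLp_spinor ha hb).coeFn_toLp] with z hz
  rw [spinorOf, hz]; simp

lemma spinor_ext {ψ φ : Spinor} (h0 : ∀ᵐ z, ψ z 0 = φ z 0) (h1 : ∀ᵐ z, ψ z 1 = φ z 1) :
    ψ = φ := by
  refine Lp.ext ?_
  filter_upwards [h0, h1] with z hz0 hz1
  ext i
  fin_cases i
  · exact hz0
  · exact hz1

lemma spinor_add_ae (ψ φ : Spinor) (i : Fin 2) : ∀ᵐ z, (ψ + φ) z i = ψ z i + φ z i := by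
  filter_upwards [Lp.coeFn_add ψ φ] with z hz
  rw [hz]; simp

lemma spinor_smul_ae (c : ℂ) (ψ : Spinor) (i : Fin 2) : ∀ᵐ z, (c • ψ) z i = c * ψ z i := by
  filter_upwards [Lp.coeFn_smul c ψ] with z hz
  rw [hz]; simp

lemma spinor_zero_ae (i : Fin 2) : ∀ᵐ z, (0 : Spinor) z i = 0 := by
  filter_upwards [Lp.coeFn_zero (EuclideanSpace ℂ (Fin 2)) 2 (volume : Measure ℂ)] with z hz
  rw [hz]; simp

/-- The potential seen by the lower component after complex conjugation. -/
noncomputable def conjPot (h : ℂ → ℝ) (z : ℂ) : ℝ := -h (starRingEnd ℂ z)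

lemma memLp_conj {h : ℂ → ℝ} {g : ℂ → ℂ} (hg : g ∈ HolL2 (conjPot h)) :
    MemLp (fun z => (Real.exp (-h z) : ℂ) * g (starRingEnd ℂ z)) 2 volume := by
  have := hg.2.comp_measurePreserving measurePreserving_conj
  simpa [Function.comp_def, conjPot] using this

/-- The zero modes built from a holomorphic and an antiholomorphic function. -/
noncomputable def zeroMode (h : ℂ → ℝ) : HolL2 h × HolL2 (conjPot h) →ₗ[ℂ] Spinor where
  toFun p := spinorOf p.1.2.2 (memLp_conj p.2.2)
  map_add' p q := by
    refine spinor_ext ?_ ?_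
    · filter_upwards [spinor_add_ae (spinorOf p.1.2.2 (memLp_conj p.2.2))
        (spinorOf q.1.2.2 (memLp_conj q.2.2)) 0, spinorOf_zero_ae p.1.2.2 (memLp_conj p.2.2),
        spinorOf_zero_ae q.1.2.2 (memLp_conj q.2.2),
        spinorOf_zero_ae (p + q).1.2.2 (memLp_conj (p + q).2.2)] with z h1 h2 h3 h4
      rw [h1, h2, h3, h4]
      simp [mul_add]
    · filter_upwards [spinor_add_ae (spinorOf p.1.2.2 (memLp_conj p.2.2))
        (spinorOf q.1.2.2 (memLp_conj q.2.2)) 1, spinorOf_one_ae p.1.2.2 (memLp_conj p.2.2),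
        spinorOf_one_ae q.1.2.2 (memLp_conj q.2.2),
        spinorOf_one_ae (p + q).1.2.2 (memLp_conj (p + q).2.2)] with z h1 h2 h3 h4
      rw [h1, h2, h3, h4]
      simp [mul_add]
  map_smul' c p := by
    refine spinor_ext ?_ ?_
    · filter_upwards [spinor_smul_ae c (spinorOf p.1.2.2 (memLp_conj p.2.2)) 0,
        spinorOf_zero_ae p.1.2.2 (memLp_conj p.2.2),
        spinorOf_zero_ae (c • p).1.2.2 (memLp_conj (c • p).2.2)] with z h1 h2 h3
      simp only [RingHom.id_apply]
      rw [h1, h2, h3]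
      simp; ring
    · filter_upwards [spinor_smul_ae c (spinorOf p.1.2.2 (memLp_conj p.2.2)) 1,
        spinorOf_one_ae p.1.2.2 (memLp_conj p.2.2),
        spinorOf_one_ae (c • p).1.2.2 (memLp_conj (c • p).2.2)] with z h1 h2 h3
      simp only [RingHom.id_apply]
      rw [h1, h2, h3]
      simp; ring

lemma zeroMode_zero_ae {h : ℂ → ℝ} (p : HolL2 h × HolL2 (conjPot h)) :
    ∀ᵐ z, zeroMode h p z 0 = (Real.exp (h z) : ℂ) * (p.1 : ℂ → ℂ) z :=
  spinorOf_zero_ae p.1.2.2 (memLp_conj p.2.2)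

lemma zeroMode_one_ae {h : ℂ → ℝ} (p : HolL2 h × HolL2 (conjPot h)) :
    ∀ᵐ z, zeroMode h p z 1 = (Real.exp (-h z) : ℂ) * (p.2 : ℂ → ℂ) (starRingEnd ℂ z) :=
  spinorOf_one_ae p.1.2.2 (memLp_conj p.2.2)

lemma eq_zero_of_ae_eq_zero {f : ℂ → ℂ} (hf : Continuous f) (h : ∀ᵐ z, f z = 0) : f = 0 :=
  (Continuous.ae_eq_iff_eq volume hf continuous_const).1 h

lemma zeroMode_injective (h : ℂ → ℝ) : Function.Injective (zeroMode h) := by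
  rw [← LinearMap.ker_eq_bot, LinearMap.ker_eq_bot']
  rintro ⟨f, g⟩ hp
  have h0 := zeroMode_zero_ae (f, g)
  have h1 := zeroMode_one_ae (f, g)
  rw [hp] at h0 h1
  have hf : (f : ℂ → ℂ) = 0 := by
    refine eq_zero_of_ae_eq_zero f.2.1.continuous ?_
    filter_upwards [h0, spinor_zero_ae 0] with z hz hz0
    rw [hz0] at hz
    simpa using hz.symm
  have hg : (g : ℂ → ℂ) = 0 := by
    refine eq_zero_of_ae_eq_zero g.2.1.continuous ?_
    have : ∀ᵐ z, (g : ℂ → ℂ) (starRingEnd ℂ z) = 0 := by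
      filter_upwards [h1, spinor_zero_ae 1] with z hz hz0
      rw [hz0] at hz
      simpa using hz.symm
    simpa only [Complex.conj_conj] using ae_comp_conj this
  exact Prod.ext (Subtype.ext hf) (Subtype.ext hg)

lemma exp_mul_exp_neg_complex (x : ℝ) : (Real.exp x : ℂ) * (Real.exp (-x) : ℂ) = 1 := by
  rw [← Complex.ofReal_mul, ← Real.exp_add]; simp

lemma isWeakDbar_reducedUp_zeroMode {h : ℂ → ℝ} (p : HolL2 h × HolL2 (conjPot h)) :
    IsWeakDbar (reducedUp h (zeroMode h p)) 0 := by
  refine (isWeakDbar_entire p.1.2.1).congr ?_ (ae_eq_refl _)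
  filter_upwards [zeroMode_zero_ae p] with z hz
  rw [reducedUp, hz, ← mul_assoc, mul_comm (Real.exp (-h z) : ℂ), exp_mul_exp_neg_complex, one_mul]

lemma isWeakDz_reducedDown_zeroMode {h : ℂ → ℝ} (p : HolL2 h × HolL2 (conjPot h)) :
    IsWeakDz (reducedDown h (zeroMode h p)) 0 := by
  refine (isWeakDbar_entire p.2.2.1).comp_conj.congr ?_ (ae_eq_refl _)
  filter_upwards [zeroMode_one_ae p] with z hz
  rw [reducedDown, hz, ← mul_assoc, exp_mul_exp_neg_complex, one_mul]

lemma zeroMode_mem_formDomain {h : ℂ → ℝ} (p : HolL2 h × HolL2 (conjPot h)) :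
    zeroMode h p ∈ formDomain h := by
  have h1 := isWeakDbar_reducedUp_zeroMode p
  have h2 := isWeakDz_reducedDown_zeroMode p
  refine ⟨h1.weakDbar, h2.weakDz, ?_, ?_⟩
  · refine (MemLp.zero' (ε := ℂ)).ae_eq ?_
    filter_upwards [h1.weakDbar_ae_eq] with z hz
    rw [hz]; simp
  · refine (MemLp.zero' (ε := ℂ)).ae_eq ?_
    filter_upwards [h2.weakDz_ae_eq] with z hz
    rw [hz]; simp

lemma pauliForm_zeroMode {h : ℂ → ℝ} (p : HolL2 h × HolL2 (conjPot h)) (ξ : Spinor) :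
    pauliForm h (zeroMode h p) ξ = 0 := by
  have h1 := (isWeakDbar_reducedUp_zeroMode p).weakDbar_ae_eq
  have h2 := (isWeakDz_reducedDown_zeroMode p).weakDz_ae_eq
  rw [pauliForm, integral_eq_zero_of_ae, integral_eq_zero_of_ae]
  · simp
  · filter_upwards [h2] with z hz
    rw [hz]; simp
  · filter_upwards [h1] with z hz
    rw [hz]; simp

lemma ae_eq_zero_of_integral_normSq {a : ℂ → ℂ} {w : ℂ → ℝ}
    (ha : MemLp (fun z => (Real.exp (w z) : ℂ) * a z) 2 volume)
    (h0 : ∫ z, ‖(Real.exp (w z) : ℂ) * a z‖ ^ 2 = 0) : a =ᵐ[volume] 0 := by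
  have hi := (memLp_two_iff_integrable_sq_norm ha.1).1 ha
  rw [integral_eq_zero_iff_of_nonneg (fun z => by positivity) hi] at h0
  filter_upwards [h0] with z hz
  simpa using hz

lemma integral_conj_mul_exp (a : ℂ → ℂ) (w : ℂ → ℝ) {c : ℂ → ℝ} (hc : ∀ z, c z = 2 * w z) :
    ∫ z, (starRingEnd ℂ) (a z) * a z * (Real.exp (c z) : ℂ)
      = ((∫ z, ‖(Real.exp (w z) : ℂ) * a z‖ ^ 2 : ℝ) : ℂ) := by
  refine Eq.trans ?_ integral_complex_ofReal
  congr 1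
  ext z
  rw [norm_mul, mul_pow, Complex.norm_real, Real.norm_eq_abs, Real.abs_exp, hc z,
    ← Complex.normSq_eq_conj_mul_self, Complex.normSq_eq_norm_sq, ← Real.exp_nat_mul]
  push_cast
  ring

/-- With `ξ = ψ` the form is a sum of two nonnegative terms, so both weak derivatives vanish. Weyl's
lemma then applies to `e^{-h}ψ₊` and, after conjugation, to `e^{h}ψ₋`. -/
lemma mem_range_zeroMode_iff {h : ℂ → ℝ} (ψ : Spinor) :
    ψ ∈ LinearMap.range (zeroMode h) ↔
      ψ ∈ formDomain h ∧ ∀ ξ ∈ formDomain h, pauliForm h ψ ξ = inner ℂ (0 : Spinor) ξ := by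
  constructor
  · rintro ⟨p, rfl⟩
    exact ⟨zeroMode_mem_formDomain p, fun ξ _ => by rw [pauliForm_zeroMode, inner_zero_left]⟩
  · rintro ⟨hψ, hform⟩
    have h0 := hform ψ hψ
    rw [inner_zero_left, pauliForm, integral_conj_mul_exp _ h (fun z => rfl),
      integral_conj_mul_exp _ (fun z => -h z) (fun z => by ring)] at h0
    have hA : 0 ≤ ∫ z, ‖(Real.exp (h z) : ℂ) * weakDbar (reducedUp h ψ) z‖ ^ 2 :=
      integral_nonneg fun z => by positivity
    have hB : 0 ≤ ∫ z, ‖(Real.exp (-h z) : ℂ) * weakDz (reducedDown h ψ) z‖ ^ 2 :=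
      integral_nonneg fun z => by positivity
    have h0' := congrArg Complex.re h0
    simp only [Complex.add_re, Complex.mul_re, Complex.ofReal_re, Complex.ofReal_im, mul_zero,
      sub_zero, Complex.zero_re, Complex.re_ofNat] at h0'
    have e1 := ae_eq_zero_of_integral_normSq hψ.2.2.1 (by linarith)
    have e2 := ae_eq_zero_of_integral_normSq (w := fun z => -h z) hψ.2.2.2 (by linarith)
    obtain ⟨f, hf, hfe⟩ := exists_entire_ae_eq hψ.1.1 fun φ hφ hc => by
      rw [(hψ.1.congr (ae_eq_refl _) e1).2.2 φ hφ hc]; simp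
    have hc2 := (hψ.2.1.congr (ae_eq_refl _) e2).comp_conj
    obtain ⟨g, hg, hge⟩ := exists_entire_ae_eq hc2.1 fun φ hφ hc => by
      rw [hc2.2.2 φ hφ hc]; simp
    have hge' : ∀ᵐ z, reducedDown h ψ z = g (starRingEnd ℂ z) := by
      simpa only [Complex.conj_conj] using ae_comp_conj hge
    have hψ0 : ∀ᵐ z, ψ z 0 = (Real.exp (h z) : ℂ) * f z := by
      filter_upwards [hfe] with z hz
      rw [← hz, reducedUp, ← mul_assoc, exp_mul_exp_neg_complex, one_mul]
    have hψ1 : ∀ᵐ z, ψ z 1 = (Real.exp (-h z) : ℂ) * g (starRingEnd ℂ z) := by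
      filter_upwards [hge'] with z hz
      rw [← hz, reducedDown, ← mul_assoc, mul_comm (Real.exp (-h z) : ℂ),
        exp_mul_exp_neg_complex, one_mul]
    have hfm : f ∈ HolL2 h := ⟨hf, (memLp_spinor_apply ψ 0).ae_eq hψ0⟩
    have hgm : g ∈ HolL2 (conjPot h) := by
      refine ⟨hg, ?_⟩
      have := ((memLp_spinor_apply ψ 1).ae_eq hψ1).comp_measurePreserving measurePreserving_conj
      simpa [Function.comp_def, conjPot] using this
    refine ⟨(⟨f, hfm⟩, ⟨g, hgm⟩), spinor_ext ?_ ?_⟩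
    · filter_upwards [zeroMode_zero_ae (h := h) (⟨f, hfm⟩, ⟨g, hgm⟩), hψ0] with z hz hz'
      rw [hz, hz']
    · filter_upwards [zeroMode_one_ae (h := h) (⟨f, hfm⟩, ⟨g, hgm⟩), hψ1] with z hz hz'
      rw [hz, hz']

lemma mem_ker_iff_mem_graph (H : Spinor →ₗ.[ℂ] Spinor) (ψ : Spinor) :
    (∃ x : H.domain, H x = 0 ∧ (x : Spinor) = ψ) ↔ (ψ, 0) ∈ H.graph := by
  rw [LinearPMap.mem_graph_iff]
  exact ⟨fun ⟨x, h1, h2⟩ => ⟨x, h2, h1⟩, fun ⟨x, h1, h2⟩ => ⟨x, h2, h1⟩⟩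

variable {h : ℂ → ℝ} {H H₀ : Spinor →ₗ.[ℂ] Spinor} {U : Spinor ≃ₗᵢ[ℂ] Spinor}

lemma mem_graph_iff_mem_range_zeroMode (hH₀ : IsFormOperator h H₀)
    (hU : ∀ ψ η : Spinor, (ψ, η) ∈ H.graph ↔ (U ψ, U η) ∈ H₀.graph) (ψ : Spinor) :
    (ψ, 0) ∈ H.graph ↔ U ψ ∈ LinearMap.range (zeroMode h) := by
  rw [hU, map_zero, hH₀, mem_range_zeroMode_iff]

/-- The kernel of a Pauli operator splits into a holomorphic and an antiholomorphic part. -/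
theorem kernelDim_eq (hH₀ : IsFormOperator h H₀)
    (hU : ∀ ψ η : Spinor, (ψ, η) ∈ H.graph ↔ (U ψ, U η) ∈ H₀.graph) :
    kernelDim H = dimHol h + dimHol (conjPot h) := by
  let A : LinearMap.ker H.toFun →ₗ[ℂ] Spinor :=
    U.toLinearEquiv.toLinearMap ∘ₗ H.domain.subtype ∘ₗ (LinearMap.ker H.toFun).subtype
  have hA : Function.Injective A :=
    U.injective.comp (Subtype.val_injective.comp Subtype.val_injective)
  have hrange : LinearMap.range A = LinearMap.range (zeroMode h) := by
    ext φ
    rw [← U.apply_symm_apply φ, ← mem_graph_iff_mem_range_zeroMode hH₀ hU,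
      ← mem_ker_iff_mem_graph]
    constructor
    · rintro ⟨x, hx⟩
      exact ⟨x.1, x.2, U.injective hx⟩
    · rintro ⟨x, hx, hx2⟩
      exact ⟨⟨x, hx⟩, congrArg U hx2⟩
  have e : LinearMap.ker H.toFun ≃ₗ[ℂ] HolL2 h × HolL2 (conjPot h) :=
    (LinearEquiv.ofInjective A hA).trans ((LinearEquiv.ofEq _ _ hrange).trans
      (LinearEquiv.ofInjective _ (zeroMode_injective h)).symm)
  rw [kernelDim, e.rank_eq, rank_prod', map_add]
  rfl

lemma HolL2_eq_bot (h0 : dimHol h = 0) : HolL2 h = ⊥ := by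
  rw [dimHol, Cardinal.toENat_eq_zero] at h0
  exact Submodule.rank_eq_zero.1 h0

/-- Division by `c` is avoided because `c` is not assumed nonzero. Instead, the spinor `φ` keeping
only the `i`-th component of `ψ` satisfies `U φ = 0`, and `U` is injective. -/
lemma component_zero_of_gauge {c : ℂ → ℂ} (hc : ∀ ψ : Spinor, ∀ᵐ z, U ψ z = c z • ψ z)
    {ψ : Spinor} {i : Fin 2} (h0 : ∀ᵐ z, U ψ z i = 0) : ∀ᵐ z, ψ z i = 0 := by
  let L : EuclideanSpace ℂ (Fin 2) →L[ℂ] EuclideanSpace ℂ (Fin 2) :=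
    (ContinuousLinearMap.toSpanSingleton ℂ (EuclideanSpace.single i (1 : ℂ))).comp
      (EuclideanSpace.proj i)
  set φ : Spinor := L.compLp ψ with hφ
  have hφz : ∀ᵐ z, φ z = EuclideanSpace.single i (ψ z i) := by
    filter_upwards [L.coeFn_compLp ψ] with z hz
    rw [hφ, hz]
    ext j
    simp [L]
  have hUφ : U φ = 0 := by
    refine Lp.ext ?_
    filter_upwards [hc φ, hc ψ, h0, hφz,
      Lp.coeFn_zero (EuclideanSpace ℂ (Fin 2)) 2 (volume : Measure ℂ)] with z h1 h2 h3 h4 h5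
    rw [h1, h5, h4]
    rw [h2] at h3
    ext j
    by_cases hj : j = i
    · subst hj
      simpa using h3
    · simp [hj]
  have hφ0 : φ = 0 := by
    have := congrArg U.symm hUφ
    simpa using this
  filter_upwards [hφz, Lp.coeFn_zero (EuclideanSpace ℂ (Fin 2)) 2 (volume : Measure ℂ)]
    with z h1 h2
  rw [hφ0, h2] at h1
  have := congrArg (fun v : EuclideanSpace ℂ (Fin 2) => v i) h1
  simpa using this.symm

lemma kernel_up_eq_zero (hH₀ : IsFormOperator h H₀)
    (hU : ∀ ψ η : Spinor, (ψ, η) ∈ H.graph ↔ (U ψ, U η) ∈ H₀.graph) {c : ℂ → ℂ}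
    (hc : ∀ ψ : Spinor, ∀ᵐ z, U ψ z = c z • ψ z) (h0 : dimHol h = 0) (x : H.domain)
    (hx : H x = 0) : ∀ᵐ z, (x : Spinor) z 0 = 0 := by
  obtain ⟨p, hp⟩ := (mem_graph_iff_mem_range_zeroMode hH₀ hU x).1
    ((mem_ker_iff_mem_graph H _).1 ⟨x, hx, rfl⟩)
  refine component_zero_of_gauge hc ?_
  have hp0 : (p.1 : ℂ → ℂ) = 0 := by
    have h1 : ∀ f ∈ HolL2 h, f = 0 := by rw [HolL2_eq_bot h0]; simp
    exact h1 _ p.1.2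
  filter_upwards [zeroMode_zero_ae p] with z hz
  rw [← hp, hz, hp0]; simp

lemma kernel_down_eq_zero (hH₀ : IsFormOperator h H₀)
    (hU : ∀ ψ η : Spinor, (ψ, η) ∈ H.graph ↔ (U ψ, U η) ∈ H₀.graph) {c : ℂ → ℂ}
    (hc : ∀ ψ : Spinor, ∀ᵐ z, U ψ z = c z • ψ z) (h0 : dimHol (conjPot h) = 0) (x : H.domain)
    (hx : H x = 0) : ∀ᵐ z, (x : Spinor) z 1 = 0 := by
  obtain ⟨p, hp⟩ := (mem_graph_iff_mem_range_zeroMode hH₀ hU x).1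
    ((mem_ker_iff_mem_graph H _).1 ⟨x, hx, rfl⟩)
  refine component_zero_of_gauge hc ?_
  have hp0 : (p.2 : ℂ → ℂ) = 0 := by
    have h1 : ∀ f ∈ HolL2 (conjPot h), f = 0 := by rw [HolL2_eq_bot h0]; simp
    exact h1 _ p.2.2
  filter_upwards [zeroMode_one_ae p] with z hz
  rw [← hp, hz, hp0]; simp

end Kernel

-- Signed measures and uniqueness and finiteness of the reduction.

section Measures

instance (μ : SignedRadon) : IsLocallyFiniteMeasure μ.pos := μ.locFin_pos

instance (μ : SignedRadon) : IsLocallyFiniteMeasure μ.neg := μ.locFin_neg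

lemma measure_ext_of_bounded {P Q : Measure ℂ}
    (h : ∀ A, MeasurableSet A → Bornology.IsBounded A → P A = Q A) : P = Q := by
  refine (Measure.ext_iff_of_iUnion_eq_univ
    (s := fun n : ℕ => Metric.closedBall (0 : ℂ) n) (Metric.iUnion_closedBall_nat 0)).2 fun n => ?_
  ext A hA
  rw [Measure.restrict_apply hA, Measure.restrict_apply hA]
  exact h _ (hA.inter Metric.isClosed_closedBall.measurableSet)
    (Metric.isBounded_closedBall.subset inter_subset_right)

/-- Minimality of the Jordan decomposition: `p` is carried by a set on which `q` vanishes, and there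
`p ≤ p + N = P`. Writing the identity with sums avoids subtracting infinite measures. -/
lemma le_of_add_eq_of_mutuallySingular {p q P N : Measure ℂ} (hs : p.MutuallySingular q)
    (h : p + N = q + P) : p ≤ P := by
  obtain ⟨S, hS, hp, hq⟩ := hs
  refine Measure.le_iff.2 fun A hA => ?_
  have h1 : p A = p (A ∩ Sᶜ) := by
    rw [← measure_inter_add_sdiff A hS, measure_mono_null inter_subset_right hp, zero_add]; rfl
  have h2 := congrArg (fun m : Measure ℂ => m (A ∩ Sᶜ)) h
  simp only [Measure.add_apply, measure_mono_null inter_subset_right hq, zero_add] at h2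
  rw [h1]
  calc p (A ∩ Sᶜ) ≤ p (A ∩ Sᶜ) + N (A ∩ Sᶜ) := le_self_add
    _ = P (A ∩ Sᶜ) := h2
    _ ≤ P A := measure_mono inter_subset_left

lemma add_eq_add_of_real {P Q P' Q' : Measure ℂ} [IsLocallyFiniteMeasure P]
    [IsLocallyFiniteMeasure Q] [IsLocallyFiniteMeasure P'] [IsLocallyFiniteMeasure Q']
    (h : ∀ A, MeasurableSet A → Bornology.IsBounded A →
      P.real A - Q.real A = P'.real A - Q'.real A) : P + Q' = Q + P' := by
  refine measure_ext_of_bounded fun A hA hb => ?_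
  have h1 := h A hA hb
  rw [Measure.add_apply, Measure.add_apply,
    ← ENNReal.toReal_eq_toReal_iff' (ENNReal.add_lt_top.2 ⟨hb.measure_lt_top, hb.measure_lt_top⟩).ne
      (ENNReal.add_lt_top.2 ⟨hb.measure_lt_top, hb.measure_lt_top⟩).ne,
    ENNReal.toReal_add hb.measure_lt_top.ne hb.measure_lt_top.ne,
    ENNReal.toReal_add hb.measure_lt_top.ne hb.measure_lt_top.ne]
  simp only [Measure.real] at h1
  linarith

instance (P Q : Measure ℂ) [IsLocallyFiniteMeasure P] [IsLocallyFiniteMeasure Q] :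
    IsLocallyFiniteMeasure (P + Q) := by
  refine ⟨fun x => ?_⟩
  obtain ⟨s, hs, hs'⟩ := P.finiteAt_nhds x
  obtain ⟨t, ht, ht'⟩ := Q.finiteAt_nhds x
  refine ⟨s ∩ t, inter_mem hs ht, ?_⟩
  rw [Measure.add_apply, ENNReal.add_lt_top]
  exact ⟨(measure_mono inter_subset_left).trans_lt hs', (measure_mono inter_subset_right).trans_lt ht'⟩

namespace SignedRadon

variable {μ ν ν' : SignedRadon}

lemma val_eq_pos_or (μ : SignedRadon) (z : ℂ) : μ.pos {z} = 0 ∨ μ.neg {z} = 0 := by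
  obtain ⟨S, hS, hp, hq⟩ := μ.singular
  by_cases hz : z ∈ S
  · exact Or.inl (measure_mono_null (singleton_subset_iff.2 hz) hp)
  · exact Or.inr (measure_mono_null (singleton_subset_iff.2 hz) hq)

lemma eq_of_val (h : ∀ A, MeasurableSet A → Bornology.IsBounded A → ν.val A = ν'.val A) :
    ν = ν' := by
  have h1 : ν.pos + ν'.neg = ν.neg + ν'.pos := add_eq_add_of_real h
  have h2 : ν'.pos + ν.neg = ν'.neg + ν.pos := by
    rw [add_comm ν'.pos, ← h1, add_comm]
  have h1' : ν.neg + ν'.pos = ν.pos + ν'.neg := h1.symm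
  have h2' : ν'.neg + ν.pos = ν'.pos + ν.neg := h2.symm
  exact SignedRadon.ext
    (le_antisymm (le_of_add_eq_of_mutuallySingular ν.singular h1)
      (le_of_add_eq_of_mutuallySingular ν'.singular h2))
    (le_antisymm (le_of_add_eq_of_mutuallySingular ν.singular.symm h1')
      (le_of_add_eq_of_mutuallySingular ν'.singular.symm h2'))

lemma DiffersByIntegerFluxes.val_singleton {n : ℂ → ℤ} (h : μ.DiffersByIntegerFluxes ν n)
    (z : ℂ) : μ.val {z} - ν.val {z} = 2 * Real.pi * n z := by
  rw [(h {z} (measurableSet_singleton z) Bornology.isBounded_singleton).2]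
  congr 1
  rw [finsum_mem_singleton]

lemma eq_of_mem_Ico {a b : ℝ} {n m : ℤ} (ha : a ∈ Ico (-Real.pi) Real.pi)
    (hb : b ∈ Ico (-Real.pi) Real.pi) (h : a + 2 * Real.pi * n = b + 2 * Real.pi * m) :
    n = m := by
  have hpi := Real.pi_pos
  have h1 : 2 * Real.pi * ((n : ℝ) - m) < 2 * Real.pi * 1 := by linarith [hb.2, ha.1]
  have h2 : 2 * Real.pi * ((m : ℝ) - n) < 2 * Real.pi * 1 := by linarith [ha.2, hb.1]
  have h1' := lt_of_mul_lt_mul_left h1 (by positivity)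
  have h2' := lt_of_mul_lt_mul_left h2 (by positivity)
  have h1'' : n - m < 1 := by exact_mod_cast h1'
  have h2'' : m - n < 1 := by exact_mod_cast h2'
  omega

/-- An interval `[-π, π)` contains one representative modulo `2π`, so the weight at `z` depends only
on the atom there. Two measures are allowed because `μ` is also compared with its finite part. -/
lemma weights_eq {μ' : SignedRadon} {n m : ℂ → ℤ} (hatoms : ∀ z, μ.val {z} = μ'.val {z})
    (hn : μ.DiffersByIntegerFluxes ν n) (hν : ∀ z, ν.val {z} ∈ Ico (-Real.pi) Real.pi)
    (hm : μ'.DiffersByIntegerFluxes ν' m) (hν' : ∀ z, ν'.val {z} ∈ Ico (-Real.pi) Real.pi) :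
    n = m := by
  ext z
  refine eq_of_mem_Ico (hν z) (hν' z) ?_
  linarith [hn.val_singleton z, hm.val_singleton z, hatoms z]

lemma IsReduction.unique (h : μ.IsReduction ν) (h' : μ.IsReduction ν') : ν = ν' := by
  obtain ⟨⟨n, hn⟩, hν⟩ := h
  obtain ⟨⟨m, hm⟩, hν'⟩ := h'
  obtain rfl := weights_eq (fun _ => rfl) hn hν hm hν'
  exact eq_of_val fun A hA hb => by linarith [(hn A hA hb).2, (hm A hA hb).2]

lemma IsReduction.pos_real_le (h : μ.IsReduction ν) (z : ℂ) : ν.pos.real {z} ≤ Real.pi := by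
  have h1 := (h.2 z).2
  rcases ν.val_eq_pos_or z with h0 | h0
  · simp [Measure.real, h0, Real.pi_pos.le]
  · simpa [val, Measure.real, h0] using h1.le

lemma IsReduction.neg_real_le (h : μ.IsReduction ν) (z : ℂ) : ν.neg.real {z} ≤ Real.pi := by
  have h1 := (h.2 z).1
  rcases ν.val_eq_pos_or z with h0 | h0
  · have : -Real.pi ≤ -ν.neg.real {z} := by simpa [val, Measure.real, h0] using h1
    linarith
  · simp [Measure.real, h0, Real.pi_pos.le]

lemma measure_univ_lt_top_of_bounded {P : Measure ℂ} {C : ℝ}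
    (h : ∀ R : ℝ, P (Metric.closedBall 0 R) ≤ ENNReal.ofReal C) : P univ < ⊤ := by
  have h1 : Tendsto (fun n : ℕ => P (Metric.closedBall 0 n)) atTop (𝓝 (P univ)) := by
    rw [← Metric.iUnion_closedBall_nat (0 : ℂ)]
    exact tendsto_measure_iUnion_atTop fun a b hab =>
      Metric.closedBall_subset_closedBall (by exact_mod_cast hab)
  exact (le_of_tendsto' h1 fun n => h n).trans_lt ENNReal.ofReal_lt_top

lemma finiteVariation_of_val_le {C : ℝ}
    (h : ∀ A, MeasurableSet A → Bornology.IsBounded A → |ν.val A| ≤ C) : ν.FiniteVariation := by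
  obtain ⟨S, hS, hp, hq⟩ := ν.singular
  rw [FiniteVariation, variation, Measure.add_apply, ENNReal.add_lt_top]
  constructor
  · refine measure_univ_lt_top_of_bounded (C := C) fun R => ?_
    have hb : Bornology.IsBounded (Metric.closedBall (0 : ℂ) R \ S) :=
      Metric.isBounded_closedBall.subset sdiff_subset
    have h1 := (le_abs_self _).trans
      (h _ (Metric.isClosed_closedBall.measurableSet.diff hS) hb)
    have h2 : ν.neg (Metric.closedBall (0 : ℂ) R \ S) = 0 :=
      measure_mono_null (fun x hx => hx.2) hq
    rw [val, Measure.real, Measure.real, h2, ENNReal.toReal_zero, sub_zero] at h1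
    rw [← measure_inter_add_sdiff _ hS, measure_mono_null inter_subset_right hp, zero_add,
      ← ENNReal.ofReal_toReal hb.measure_lt_top.ne]
    exact ENNReal.ofReal_le_ofReal h1
  · refine measure_univ_lt_top_of_bounded (C := C) fun R => ?_
    have hb : Bornology.IsBounded (Metric.closedBall (0 : ℂ) R ∩ S) :=
      Metric.isBounded_closedBall.subset inter_subset_left
    have h1 := (neg_le_abs _).trans
      (h _ (Metric.isClosed_closedBall.measurableSet.inter hS) hb)
    have h2 : ν.pos (Metric.closedBall (0 : ℂ) R ∩ S) = 0 :=
      measure_mono_null inter_subset_right hp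
    rw [val, Measure.real, Measure.real, h2, ENNReal.toReal_zero, zero_sub, neg_neg] at h1
    have h3 : ν.neg (Metric.closedBall (0 : ℂ) R \ S) = 0 :=
      measure_mono_null (fun x hx => hx.2) hq
    rw [← measure_inter_add_sdiff _ hS, h3, add_zero,
      ← ENNReal.ofReal_toReal hb.measure_lt_top.ne]
    exact ENNReal.ofReal_le_ofReal h1

lemma FiniteVariation.pos (h : μ.FiniteVariation) : IsFiniteMeasure μ.pos :=
  ⟨lt_of_le_of_lt (by rw [variation, Measure.add_apply]; exact le_self_add) h⟩

lemma FiniteVariation.neg (h : μ.FiniteVariation) : IsFiniteMeasure μ.neg :=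
  ⟨lt_of_le_of_lt (by rw [variation, Measure.add_apply]; exact le_add_self) h⟩

lemma abs_val_le_pos_add_neg (h : μ.FiniteVariation) (A : Set ℂ) :
    |μ.val A| ≤ μ.pos.real univ + μ.neg.real univ := by
  have := h.pos
  have := h.neg
  have h1 := measureReal_mono (μ := μ.pos) (subset_univ A)
  have h2 := measureReal_mono (μ := μ.neg) (subset_univ A)
  have h3 : 0 ≤ μ.pos.real A := measureReal_nonneg
  have h4 : 0 ≤ μ.neg.real A := measureReal_nonneg
  rw [val, abs_le]
  constructor <;> linarith

/-- A point with nonzero weight carries an atom of total variation at least `π`. -/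
lemma IsReduction.finite_weights (hμ : μ.FiniteVariation) {n : ℂ → ℤ}
    (hn : μ.DiffersByIntegerFluxes ν n) (hν : ∀ z, ν.val {z} ∈ Ico (-Real.pi) Real.pi) :
    {z | n z ≠ 0}.Finite := by
  by_contra hinf
  refine hμ.not_ge (le_of_eq_of_le ?_ (measure_mono (subset_univ {z | n z ≠ 0})))
  refine (Set.Infinite.meas_eq_top hinf ⟨ENNReal.ofReal Real.pi, by simp [Real.pi_pos], ?_⟩).symm
  intro z hz
  have := hμ.pos
  have := hμ.neg
  have h1 := hn.val_singleton z
  have h2 : Real.pi ≤ |μ.val {z}| := by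
    rcases lt_or_gt_of_ne hz with h | h
    · have : (n z : ℝ) ≤ -1 := by exact_mod_cast Int.le_sub_one_of_lt h
      rw [le_abs]; right
      nlinarith [(hν z).2, Real.pi_pos]
    · have : (1 : ℝ) ≤ n z := by exact_mod_cast h
      rw [le_abs]; left
      nlinarith [(hν z).1, Real.pi_pos]
  have h3 : |μ.val {z}| ≤ μ.pos.real {z} + μ.neg.real {z} := by
    have h3 : 0 ≤ μ.pos.real {z} := measureReal_nonneg
    have h4 : 0 ≤ μ.neg.real {z} := measureReal_nonneg
    rw [val, abs_le]
    constructor <;> linarith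
  rw [variation, ENNReal.ofReal_le_iff_le_toReal (by
    rw [Measure.add_apply]; exact (ENNReal.add_lt_top.2 ⟨measure_lt_top _ _, measure_lt_top _ _⟩).ne),
    Measure.add_apply, ENNReal.toReal_add (measure_ne_top _ _) (measure_ne_top _ _)]
  exact h2.trans h3

lemma IsReduction.finiteVariation (hμ : μ.FiniteVariation) (h : μ.IsReduction ν) :
    ν.FiniteVariation := by
  obtain ⟨⟨n, hn⟩, hν⟩ := h
  have hfin := IsReduction.finite_weights hμ hn hν
  refine finiteVariation_of_val_le
    (C := μ.pos.real univ + μ.neg.real univ + 2 * Real.pi * ∑ z ∈ hfin.toFinset, |(n z : ℝ)|)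
    fun A hA hb => ?_
  have h1 := (hn A hA hb).2
  have h2 : |∑ᶠ (z : ℂ) (_ : z ∈ A), (n z : ℝ)| ≤ ∑ z ∈ hfin.toFinset, |(n z : ℝ)| := by
    rw [finsum_mem_eq_sum_of_inter_support_eq (t := (hfin.inter_of_right A).toFinset)]
    · refine (Finset.abs_sum_le_sum_abs _ _).trans
        (Finset.sum_le_sum_of_subset_of_nonneg ?_ fun _ _ _ => abs_nonneg _)
      intro z hz
      simp only [Finite.mem_toFinset] at hz ⊢
      exact hz.2
    · ext z
      simp
  have h3 := abs_val_le_pos_add_neg hμ A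
  have h4 : ν.val A = μ.val A - 2 * Real.pi * ∑ᶠ (z : ℂ) (_ : z ∈ A), (n z : ℝ) := by linarith
  rw [h4]
  refine (abs_sub _ _).trans (add_le_add h3 ?_)
  rw [abs_mul, abs_of_pos (by positivity : 0 < 2 * Real.pi)]
  exact mul_le_mul_of_nonneg_left h2 (by positivity)

end SignedRadon

/-- An atom off the origin would be repeated at all points of its circle, an infinite set of finite
measure. -/
lemma measure_singleton_eq_zero_of_rotationInvariant {P : Measure ℂ} [IsLocallyFiniteMeasure P]
    (hrot : ∀ c : ℂ, ‖c‖ = 1 → P.map (fun z => c * z) = P) {z : ℂ} (hz : z ≠ 0) : P {z} = 0 := by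
  by_contra h
  have h1 : ∀ w ∈ Metric.sphere (0 : ℂ) ‖z‖, P {z} ≤ P {w} := by
    intro w hw
    have hw' : ‖w‖ = ‖z‖ := by simpa using hw
    have hc : ‖w / z‖ = 1 := by
      rw [norm_div, hw', div_self (norm_ne_zero_iff.2 hz)]
    conv_rhs => rw [← hrot _ hc]
    rw [Measure.map_apply (by fun_prop) (measurableSet_singleton w)]
    refine measure_mono (singleton_subset_iff.2 ?_)
    simp [div_mul_cancel₀ w hz]
  have hinf : (Metric.sphere (0 : ℂ) ‖z‖).Infinite := by
    have hpre := (isPreconnected_sphere (by simp [Complex.rank_real_complex]) (0 : ℂ) ‖z‖)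
    refine hpre.infinite_of_nontrivial ⟨z, by simp, -z, by simp, fun h => hz ?_⟩
    have : (2 : ℂ) * z = 0 := by linear_combination h
    simpa using this
  have := hinf.meas_eq_top ⟨P {z}, h, h1⟩
  exact (Metric.isBounded_sphere (x := (0 : ℂ)) (r := ‖z‖)).measure_lt_top.ne this

end Measures

-- The potential adapted to the radial decomposition.

section Reduced

open SignedRadon

variable {μ μrad μt ν νt : SignedRadon} {Φrad : EReal}

/-- At the origin the hypothesis only equates the two masses, but by mutual singularity one of them
is zero. Elsewhere rotation invariance excludes atoms. -/
lemma RadialDecomposition.pos_singleton (h : RadialDecomposition μ μrad μt Φrad) (z : ℂ) :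
    μrad.pos {z} = 0 ∧ μrad.neg {z} = 0 := by
  rcases eq_or_ne z 0 with rfl | hz
  · have h0 := h.noAtomZero
    have hp : μrad.pos {(0 : ℂ)} ≠ ⊤ := Bornology.isBounded_singleton.measure_lt_top.ne
    have hq : μrad.neg {(0 : ℂ)} ≠ ⊤ := Bornology.isBounded_singleton.measure_lt_top.ne
    rw [val, Measure.real, Measure.real, sub_eq_zero, ENNReal.toReal_eq_toReal_iff' hp hq] at h0
    rcases μrad.val_eq_pos_or 0 with h1 | h1
    · exact ⟨h1, h0 ▸ h1⟩
    · exact ⟨h0 ▸ h1, h1⟩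
  · exact ⟨measure_singleton_eq_zero_of_rotationInvariant (fun c hc => (h.radial c hc).1) hz,
      measure_singleton_eq_zero_of_rotationInvariant (fun c hc => (h.radial c hc).2) hz⟩

/-- Since `μrad` has no atoms, `μ` and `μt` have the same atoms and hence the same integer weights.
-/
lemma RadialDecomposition.val_reduction (h : RadialDecomposition μ μrad μt Φrad)
    (hν : μ.IsReduction ν) (hνt : μt.IsReduction νt) {A : Set ℂ} (hA : MeasurableSet A)
    (hb : Bornology.IsBounded A) : ν.val A = μrad.val A + νt.val A := by
  obtain ⟨⟨n, hn⟩, hν⟩ := hν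
  obtain ⟨⟨m, hm⟩, hνt⟩ := hνt
  obtain rfl := weights_eq (fun z => by
    rw [h.isSum _ (measurableSet_singleton z) Bornology.isBounded_singleton]
    simp [val, Measure.real, h.pos_singleton z]) hn hν hm hνt
  linarith [(hn A hA hb).2, (hm A hA hb).2, h.isSum A hA hb]

lemma RadialDecomposition.add_eq_add (h : RadialDecomposition μ μrad μt Φrad)
    (hν : μ.IsReduction ν) (hνt : μt.IsReduction νt) :
    ν.pos + (μrad.neg + νt.neg) = ν.neg + (μrad.pos + νt.pos) := by
  have := (hνt.finiteVariation h.finite).pos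
  have := (hνt.finiteVariation h.finite).neg
  refine add_eq_add_of_real fun A hA hb => ?_
  have h1 := h.val_reduction hν hνt hA hb
  rw [measureReal_add_apply hb.measure_lt_top.ne hb.measure_lt_top.ne,
    measureReal_add_apply hb.measure_lt_top.ne hb.measure_lt_top.ne]
  simp only [val] at h1
  linarith

/-- A potential generating `ν` built from a radial part and a part of finite variation. -/
lemma isGeneratingPotential_fieldPot {Pr Nr Pt Nt : Measure ℂ} [IsLocallyFiniteMeasure Pr]
    [IsLocallyFiniteMeasure Nr] [IsFiniteMeasure Pt] [IsFiniteMeasure Nt]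
    (hP : ∀ c : ℂ, ‖c‖ = 1 → Pr.map (fun z => c * z) = Pr) (hP0 : Pr {0} = 0)
    (hN : ∀ c : ℂ, ‖c‖ = 1 → Nr.map (fun z => c * z) = Nr) (hN0 : Nr {0} = 0)
    (h : ν.pos + (Nr + Nt) = ν.neg + (Pr + Pt)) :
    IsGeneratingPotential (fieldPot Pr Nr Pt Nt) ν := by
  have l1 := locallyIntegrable_radPot Pr
  have l2 := locallyIntegrable_radPot Nr
  have l3 := locallyIntegrable_logPot Pt
  have l4 := locallyIntegrable_logPot Nt
  refine ⟨((l1.sub l2).add (l3.sub l4)).smul (2 * Real.pi)⁻¹, fun φ hφ hc => ?_⟩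
  have hi : ∀ {w : ℂ → ℝ}, LocallyIntegrable w volume →
      Integrable (fun z => w z * Laplacian.laplacian φ z) := fun hw =>
    hw.integrable_smul_right_of_hasCompactSupport (continuous_laplacian hφ)
      (hasCompactSupport_laplacian hφ hc)
  have e : ∀ z, fieldPot Pr Nr Pt Nt z * Laplacian.laplacian φ z = (2 * Real.pi)⁻¹ *
      (radPot Pr z * Laplacian.laplacian φ z - radPot Nr z * Laplacian.laplacian φ z +
        (logPot Pt z * Laplacian.laplacian φ z - logPot Nt z * Laplacian.laplacian φ z)) :=
    fun z => by rw [fieldPot]; ring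
  have hφi : ∀ (P : Measure ℂ) [IsLocallyFiniteMeasure P], Integrable φ P :=
    fun P _ => hφ.continuous.integrable_of_hasCompactSupport hc
  have h1 := congrArg (fun m : Measure ℂ => ∫ z, φ z ∂m) h
  rw [integral_add_measure (hφi _) (hφi _), integral_add_measure (hφi _) (hφi _),
    integral_add_measure (hφi _) (hφi _), integral_add_measure (hφi _) (hφi _)] at h1
  simp only [e]
  have i1 : Integrable (fun z => radPot Pr z * Laplacian.laplacian φ z
      - radPot Nr z * Laplacian.laplacian φ z) := (hi l1).sub (hi l2)
  have i2 : Integrable (fun z => logPot Pt z * Laplacian.laplacian φ z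
      - logPot Nt z * Laplacian.laplacian φ z) := (hi l3).sub (hi l4)
  rw [integral_const_mul, integral_add i1 i2, integral_sub (hi l1) (hi l2),
    integral_sub (hi l3) (hi l4),
    integral_radPot_mul_laplacian Pr hP hP0 hφ hc, integral_radPot_mul_laplacian Nr hN hN0 hφ hc,
    integral_logPot_mul_laplacian Pt hφ hc, integral_logPot_mul_laplacian Nt hφ hc]
  have hpi := Real.pi_ne_zero
  field_simp
  linarith

/-- The pairs of measures entering `fieldPot` come from `μrad` and from the reduction of `μt`, not
from the Jordan decomposition of `ν`. Infinite mass is thus confined to the radial part. -/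
theorem HasRegularFlux.exists_regularWeight {Φ : EReal} (hμ : HasRegularFlux μ Φ)
    (hν : μ.IsReduction ν) : ∃ h₀, RegularWeight h₀ Φ ∧ IsGeneratingPotential h₀ ν := by
  obtain ⟨μrad, μt, νt, Φrad, hd, hνt, rfl⟩ := hμ
  have := (hνt.finiteVariation hd.finite).pos
  have := (hνt.finiteVariation hd.finite).neg
  refine ⟨fieldPot μrad.pos μrad.neg νt.pos νt.neg, ?_, ?_⟩
  · exact regularWeight_fieldPot _ _ _ _ (hd.pos_singleton 0).1 (hd.pos_singleton 0).2
      hνt.pos_real_le hνt.neg_real_le hd.tendsto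
  · exact isGeneratingPotential_fieldPot (fun c hc => (hd.radial c hc).1) (hd.pos_singleton 0).1
      (fun c hc => (hd.radial c hc).2) (hd.pos_singleton 0).2 (hd.add_eq_add hν hνt)

lemma SignedRadon.FiniteVariation.tendsto_discFlux (h : ν.FiniteVariation) :
    Tendsto ν.discFlux atTop (𝓝 ν.flux) := by
  have := h.pos
  have := h.neg
  exact ((tendsto_measureReal_closedBall_atTop ν.pos).sub
    (tendsto_measureReal_closedBall_atTop ν.neg)).div_const _

/-- Recovers `Φ` from the reduced field alone, independently of the decomposition. When `ν` turns
out to be finite, its flux is therefore `Φ`. -/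
lemma HasRegularFlux.tendsto_discFlux {Φ : EReal} (hμ : HasRegularFlux μ Φ)
    (hν : μ.IsReduction ν) : Tendsto (fun R => (ν.discFlux R : EReal)) atTop (𝓝 Φ) := by
  obtain ⟨μrad, μt, νt, Φrad, hd, hνt, rfl⟩ := hμ
  have h1 : Tendsto (fun R => (νt.discFlux R : EReal)) atTop (𝓝 (νt.flux : EReal)) :=
    (continuous_coe_real_ereal.tendsto _).comp (hνt.finiteVariation hd.finite).tendsto_discFlux
  have h2 := (EReal.continuousAt_add (p := (Φrad, (νt.flux : EReal))) (by simp)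
    (by simp)).tendsto.comp (hd.tendsto.prodMk_nhds h1)
  refine h2.congr fun R => ?_
  simp only [Function.comp_apply, discFlux]
  rw [hd.val_reduction hν hνt Metric.isClosed_closedBall.measurableSet
    Metric.isBounded_closedBall, ← EReal.coe_add, add_div]

lemma SignedRadon.CompactlySupported.exists_closedBall (h : ν.CompactlySupported) :
    ∃ R : ℝ, ν.pos (Metric.closedBall 0 R)ᶜ = 0 ∧ ν.neg (Metric.closedBall 0 R)ᶜ = 0 := by
  obtain ⟨K, hK, h0⟩ := h
  obtain ⟨R, hR⟩ := hK.isBounded.subset_closedBall 0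
  rw [variation, Measure.add_apply, add_eq_zero] at h0
  exact ⟨R, measure_mono_null (compl_subset_compl.2 hR) h0.1,
    measure_mono_null (compl_subset_compl.2 hR) h0.2⟩

lemma measure_univ_lt_top_of_closedBall {P : Measure ℂ} [IsLocallyFiniteMeasure P] {R : ℝ}
    (h : P (Metric.closedBall 0 R)ᶜ = 0) : P univ < ⊤ := by
  rw [← measure_add_measure_compl (Metric.isClosed_closedBall (x := (0 : ℂ)) (ε := R)).measurableSet,
    h, add_zero]
  exact Metric.isBounded_closedBall.measure_lt_top

end Reduced

-- Dimension count according to the value of `Φ`.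

section Dimensions

variable {h h₀ : ℂ → ℝ} {Φ : EReal}

lemma RegularWeight.conj (H : RegularWeight h Φ) : RegularWeight (conjPot h) (-Φ) :=
  H.neg.comp_conj

/-- The difference of the potentials is weakly harmonic, hence the real part of an entire `E`. For
the conjugated potentials the entire function is `-conj (E (conj z))`. -/
lemma dimHol_eq_of_generating {ν : SignedRadon} (hh : IsGeneratingPotential h ν)
    (hh₀ : IsGeneratingPotential h₀ ν) :
    dimHol h = dimHol h₀ ∧ dimHol (conjPot h) = dimHol (conjPot h₀) := by
  obtain ⟨E, hE, hEe⟩ := exists_entire_re_ae_eq (u := fun z => h z - h₀ z) (hh.1.sub hh₀.1)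
    fun φ hφ hc => by
      have hi : ∀ {w : ℂ → ℝ}, LocallyIntegrable w volume →
          Integrable (fun z => w z * Laplacian.laplacian φ z) := fun hw =>
        hw.integrable_smul_right_of_hasCompactSupport (continuous_laplacian hφ)
          (hasCompactSupport_laplacian hφ hc)
      simp only [sub_mul]
      rw [integral_sub (hi hh.1) (hi hh₀.1), hh.2 φ hφ hc, hh₀.2 φ hφ hc, sub_self]
  refine ⟨dimHol_congr hE (by filter_upwards [hEe] with z hz; linarith), ?_⟩
  have hE' : Differentiable ℂ (fun z => -(starRingEnd ℂ) (E (starRingEnd ℂ z))) := by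
    refine Differentiable.neg fun z => ?_
    exact (differentiableAt_conj_conj_iff (f := E)).2 (hE _)
  refine dimHol_congr hE' ?_
  filter_upwards [ae_comp_conj hEe] with z hz
  simp only [conjPot, Complex.neg_re, Complex.conj_re]
  linarith

lemma RegularWeight.dimHol_conj_eq_zero (H : RegularWeight h Φ) (hΦ : Φ ≤ 0) :
    dimHol (conjPot h) = 0 := by
  refine H.conj.dimHol_eq_zero (lt_of_lt_of_le (by norm_cast) (EReal.neg_nonneg.2 hΦ))

lemma RegularWeight.dimHol_eq_zero_of_nonneg (H : RegularWeight h Φ) (hΦ : 0 ≤ Φ) :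
    dimHol h = 0 :=
  H.dimHol_eq_zero (lt_of_lt_of_le (by norm_cast) hΦ)

/-- For real non-integer `Φ = r` the number `K = ⌊-r⌋` satisfies `-1 < K + r < 0`, so no exponent is
critical; for `Φ = -∞` every power is admissible. -/
lemma RegularWeight.dimHol_eq_floor (H : RegularWeight h Φ) (hneg : Φ < 0)
    (hn : ∀ n : ℤ, Φ ≠ ((n : ℝ) : EReal)) : dimHol h = ⌊Φ.abs⌋ₑ := by
  induction Φ with
  | bot => rw [H.dimHol_bot]; simp
  | top => simp at hneg
  | coe r =>
    have hr : r < 0 := by exact_mod_cast hneg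
    have h1 : (⌊-r⌋₊ : ℝ) ≤ -r := Nat.floor_le (by linarith)
    have h2 : -r < ⌊-r⌋₊ + 1 := Nat.lt_floor_add_one _
    have h3 : (⌊-r⌋₊ : ℝ) ≠ -r := fun h => hn (-(⌊-r⌋₊ : ℤ)) (by
      rw [Int.cast_neg, Int.cast_natCast, h, neg_neg])
    have h4 := lt_of_le_of_ne h1 h3
    rw [H.dimHol_eq (K := ⌊-r⌋₊) (by linarith) (by linarith), EReal.abs_def, abs_of_neg hr,
      ENNReal.ofReal, ENat.floor_coe]
    congr 1
    have : ⌊(-r).toNNReal⌋₊ = ⌊((-r).toNNReal : ℝ)⌋₊ := rfl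
    rw [this, Real.coe_toNNReal _ (by linarith)]

lemma RegularWeight.total_eq_floor (H : RegularWeight h Φ)
    (hn : (∀ n : ℤ, Φ ≠ ((n : ℝ) : EReal)) ∨ Φ = 0) :
    dimHol h + dimHol (conjPot h) = ⌊Φ.abs⌋ₑ := by
  rcases lt_trichotomy Φ 0 with h1 | h1 | h1
  · rw [H.dimHol_conj_eq_zero h1.le, add_zero,
      H.dimHol_eq_floor h1 (hn.resolve_right h1.ne)]
  · rw [H.dimHol_conj_eq_zero h1.le, H.dimHol_eq_zero_of_nonneg h1.ge, h1]
    simp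
  · have hn' := hn.resolve_right h1.ne'
    rw [H.dimHol_eq_zero_of_nonneg h1.le, zero_add, ← EReal.abs_neg]
    refine H.conj.dimHol_eq_floor (by rwa [EReal.neg_lt_comm, neg_zero]) fun n hΦ => hn' (-n) ?_
    rw [← neg_neg Φ, hΦ]
    push_cast
    rfl

/-- Isolates the critical exponent `K = |n| - 1` by writing `n = -(K + 1)`. -/
lemma eq_neg_natAbs {n : ℤ} (hn : n < 0) : (n : ℝ) = -(((n.natAbs - 1 : ℕ) : ℝ) + 1) := by
  have h : n = -(((n.natAbs - 1 : ℕ) : ℤ) + 1) := by omega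
  exact_mod_cast congrArg (Int.cast : ℤ → ℝ) h

lemma RegularWeight.dimHol_integer_or {n : ℤ} (hn : n < 0)
    (H : RegularWeight h ((n : ℝ) : EReal)) :
    dimHol h = (n.natAbs : ℕ∞) ∨ dimHol h = ((n.natAbs - 1 : ℕ) : ℕ∞) := by
  rw [eq_neg_natAbs hn] at H
  by_cases hm : (fun z : ℂ => z ^ (n.natAbs - 1)) ∈ HolL2 h
  · left
    rw [H.dimHol_integer_of_mem hm]
    congr 1
    omega
  · exact Or.inr (H.dimHol_integer_of_notMem hm)

lemma RegularWeight.neg_int {n : ℤ} (H : RegularWeight h ((n : ℝ) : EReal)) :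
    RegularWeight (conjPot h) (((-n : ℤ) : ℝ) : EReal) := by
  have := H.conj
  rwa [← EReal.coe_neg, ← Int.cast_neg] at this

lemma RegularWeight.total_integer_neg {n : ℤ} (hn : n < 0)
    (H : RegularWeight h ((n : ℝ) : EReal)) :
    dimHol h + dimHol (conjPot h) = dimHol h := by
  rw [H.dimHol_conj_eq_zero (by exact_mod_cast hn.le), add_zero]

lemma RegularWeight.total_integer_pos {n : ℤ} (hn : 0 < n)
    (H : RegularWeight h ((n : ℝ) : EReal)) :
    dimHol h + dimHol (conjPot h) = dimHol (conjPot h) := by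
  rw [H.dimHol_eq_zero_of_nonneg (by exact_mod_cast hn.le), zero_add]

lemma RegularWeight.total_integer_or {n : ℤ} (hn : n ≠ 0)
    (H : RegularWeight h ((n : ℝ) : EReal)) :
    dimHol h + dimHol (conjPot h) = (n.natAbs : ℕ∞) ∨
      dimHol h + dimHol (conjPot h) = ((n.natAbs - 1 : ℕ) : ℕ∞) := by
  rcases lt_or_gt_of_ne hn with h1 | h1
  · rw [H.total_integer_neg h1]
    exact H.dimHol_integer_or h1
  · rw [H.total_integer_pos h1, ← Int.natAbs_neg]
    exact H.neg_int.dimHol_integer_or (by omega)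

lemma RegularWeight.dimHol_of_lower_bound {n : ℤ} (hn : n < 0)
    (H : RegularWeight h ((n : ℝ) : EReal)) {C R : ℝ}
    (hlow : ∀ x : ℂ, R ≤ ‖x‖ → n * Real.log (1 + ‖x‖) - C ≤ h x) :
    dimHol h = ((n.natAbs - 1 : ℕ) : ℕ∞) := by
  rw [eq_neg_natAbs hn] at H hlow
  exact H.dimHol_integer_of_notMem (pow_notMem_HolL2 hlow)

lemma radPot_zero_measure (x : ℂ) : radPot 0 x = 0 := by simp [radPot]

/-- The logarithmic potential of a measure with compactly supported positive part. -/
lemma exists_le_fieldPot (P N : Measure ℂ) [IsFiniteMeasure P] [IsFiniteMeasure N] {R : ℝ}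
    (hP : P (Metric.closedBall 0 R)ᶜ = 0) :
    ∃ C R' : ℝ, ∀ x : ℂ, R' ≤ ‖x‖ →
      (P.real univ - N.real univ) / (2 * Real.pi) * Real.log (1 + ‖x‖) - C
        ≤ fieldPot 0 0 P N x := by
  obtain ⟨C, hC⟩ := le_logPot_of_support_closedBall P hP
  refine ⟨(2 * Real.pi)⁻¹ * C, 2 * R + 1, fun x hx => ?_⟩
  have h1 := hC x hx
  have h2 := logPot_le N x
  rw [fieldPot, radPot_zero_measure]
  have h3 : (P.real univ - N.real univ) / (2 * Real.pi) * Real.log (1 + ‖x‖)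
      - (2 * Real.pi)⁻¹ * C = (2 * Real.pi)⁻¹ * (P.real univ * Real.log (1 + ‖x‖) - C
        - N.real univ * Real.log (1 + ‖x‖)) := by
    field_simp
    ring
  rw [h3]
  exact mul_le_mul_of_nonneg_left (by linarith) (by have := Real.pi_pos; positivity)

lemma SignedRadon.IsReduction.regularWeight_fieldPot {μ ν : SignedRadon} (hν : μ.IsReduction ν)
    (hfin : ν.FiniteVariation) :
    RegularWeight (fieldPot 0 0 ν.pos ν.neg) (ν.flux : EReal) := by
  have := hfin.pos
  have := hfin.neg
  have := PauliMeasure.regularWeight_fieldPot 0 0 ν.pos ν.neg (by simp) (by simp)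
    hν.pos_real_le hν.neg_real_le (Φrad := 0) (by simp)
  rwa [zero_add] at this

lemma SignedRadon.FiniteVariation.isGeneratingPotential_fieldPot {ν : SignedRadon}
    (hfin : ν.FiniteVariation) : IsGeneratingPotential (fieldPot 0 0 ν.pos ν.neg) ν := by
  have := hfin.pos
  have := hfin.neg
  exact PauliMeasure.isGeneratingPotential_fieldPot (by simp) (by simp) (by simp) (by simp)
    (by rw [zero_add, zero_add, add_comm])

lemma SignedRadon.IsReduction.dimHol_fieldPot {μ ν : SignedRadon} (hν : μ.IsReduction ν)
    (hfin : ν.FiniteVariation) {n : ℤ} (hn : n < 0) (hflux : ν.flux = n) {R : ℝ}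
    (hP : ν.pos (Metric.closedBall 0 R)ᶜ = 0) :
    dimHol (fieldPot 0 0 ν.pos ν.neg) = ((n.natAbs - 1 : ℕ) : ℕ∞) := by
  have := hfin.pos
  have := hfin.neg
  obtain ⟨C, R', h1⟩ := exists_le_fieldPot ν.pos ν.neg hP
  have H := hν.regularWeight_fieldPot hfin
  rw [hflux] at H
  refine H.dimHol_of_lower_bound hn (C := C) (R := R') fun x hx => ?_
  rw [← hflux]
  exact h1 x hx

lemma SignedRadon.IsReduction.dimHol_conjPot_fieldPot {μ ν : SignedRadon} (hν : μ.IsReduction ν)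
    (hfin : ν.FiniteVariation) {n : ℤ} (hn : 0 < n) (hflux : ν.flux = n) {R : ℝ}
    (hP : ν.neg (Metric.closedBall 0 R)ᶜ = 0) :
    dimHol (conjPot (fieldPot 0 0 ν.pos ν.neg)) = ((n.natAbs - 1 : ℕ) : ℕ∞) := by
  have := hfin.pos
  have := hfin.neg
  obtain ⟨C, R', h1⟩ := exists_le_fieldPot ν.neg ν.pos hP
  have H := hν.regularWeight_fieldPot hfin
  rw [hflux] at H
  rw [← Int.natAbs_neg]
  refine H.neg_int.dimHol_of_lower_bound (by omega) (C := C) (R := R') fun x hx => ?_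
  have h2 := h1 (starRingEnd ℂ x) (by simpa using hx)
  rw [conjPot, fieldPot_neg]
  have h3 : ((-n : ℤ) : ℝ) = (ν.neg.real univ - ν.pos.real univ) / (2 * Real.pi) := by
    rw [Int.cast_neg, ← hflux, flux, val]; ring
  rw [h3]
  simpa using h2

/-- For a field of definite sign the absolute flux through discs increases with the radius, so its
finite limit bounds the total mass. -/
lemma SignedRadon.DefiniteSign.finiteVariation {ν : SignedRadon} (hs : ν.DefiniteSign) {r : ℝ}
    (ht : Tendsto ν.discFlux atTop (𝓝 r)) : ν.FiniteVariation := by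
  have hpi := Real.pi_pos
  have hb : ∀ R : ℝ, ν.pos.real (Metric.closedBall 0 R) + ν.neg.real (Metric.closedBall 0 R)
      ≤ 2 * Real.pi * |r| := by
    intro R
    have ht' := ht.abs
    have hval : ∀ R, ν.pos.real (Metric.closedBall 0 R) + ν.neg.real (Metric.closedBall 0 R)
        = 2 * Real.pi * |ν.discFlux R| := by
      intro R
      rw [discFlux, abs_div, abs_of_pos (by positivity : 0 < 2 * Real.pi),
        mul_div_cancel₀ _ (by positivity), val]
      rcases hs with h0 | h0 <;> simp [h0, abs_of_nonneg measureReal_nonneg]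
    have hmono : Monotone fun R => |ν.discFlux R| := by
      intro a b hab
      refine le_of_mul_le_mul_left (a := 2 * Real.pi) ?_ (by positivity)
      rw [← hval, ← hval]
      have hsub : Metric.closedBall (0 : ℂ) a ⊆ Metric.closedBall 0 b :=
        Metric.closedBall_subset_closedBall hab
      exact add_le_add
        (measureReal_mono hsub Metric.isBounded_closedBall.measure_lt_top.ne)
        (measureReal_mono hsub Metric.isBounded_closedBall.measure_lt_top.ne)
    rw [hval]
    exact mul_le_mul_of_nonneg_left (hmono.ge_of_tendsto ht' R) (by positivity)
  have hlt : ∀ P : Measure ℂ, IsLocallyFiniteMeasure P →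
      (∀ R : ℝ, P.real (Metric.closedBall 0 R) ≤ 2 * Real.pi * |r|) → P univ < ⊤ := by
    intro P _ hP
    refine measure_univ_lt_top_of_bounded (C := 2 * Real.pi * |r|) fun R => ?_
    rw [← ENNReal.ofReal_toReal
      (Metric.isBounded_closedBall (x := (0 : ℂ)) (r := R)).measure_lt_top.ne]
    exact ENNReal.ofReal_le_ofReal (hP R)
  rw [FiniteVariation, variation, Measure.add_apply, ENNReal.add_lt_top]
  exact ⟨hlt _ inferInstance fun R => (le_add_of_nonneg_right measureReal_nonneg).trans (hb R),
    hlt _ inferInstance fun R => (le_add_of_nonneg_left measureReal_nonneg).trans (hb R)⟩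

lemma SignedRadon.CompactlySupported.finiteVariation {ν : SignedRadon}
    (hs : ν.CompactlySupported) : ν.FiniteVariation := by
  obtain ⟨R, h1, h2⟩ := hs.exists_closedBall
  rw [FiniteVariation, variation, Measure.add_apply, ENNReal.add_lt_top]
  exact ⟨measure_univ_lt_top_of_closedBall h1, measure_univ_lt_top_of_closedBall h2⟩

/-- Here `ν` is finite with flux `n`, so its purely logarithmic potential may be used. The lower
bound at the critical exponent requires only the part of `ν` of sign opposite to `n` to have compact
support, and a definite sign makes that part vanish. -/
theorem HasRegularFlux.total_of_compactlySupported_or_definiteSign {μ ν : SignedRadon} {n : ℤ}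
    (hμ : HasRegularFlux μ ((n : ℝ) : EReal)) (hν : μ.IsReduction ν) (hn : n ≠ 0)
    (hs : ν.CompactlySupported ∨ ν.DefiniteSign) (hh : IsGeneratingPotential h ν) :
    dimHol h + dimHol (conjPot h) = ((n.natAbs - 1 : ℕ) : ℕ∞) := by
  have ht : Tendsto ν.discFlux atTop (𝓝 (n : ℝ)) :=
    EReal.tendsto_coe.1 (hμ.tendsto_discFlux hν)
  have hfin : ν.FiniteVariation := by
    rcases hs with h | h
    · exact h.finiteVariation
    · exact h.finiteVariation ht
  have hflux : ν.flux = n := tendsto_nhds_unique hfin.tendsto_discFlux ht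
  have H := hν.regularWeight_fieldPot hfin
  rw [hflux] at H
  obtain ⟨e1, e2⟩ := dimHol_eq_of_generating hh hfin.isGeneratingPotential_fieldPot
  rw [e1, e2]
  have := Real.pi_pos
  rcases lt_or_gt_of_ne hn with h1 | h1
  · rw [H.total_integer_neg h1]
    have hR : ∃ R, ν.pos (Metric.closedBall 0 R)ᶜ = 0 := by
      rcases hs with h | h | h
      · obtain ⟨R, h2, -⟩ := h.exists_closedBall
        exact ⟨R, h2⟩
      · exfalso
        have : (0 : ℝ) ≤ n := by
          rw [← hflux, SignedRadon.flux, SignedRadon.val, h]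
          simp only [measureReal_zero_apply, sub_zero]
          positivity
        exact absurd h1 (not_lt.2 (by exact_mod_cast this))
      · exact ⟨0, by simp [h]⟩
    obtain ⟨R, hR⟩ := hR
    exact hν.dimHol_fieldPot hfin h1 hflux hR
  · rw [H.total_integer_pos h1]
    have hR : ∃ R, ν.neg (Metric.closedBall 0 R)ᶜ = 0 := by
      rcases hs with h | h | h
      · obtain ⟨R, -, h2⟩ := h.exists_closedBall
        exact ⟨R, h2⟩
      · exact ⟨0, by simp [h]⟩
      · exfalso
        have : (0 : ℝ) ≤ -n := by
          rw [← hflux, SignedRadon.flux, SignedRadon.val, h]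
          simp only [measureReal_zero_apply, zero_sub, neg_div, neg_neg]
          positivity
        have h3 : (n : ℝ) ≤ 0 := by linarith
        exact absurd h1 (not_lt.2 (by exact_mod_cast h3))
    obtain ⟨R, hR⟩ := hR
    exact hν.dimHol_conjPot_fieldPot hfin h1 hflux hR

end Dimensions

-- Dimension and spin of the zero modes.

section ZeroModes

variable {μ ν : SignedRadon} {Φ : EReal} {H : Spinor →ₗ.[ℂ] Spinor}

lemma sigma3_mulVec (v : EuclideanSpace ℂ (Fin 2)) : sigma3.mulVec v.ofLp = ![v 0, -v 1] := by
  ext i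
  fin_cases i <;> simp [sigma3, Matrix.mulVec, dotProduct]

/-- Upper components come from `HolL2 h` and lower ones from `HolL2 (conjPot h)`. The sign of `Φ`
annihilates one of these spaces, and `Φ = 0` both. -/
theorem kernelHasSpin_sign {h : ℂ → ℝ} {H₀ : Spinor →ₗ.[ℂ] Spinor} {U : Spinor ≃ₗᵢ[ℂ] Spinor}
    {c : ℂ → ℂ} (hH₀ : IsFormOperator h H₀)
    (hU : ∀ ψ η : Spinor, (ψ, η) ∈ H.graph ↔ (U ψ, U η) ∈ H₀.graph)
    (hc : ∀ ψ : Spinor, ∀ᵐ z, U ψ z = c z • ψ z)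
    (hup : 0 ≤ Φ → dimHol h = 0) (hdown : Φ ≤ 0 → dimHol (conjPot h) = 0) :
    KernelHasSpin H ((SignType.sign Φ : ℤ) : ℂ) := by
  intro ψ hψ
  rcases lt_trichotomy Φ 0 with h1 | h1 | h1
  · filter_upwards [kernel_down_eq_zero hH₀ hU hc (hdown h1.le) ψ hψ] with z hz
    rw [sigma3_mulVec, sign_neg h1]
    ext i
    fin_cases i <;> simp [hz]
  · filter_upwards [kernel_down_eq_zero hH₀ hU hc (hdown h1.le) ψ hψ,
      kernel_up_eq_zero hH₀ hU hc (hup h1.ge) ψ hψ] with z hz hz'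
    rw [sigma3_mulVec, h1, sign_zero]
    ext i
    fin_cases i <;> simp [hz, hz']
  · filter_upwards [kernel_up_eq_zero hH₀ hU hc (hup h1.le) ψ hψ] with z hz
    rw [sigma3_mulVec, sign_pos h1]
    ext i
    fin_cases i <;> simp [hz]

/-- The Aharonov–Casher theorem for fields of regular flux. -/
theorem zeroModes_of_hasRegularFlux (hμ : HasRegularFlux μ Φ) (hν : μ.IsReduction ν)
    (hH : IsPauliOperator μ H) :
    ((∀ n : ℤ, Φ ≠ ((n : ℝ) : EReal)) ∨ Φ = 0 → kernelDim H = ⌊Φ.abs⌋ₑ) ∧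
    (∀ n : ℤ, n ≠ 0 → Φ = ((n : ℝ) : EReal) →
      (kernelDim H = (n.natAbs : ℕ∞) ∨ kernelDim H = ((n.natAbs - 1 : ℕ) : ℕ∞)) ∧
      (ν.CompactlySupported ∨ ν.DefiniteSign → kernelDim H = ((n.natAbs - 1 : ℕ) : ℕ∞))) ∧
    KernelHasSpin H ((SignType.sign Φ : ℤ) : ℂ) := by
  obtain ⟨ν', h, H₀, L, U, hν', hh, hH₀, -, hc, hU⟩ := hH
  obtain rfl := hν'.unique hν
  obtain ⟨h₀, hreg, hh₀⟩ := hμ.exists_regularWeight hν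
  obtain ⟨e1, e2⟩ := dimHol_eq_of_generating hh hh₀
  have hdim := kernelDim_eq hH₀ hU
  refine ⟨fun hΦ => ?_, fun n hn hΦ => ⟨?_, fun hs => ?_⟩, ?_⟩
  · rw [hdim, e1, e2, hreg.total_eq_floor hΦ]
  · subst hΦ
    rw [hdim, e1, e2]
    exact hreg.total_integer_or hn
  · subst hΦ
    rw [hdim]
    exact hμ.total_of_compactlySupported_or_definiteSign hν hn hs hh
  · exact kernelHasSpin_sign hH₀ hU hc (fun h0 => e1.trans (hreg.dimHol_eq_zero_of_nonneg h0))
      fun h0 => e2.trans (hreg.dimHol_conj_eq_zero h0)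

end ZeroModes

-- Existence of the form operator for a smooth potential.

section FormOperator

variable {h : ℂ → ℝ}

/-- Frees the form domain from the chosen representatives of the weak derivatives. -/
lemma mem_formDomain_iff (ψ : Spinor) : ψ ∈ formDomain h ↔ ∃ u v,
    IsWeakDbar (reducedUp h ψ) u ∧ IsWeakDz (reducedDown h ψ) v ∧
      MemLp (fun z => (Real.exp (h z) : ℂ) * u z) 2 volume ∧
      MemLp (fun z => (Real.exp (-h z) : ℂ) * v z) 2 volume := by
  refine ⟨fun hψ => ⟨_, _, hψ⟩, fun ⟨u, v, h1, h2, h3, h4⟩ => ⟨h1.weakDbar, h2.weakDz, ?_, ?_⟩⟩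
  · refine h3.ae_eq ?_
    filter_upwards [h1.weakDbar_ae_eq] with z hz
    rw [hz]
  · refine h4.ae_eq ?_
    filter_upwards [h2.weakDz_ae_eq] with z hz
    rw [hz]

lemma reducedUp_add (ψ φ : Spinor) :
    reducedUp h ψ + reducedUp h φ =ᵐ[volume] reducedUp h (ψ + φ) := by
  filter_upwards [spinor_add_ae ψ φ 0] with z hz
  rw [Pi.add_apply, reducedUp, reducedUp, reducedUp, hz, mul_add]

lemma reducedDown_add (ψ φ : Spinor) :
    reducedDown h ψ + reducedDown h φ =ᵐ[volume] reducedDown h (ψ + φ) := by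
  filter_upwards [spinor_add_ae ψ φ 1] with z hz
  rw [Pi.add_apply, reducedDown, reducedDown, reducedDown, hz, mul_add]

lemma reducedUp_smul (c : ℂ) (ψ : Spinor) :
    c • reducedUp h ψ =ᵐ[volume] reducedUp h (c • ψ) := by
  filter_upwards [spinor_smul_ae c ψ 0] with z hz
  rw [Pi.smul_apply, reducedUp, reducedUp, hz, smul_eq_mul, mul_left_comm]

lemma reducedDown_smul (c : ℂ) (ψ : Spinor) :
    c • reducedDown h ψ =ᵐ[volume] reducedDown h (c • ψ) := by
  filter_upwards [spinor_smul_ae c ψ 1] with z hz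
  rw [Pi.smul_apply, reducedDown, reducedDown, hz, smul_eq_mul, mul_left_comm]

lemma weakDbar_add {ψ φ : Spinor} (hψ : ψ ∈ formDomain h) (hφ : φ ∈ formDomain h) :
    IsWeakDbar (reducedUp h (ψ + φ)) (weakDbar (reducedUp h ψ) + weakDbar (reducedUp h φ)) :=
  (hψ.1.add hφ.1).congr (reducedUp_add ψ φ) (ae_eq_refl _)

lemma weakDz_add {ψ φ : Spinor} (hψ : ψ ∈ formDomain h) (hφ : φ ∈ formDomain h) :
    IsWeakDz (reducedDown h (ψ + φ)) (weakDz (reducedDown h ψ) + weakDz (reducedDown h φ)) :=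
  (hψ.2.1.add hφ.2.1).congr (reducedDown_add ψ φ) (ae_eq_refl _)

lemma weakDbar_smul {ψ : Spinor} (hψ : ψ ∈ formDomain h) (c : ℂ) :
    IsWeakDbar (reducedUp h (c • ψ)) (c • weakDbar (reducedUp h ψ)) :=
  (hψ.1.const_smul c).congr (reducedUp_smul c ψ) (ae_eq_refl _)

lemma weakDz_smul {ψ : Spinor} (hψ : ψ ∈ formDomain h) (c : ℂ) :
    IsWeakDz (reducedDown h (c • ψ)) (c • weakDz (reducedDown h ψ)) :=
  (hψ.2.1.const_smul c).congr (reducedDown_smul c ψ) (ae_eq_refl _)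

lemma formDomain_add {ψ φ : Spinor} (hψ : ψ ∈ formDomain h) (hφ : φ ∈ formDomain h) :
    ψ + φ ∈ formDomain h := by
  refine (mem_formDomain_iff _).2 ⟨_, _, weakDbar_add hψ hφ, weakDz_add hψ hφ, ?_, ?_⟩
  · simp only [Pi.add_apply, mul_add]
    exact hψ.2.2.1.add hφ.2.2.1
  · simp only [Pi.add_apply, mul_add]
    exact hψ.2.2.2.add hφ.2.2.2

lemma formDomain_smul {ψ : Spinor} (hψ : ψ ∈ formDomain h) (c : ℂ) : c • ψ ∈ formDomain h := by
  refine (mem_formDomain_iff _).2 ⟨_, _, weakDbar_smul hψ c, weakDz_smul hψ c, ?_, ?_⟩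
  · simpa only [Pi.smul_apply, smul_eq_mul, mul_left_comm c] using hψ.2.2.1.const_mul c
  · simpa only [Pi.smul_apply, smul_eq_mul, mul_left_comm c] using hψ.2.2.2.const_mul c

lemma integrable_conj_mul_exp {a b : ℂ → ℂ} {w c : ℂ → ℝ}
    (ha : MemLp (fun z => (Real.exp (w z) : ℂ) * a z) 2 volume)
    (hb : MemLp (fun z => (Real.exp (w z) : ℂ) * b z) 2 volume) (hc : ∀ z, c z = 2 * w z) :
    Integrable (fun z => (starRingEnd ℂ) (a z) * b z * (Real.exp (c z) : ℂ)) := by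
  have h1 := MemLp.integrable_mul (p := 2) (q := 2) ha.star hb
  refine h1.congr (Eventually.of_forall fun z => ?_)
  have h2 : Real.exp (c z) = Real.exp (w z) * Real.exp (w z) := by
    rw [hc, two_mul, Real.exp_add]
  simp only [Pi.mul_apply, Pi.star_apply, RCLike.star_def, map_mul, Complex.conj_ofReal, h2,
    Complex.ofReal_mul]
  ring

lemma pauliForm_add {ψ φ ξ : Spinor} (hψ : ψ ∈ formDomain h) (hφ : φ ∈ formDomain h)
    (hξ : ξ ∈ formDomain h) : pauliForm h (ψ + φ) ξ = pauliForm h ψ ξ + pauliForm h φ ξ := by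
  have e1 := (weakDbar_add hψ hφ).weakDbar_ae_eq
  have e2 := (weakDz_add hψ hφ).weakDz_ae_eq
  have i1 := integral_add (integrable_conj_mul_exp hψ.2.2.1 hξ.2.2.1 (c := fun z => 2 * h z)
    fun z => rfl) (integrable_conj_mul_exp hφ.2.2.1 hξ.2.2.1 (c := fun z => 2 * h z) fun z => rfl)
  have i2 := integral_add (integrable_conj_mul_exp (w := fun z => -h z) hψ.2.2.2 hξ.2.2.2
    (c := fun z => -2 * h z) fun z => by ring) (integrable_conj_mul_exp (w := fun z => -h z)
      hφ.2.2.2 hξ.2.2.2 (c := fun z => -2 * h z) fun z => by ring)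
  have k1 : ∫ z, (starRingEnd ℂ) (weakDbar (reducedUp h (ψ + φ)) z) * weakDbar (reducedUp h ξ) z *
      (Real.exp (2 * h z) : ℂ) = _ := (integral_congr_ae (by
        filter_upwards [e1] with z hz
        rw [hz, Pi.add_apply, map_add, add_mul, add_mul])).trans i1
  have k2 : ∫ z, (starRingEnd ℂ) (weakDz (reducedDown h (ψ + φ)) z) * weakDz (reducedDown h ξ) z *
      (Real.exp (-2 * h z) : ℂ) = _ := (integral_congr_ae (by
        filter_upwards [e2] with z hz
        rw [hz, Pi.add_apply, map_add, add_mul, add_mul])).trans i2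
  rw [pauliForm, pauliForm, pauliForm, k1, k2]
  ring

lemma pauliForm_smul {ψ : Spinor} (hψ : ψ ∈ formDomain h) (c : ℂ) (ξ : Spinor) :
    pauliForm h (c • ψ) ξ = (starRingEnd ℂ) c * pauliForm h ψ ξ := by
  have e1 := (weakDbar_smul hψ c).weakDbar_ae_eq
  have e2 := (weakDz_smul hψ c).weakDz_ae_eq
  have k1 : ∫ z, (starRingEnd ℂ) (weakDbar (reducedUp h (c • ψ)) z) * weakDbar (reducedUp h ξ) z *
      (Real.exp (2 * h z) : ℂ) = _ := (integral_congr_ae (by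
        filter_upwards [e1] with z hz
        rw [hz, Pi.smul_apply, smul_eq_mul, map_mul, mul_assoc, mul_assoc])).trans
          (integral_const_mul ((starRingEnd ℂ) c) fun z => (starRingEnd ℂ)
            (weakDbar (reducedUp h ψ) z) * (weakDbar (reducedUp h ξ) z * (Real.exp (2 * h z) : ℂ)))
  have k2 : ∫ z, (starRingEnd ℂ) (weakDz (reducedDown h (c • ψ)) z) * weakDz (reducedDown h ξ) z *
      (Real.exp (-2 * h z) : ℂ) = _ := (integral_congr_ae (by
        filter_upwards [e2] with z hz
        rw [hz, Pi.smul_apply, smul_eq_mul, map_mul, mul_assoc, mul_assoc])).trans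
          (integral_const_mul ((starRingEnd ℂ) c) fun z => (starRingEnd ℂ)
            (weakDz (reducedDown h ψ) z) * (weakDz (reducedDown h ξ) z *
              (Real.exp (-2 * h z) : ℂ)))
  rw [pauliForm, pauliForm, k1, k2]
  simp only [← mul_assoc]
  ring

/-- The graph of the operator associated with the Pauli form. -/
noncomputable def formGraph (h : ℂ → ℝ) : Submodule ℂ (Spinor × Spinor) where
  carrier := {p | p.1 ∈ formDomain h ∧ ∀ ξ ∈ formDomain h, pauliForm h p.1 ξ = inner ℂ p.2 ξ}
  add_mem' := fun {p q} hp hq => ⟨formDomain_add hp.1 hq.1, fun ξ hξ => by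
    rw [Prod.fst_add, Prod.snd_add, pauliForm_add hp.1 hq.1 hξ, hp.2 ξ hξ, hq.2 ξ hξ,
      inner_add_left]⟩
  zero_mem' := by
    have h0 := zeroMode_mem_formDomain (0 : HolL2 h × HolL2 (conjPot h))
    have h1 := pauliForm_zeroMode (0 : HolL2 h × HolL2 (conjPot h))
    rw [map_zero] at h0 h1
    exact ⟨h0, fun ξ _ => by
      rw [Prod.fst_zero, Prod.snd_zero, h1, inner_zero_left]⟩
  smul_mem' := fun c p hp => ⟨formDomain_smul hp.1 c, fun ξ hξ => by
    rw [Prod.smul_fst, Prod.smul_snd, pauliForm_smul hp.1, hp.2 ξ hξ, inner_smul_left]⟩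

lemma inner_spinor (η ξ : Spinor) : inner ℂ η ξ
    = ∫ z, ((starRingEnd ℂ) (η z 0) * ξ z 0 + (starRingEnd ℂ) (η z 1) * ξ z 1) := by
  rw [L2.inner_def]
  congr 1
  ext z
  rw [PiLp.inner_apply, Fin.sum_univ_two, RCLike.inner_apply, RCLike.inner_apply]
  ring

lemma memLp_of_continuous {f : ℂ → ℂ} (hf : Continuous f) (hc : HasCompactSupport f) :
    MemLp f 2 volume := hf.memLp_of_hasCompactSupport hc

/-- Smoothness of `h` keeps `e^{∓h}` times a test function smooth with compact support, which
supplies enough elements for density. -/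
lemma spinorOf_mem_formDomain (hs : ContDiff ℝ ∞ h) {f g : ℂ → ℂ} (hf : ContDiff ℝ ∞ f)
    (hfc : HasCompactSupport f) (hg : ContDiff ℝ ∞ g) (hgc : HasCompactSupport g) :
    spinorOf (memLp_of_continuous hf.continuous hfc) (memLp_of_continuous hg.continuous hgc)
      ∈ formDomain h := by
  have hE : ContDiff ℝ ∞ (fun z => (Real.exp (h z) : ℂ)) := contDiff_ofReal_comp hs.exp
  have hE' : ContDiff ℝ ∞ (fun z => (Real.exp (-h z) : ℂ)) := contDiff_ofReal_comp hs.neg.exp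
  have hu : ContDiff ℝ ∞ (fun z => (Real.exp (-h z) : ℂ) * f z) := hE'.mul hf
  have hv : ContDiff ℝ ∞ (fun z => (Real.exp (h z) : ℂ) * g z) := hE.mul hg
  have hv' : ContDiff ℝ ∞ (fun z => (Real.exp (h (starRingEnd ℂ z)) : ℂ) * g (starRingEnd ℂ z)) :=
    hv.comp Complex.conjCLE.contDiff
  have hvc : HasCompactSupport
      (fun z => (Real.exp (h (starRingEnd ℂ z)) : ℂ) * g (starRingEnd ℂ z)) :=
    (hgc.mul_left (f := fun z => (Real.exp (h z) : ℂ))).comp_homeomorph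
      Complex.conjLIE.toHomeomorph
  have hw := (isWeakDbar_of_contDiff hv').comp_conj
  simp only [Complex.conj_conj] at hw
  refine (mem_formDomain_iff _).2 ⟨_, _, (isWeakDbar_of_contDiff hu).congr ?_ (ae_eq_refl _),
    hw.congr ?_ (ae_eq_refl _), ?_, ?_⟩
  · filter_upwards [spinorOf_zero_ae (memLp_of_continuous hf.continuous hfc)
      (memLp_of_continuous hg.continuous hgc)] with z hz
    rw [reducedUp, hz]
  · filter_upwards [spinorOf_one_ae (memLp_of_continuous hf.continuous hfc)
      (memLp_of_continuous hg.continuous hgc)] with z hz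
    rw [reducedDown, hz]
  · exact memLp_of_continuous (hE.continuous.mul (continuous_dbar hu))
      (hasCompactSupport_dbar hfc.mul_left).mul_left
  · exact memLp_of_continuous
      (hE'.continuous.mul ((continuous_dbar hv').comp Complex.continuous_conj))
      ((hasCompactSupport_dbar hvc).comp_homeomorph Complex.conjLIE.toHomeomorph).mul_left

lemma ae_eq_zero_of_integral_conj {f : ℂ → ℂ} (hf : MemLp f 2 volume)
    (h0 : ∀ g : ℂ → ℝ, ContDiff ℝ ∞ g → HasCompactSupport g →
      ∫ z, (starRingEnd ℂ) (f z) * (g z : ℂ) = 0) : ∀ᵐ z, f z = 0 := by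
  have h1 : ∀ᵐ z, (starRingEnd ℂ) (f z) = 0 := by
    refine ae_eq_zero_of_integral_contDiff_smul_eq_zero
      (hf.star.locallyIntegrable (by norm_num)) fun g hg hgc => ?_
    rw [← h0 g hg hgc]
    congr 1
    ext z
    rw [Complex.real_smul, mul_comm]
  filter_upwards [h1] with z hz
  simpa using hz

/-- The form domain is dense. -/
lemma eq_zero_of_inner_formDomain (hs : ContDiff ℝ ∞ h) {η : Spinor}
    (hη : ∀ ξ ∈ formDomain h, inner ℂ η ξ = 0) : η = 0 := by
  have z1 : ContDiff ℝ ∞ (fun _ : ℂ => (0 : ℂ)) := contDiff_const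
  have z2 : HasCompactSupport (fun _ : ℂ => (0 : ℂ)) := HasCompactSupport.zero
  have h0 : ∀ᵐ z, η z 0 = 0 := by
    refine ae_eq_zero_of_integral_conj (memLp_spinor_apply η 0) fun g hg hgc => ?_
    have g1 := contDiff_ofReal_comp hg
    have g2 := hasCompactSupport_ofReal_comp hgc
    rw [← hη _ (spinorOf_mem_formDomain hs g1 g2 z1 z2), inner_spinor]
    refine integral_congr_ae ?_
    filter_upwards [spinorOf_zero_ae (memLp_of_continuous g1.continuous g2)
        (memLp_of_continuous z1.continuous z2),
      spinorOf_one_ae (memLp_of_continuous g1.continuous g2)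
        (memLp_of_continuous z1.continuous z2)] with z hz hz'
    rw [hz, hz', mul_zero, add_zero]
  have h1 : ∀ᵐ z, η z 1 = 0 := by
    refine ae_eq_zero_of_integral_conj (memLp_spinor_apply η 1) fun g hg hgc => ?_
    have g1 := contDiff_ofReal_comp hg
    have g2 := hasCompactSupport_ofReal_comp hgc
    rw [← hη _ (spinorOf_mem_formDomain hs z1 z2 g1 g2), inner_spinor]
    refine integral_congr_ae ?_
    filter_upwards [spinorOf_zero_ae (memLp_of_continuous z1.continuous z2)
        (memLp_of_continuous g1.continuous g2),
      spinorOf_one_ae (memLp_of_continuous z1.continuous z2)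
        (memLp_of_continuous g1.continuous g2)] with z hz hz'
    rw [hz, hz', mul_zero, zero_add]
  refine spinor_ext ?_ ?_
  · filter_upwards [h0, spinor_zero_ae 0] with z hz hz'
    rw [hz, hz']
  · filter_upwards [h1, spinor_zero_ae 1] with z hz hz'
    rw [hz, hz']

/-- The operator associated with the Pauli form of a smooth potential. -/
theorem exists_isFormOperator (hs : ContDiff ℝ ∞ h) :
    ∃ H : Spinor →ₗ.[ℂ] Spinor, IsFormOperator h H := by
  refine ⟨(formGraph h).toLinearPMap, fun ψ η => ?_⟩
  rw [Submodule.toLinearPMap_graph_eq]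
  · rfl
  -- The relation is single valued: a pair `(0, η)` makes `η` orthogonal to the dense form domain.
  · rintro ⟨ψ, η⟩ hx hψ
    obtain rfl : ψ = 0 := hψ
    refine eq_zero_of_inner_formDomain hs fun ξ hξ => ?_
    rw [← hx.2 ξ hξ]
    exact ((formGraph h).zero_mem.2 ξ hξ).trans (inner_zero_left _)

end FormOperator

-- Fields with a continuous density.

section SmoothFields

/-- The signed measure with a continuous density. -/
noncomputable def densityRadon (w : ℂ → ℝ) (hw : Continuous w) : SignedRadon where
  pos := volume.withDensity fun z => ENNReal.ofReal (w z)
  neg := volume.withDensity fun z => ENNReal.ofReal (-w z)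
  locFin_pos := IsLocallyFiniteMeasure.withDensity_ofReal hw
  locFin_neg := IsLocallyFiniteMeasure.withDensity_ofReal hw.neg
  singular := by
    have hm : MeasurableSet {z | w z ≤ 0} := measurableSet_le hw.measurable measurable_const
    refine ⟨{z | w z ≤ 0}, hm, ?_, ?_⟩
    · rw [withDensity_apply _ hm, setLIntegral_eq_zero hm]
      intro z hz
      simpa using hz
    · rw [withDensity_apply _ hm.compl, setLIntegral_eq_zero hm.compl]
      intro z hz
      have : 0 < w z := by simpa using hz
      simpa using this.le

variable {w : ℂ → ℝ} (hw : Continuous w)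

lemma densityRadon_finiteVariation (hi : Integrable w) :
    (densityRadon w hw).FiniteVariation := by
  rw [SignedRadon.FiniteVariation, SignedRadon.variation, Measure.add_apply, ENNReal.add_lt_top]
  simp only [densityRadon, withDensity_apply _ MeasurableSet.univ, Measure.restrict_univ]
  exact ⟨hi.lintegral_lt_top, hi.neg.lintegral_lt_top⟩

lemma densityRadon_flux (hi : Integrable w) :
    (densityRadon w hw).flux = (∫ z, w z) / (2 * Real.pi) := by
  rw [SignedRadon.flux, SignedRadon.val, integral_eq_lintegral_pos_part_sub_lintegral_neg_part hi]
  simp only [densityRadon, Measure.real, withDensity_apply _ MeasurableSet.univ,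
    Measure.restrict_univ]

lemma densityRadon_val_singleton (z : ℂ) : (densityRadon w hw).val {z} = 0 := by
  have h1 : (densityRadon w hw).pos {z} = 0 :=
    withDensity_absolutelyContinuous _ _ (measure_singleton z)
  have h2 : (densityRadon w hw).neg {z} = 0 :=
    withDensity_absolutelyContinuous _ _ (measure_singleton z)
  simp [SignedRadon.val, Measure.real, h1, h2]

lemma SignedRadon.differsByIntegerFluxes_self (μ : SignedRadon) :
    μ.DiffersByIntegerFluxes μ 0 := fun A _ _ => by simp

lemma SignedRadon.isGaugeFactor_self (μ : SignedRadon) :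
    IsGaugeFactor μ μ fun _ => 1 * (starRingEnd ℂ) 1 := by
  have h1 : ∀ z : ℂ, analyticOrderAt (fun _ : ℂ => (1 : ℂ)) z = 0 := fun z =>
    analyticAt_const.analyticOrderAt_eq_zero.2 one_ne_zero
  exact ⟨0, fun _ => 1, fun _ => 1, μ.differsByIntegerFluxes_self, differentiable_const _,
    differentiable_const _, fun z => by simp [h1], fun z => by simp [h1], rfl⟩

lemma densityRadon_isReduction : (densityRadon w hw).IsReduction (densityRadon w hw) :=
  ⟨⟨0, SignedRadon.differsByIntegerFluxes_self _⟩, fun z => by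
    rw [densityRadon_val_singleton]
    simp [Real.pi_pos, Real.pi_pos.le]⟩

/-- The zero field. -/
noncomputable def zeroRadon : SignedRadon where
  pos := 0
  neg := 0
  locFin_pos := inferInstance
  locFin_neg := inferInstance
  singular := Measure.MutuallySingular.zero_right

lemma zeroRadon_val (A : Set ℂ) : zeroRadon.val A = 0 := by simp [SignedRadon.val, zeroRadon]

lemma hasLocallyBoundedGradient_zero : HasLocallyBoundedGradient fun _ => 0 := by
  have h0 : ∀ v : ℂ, IsWeakDirDeriv v (fun _ => 0) (fun _ => 0) := fun v =>
    ⟨continuous_const.locallyIntegrable, continuous_const.locallyIntegrable, by simp⟩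
  exact ⟨_, _, h0 1, h0 Complex.I, fun K _ => ⟨MemLp.zero', MemLp.zero'⟩⟩

lemma SignedRadon.radialDecomposition_self {μ : SignedRadon} (hfin : μ.FiniteVariation) :
    RadialDecomposition μ zeroRadon μ 0 where
  isSum A _ _ := by rw [zeroRadon_val, zero_add]
  finite := hfin
  radial c _ := by simp [zeroRadon]
  noAtomZero := zeroRadon_val _
  tendsto := by simp [discFlux, zeroRadon_val]
  gradient := by simpa [discFlux, zeroRadon_val] using hasLocallyBoundedGradient_zero

lemma densityRadon_hasRegularFlux (hi : Integrable w) {r : ℝ}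
    (hr : ∫ z, w z = 2 * Real.pi * r) : HasRegularFlux (densityRadon w hw) (r : EReal) := by
  refine ⟨zeroRadon, _, _, 0,
    SignedRadon.radialDecomposition_self (densityRadon_finiteVariation hw hi),
    densityRadon_isReduction hw, ?_⟩
  rw [densityRadon_flux hw hi, hr, mul_div_cancel_left₀ _ (by have := Real.pi_pos; positivity),
    zero_add]

lemma densityRadon_integral_sub {φ : ℂ → ℝ} (hφ : Continuous φ) (hc : HasCompactSupport φ) :
    (∫ z, φ z ∂(densityRadon w hw).pos) - ∫ z, φ z ∂(densityRadon w hw).neg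
      = ∫ z, w z * φ z := by
  simp only [densityRadon]
  rw [integral_withDensity_eq_integral_toReal_smul (by fun_prop) (by simp),
    integral_withDensity_eq_integral_toReal_smul (by fun_prop) (by simp), ← integral_sub]
  · congr 1
    ext z
    simp only [ENNReal.toReal_ofReal', smul_eq_mul]
    rw [← sub_mul]
    congr 1
    rcases le_total 0 (w z) with h | h
    · rw [max_eq_left h, max_eq_right (by linarith), sub_zero]
    · rw [max_eq_right h, max_eq_left (by linarith), zero_sub, neg_neg]
  · simp only [ENNReal.toReal_ofReal', smul_eq_mul]
    exact Continuous.integrable_of_hasCompactSupport (by fun_prop) hc.mul_left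
  · simp only [ENNReal.toReal_ofReal', smul_eq_mul]
    exact Continuous.integrable_of_hasCompactSupport (by fun_prop) hc.mul_left

/-- A smooth potential generates the field with density its Laplacian. -/
lemma densityRadon_isGeneratingPotential {h : ℂ → ℝ} (hs : ContDiff ℝ ∞ h)
    (hΔ : Laplacian.laplacian h = w) : IsGeneratingPotential h (densityRadon w hw) := by
  refine ⟨hs.continuous.locallyIntegrable, fun φ hφ hc => ?_⟩
  rw [integral_mul_laplacian hs hφ hc, densityRadon_integral_sub hw hφ.continuous hc, hΔ]

/-- The field has no atoms, so it is its own reduction and `U` may be the identity. -/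
lemma exists_isPauliOperator_densityRadon {h : ℂ → ℝ} (hs : ContDiff ℝ ∞ h)
    (hΔ : Laplacian.laplacian h = w) :
    ∃ H, IsPauliOperator (densityRadon w hw) H ∧
      kernelDim H = dimHol h + dimHol (conjPot h) := by
  obtain ⟨H, hH⟩ := exists_isFormOperator hs
  refine ⟨H, ⟨_, h, H, _, LinearIsometryEquiv.refl ℂ Spinor, densityRadon_isReduction hw,
    densityRadon_isGeneratingPotential hw hs hΔ, hH, SignedRadon.isGaugeFactor_self _,
    fun ψ => Eventually.of_forall fun z => by simp, fun ψ η => Iff.rfl⟩,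
    kernelDim_eq hH (U := LinearIsometryEquiv.refl ℂ Spinor) fun ψ η => Iff.rfl⟩

end SmoothFields

-- Model fields realising both kernel dimensions at integer flux.

section Models

/-- The radial profile, in the variable `s = |z|²`, of the model potentials. -/
noncomputable def modelProfile (a b s : ℝ) : ℝ :=
  a * Real.log (1 + s) + b * Real.log (1 + Real.log (1 + s))

/-- Potentials behaving like `2a log|z| + b log log|z|` at infinity. -/
noncomputable def modelPot (a b : ℝ) (z : ℂ) : ℝ := modelProfile a b (‖z‖ ^ 2)

/-- The Laplacian of `modelPot`. -/
noncomputable def modelDensity (a b : ℝ) (z : ℂ) : ℝ :=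
  4 * a / (1 + ‖z‖ ^ 2) ^ 2 + 4 * b * (1 + Real.log (1 + ‖z‖ ^ 2) - ‖z‖ ^ 2)
    / ((1 + Real.log (1 + ‖z‖ ^ 2)) ^ 2 * (1 + ‖z‖ ^ 2) ^ 2)

lemma one_add_log_pos {s : ℝ} (hs : 0 ≤ s) : 0 < 1 + Real.log (1 + s) := by
  have := Real.log_nonneg (by linarith : 1 ≤ 1 + s)
  linarith

lemma hasDerivAt_log_one_add {s : ℝ} (hs : 0 ≤ s) :
    HasDerivAt (fun s => Real.log (1 + s)) (1 + s)⁻¹ s := by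
  have := ((hasDerivAt_id s).const_add 1).log (by simp; positivity)
  simpa using this

lemma hasDerivAt_modelProfile (a b : ℝ) {s : ℝ} (hs : 0 ≤ s) :
    HasDerivAt (modelProfile a b) (a / (1 + s) + b / ((1 + Real.log (1 + s)) * (1 + s))) s := by
  have h1 := hasDerivAt_log_one_add hs
  have h2 := (h1.const_add 1).log (one_add_log_pos hs).ne'
  refine ((h1.const_mul a).add (h2.const_mul b)).congr_deriv ?_
  have := one_add_log_pos hs
  field_simp

lemma hasDerivAt_modelProfile_two (a b : ℝ) {s : ℝ} (hs : 0 ≤ s) :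
    HasDerivAt (fun s => a / (1 + s) + b / ((1 + Real.log (1 + s)) * (1 + s)))
      (-a / (1 + s) ^ 2
        - b * (2 + Real.log (1 + s)) / ((1 + Real.log (1 + s)) ^ 2 * (1 + s) ^ 2)) s := by
  have h1 := hasDerivAt_log_one_add hs
  have h0 := one_add_log_pos hs
  have h2 : HasDerivAt (fun s : ℝ => 1 + s) 1 s := (hasDerivAt_id s).const_add 1
  have h3 := (h1.const_add 1).mul h2
  have h4 := (hasDerivAt_const s a).div h2 (by positivity)
  have h5 := (hasDerivAt_const s b).div h3 (mul_pos h0 (by positivity)).ne'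
  refine (h4.add h5).congr_deriv ?_
  simp only [Pi.mul_apply]
  field_simp
  ring

lemma contDiff_log_one_add : ContDiff ℝ ∞ (fun z : ℂ => Real.log (1 + ‖z‖ ^ 2)) :=
  (contDiff_const.add (contDiff_norm_sq ℝ)).log fun z => by positivity

lemma contDiff_modelPot (a b : ℝ) : ContDiff ℝ ∞ (modelPot a b) := by
  have h1 := contDiff_log_one_add
  have h2 : ContDiff ℝ ∞ (fun z : ℂ => Real.log (1 + Real.log (1 + ‖z‖ ^ 2))) :=
    (contDiff_const.add h1).log fun z => (one_add_log_pos (by positivity)).ne'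
  exact (contDiff_const.mul h1).add (contDiff_const.mul h2)

lemma laplacian_modelPot (a b : ℝ) :
    Laplacian.laplacian (modelPot a b) = modelDensity a b := by
  ext z
  have h0 := one_add_log_pos (by positivity : 0 ≤ ‖z‖ ^ 2)
  refine (laplacian_radial (fun s hs => hasDerivAt_modelProfile a b hs)
    (fun s hs => hasDerivAt_modelProfile_two a b hs) (contDiff_modelPot a b) z).trans ?_
  rw [modelDensity]
  field_simp
  ring

lemma continuous_modelDensity (a b : ℝ) : Continuous (modelDensity a b) := by
  rw [← laplacian_modelPot]
  exact continuous_laplacian (contDiff_modelPot a b)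

lemma hasDerivAt_one_add_sq (r : ℝ) : HasDerivAt (fun r : ℝ => 1 + r ^ 2) (2 * r) r := by
  simpa using (hasDerivAt_pow 2 r).const_add 1

lemma hasDerivAt_log_one_add_sq (r : ℝ) :
    HasDerivAt (fun r : ℝ => 1 + Real.log (1 + r ^ 2)) (2 * r / (1 + r ^ 2)) r :=
  ((hasDerivAt_one_add_sq r).log (by positivity)).const_add 1

lemma tendsto_one_add_sq : Tendsto (fun r : ℝ => 1 + r ^ 2) atTop atTop :=
  tendsto_atTop_add_const_left _ _ (tendsto_pow_atTop (by norm_num))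

lemma tendsto_log_one_add_sq : Tendsto (fun r : ℝ => 1 + Real.log (1 + r ^ 2)) atTop atTop :=
  tendsto_atTop_add_const_left _ _ (Real.tendsto_log_atTop.comp tendsto_one_add_sq)

/-- The density with radial primitive `-1 / (1 + log (1 + r²))`. -/
lemma integral_two_div_log_sq :
    Integrable (fun w : ℂ => 2 / ((1 + Real.log (1 + ‖w‖ ^ 2)) ^ 2 * (1 + ‖w‖ ^ 2))) volume ∧
      ∫ w : ℂ, 2 / ((1 + Real.log (1 + ‖w‖ ^ 2)) ^ 2 * (1 + ‖w‖ ^ 2)) = 2 * Real.pi := by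
  have hd : ∀ r : ℝ, HasDerivAt (fun r : ℝ => -(1 + Real.log (1 + r ^ 2))⁻¹)
      (r * (2 / ((1 + Real.log (1 + r ^ 2)) ^ 2 * (1 + r ^ 2)))) r := fun r => by
    have h0 := one_add_log_pos (sq_nonneg r)
    refine ((hasDerivAt_log_one_add_sq r).inv h0.ne').neg.congr_deriv ?_
    field_simp
  have h := integral_radial_of_hasDerivAt
    (f := fun r => 2 / ((1 + Real.log (1 + r ^ 2)) ^ 2 * (1 + r ^ 2))) (l := 0)
    (hd 0).continuousAt.continuousWithinAt (fun r _ => hd r)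
    (fun r _ => by have h0 := one_add_log_pos (sq_nonneg r); positivity)
    (by simpa using (tendsto_inv_atTop_zero.comp tendsto_log_one_add_sq).neg)
  simpa using h

/-- The density with radial primitive `-1 / ((1 + log (1 + r²)) (1 + r²))`. -/
lemma integral_two_mul_two_add_log :
    Integrable (fun w : ℂ => 2 * (2 + Real.log (1 + ‖w‖ ^ 2))
      / ((1 + Real.log (1 + ‖w‖ ^ 2)) ^ 2 * (1 + ‖w‖ ^ 2) ^ 2)) volume ∧
    ∫ w : ℂ, 2 * (2 + Real.log (1 + ‖w‖ ^ 2))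
      / ((1 + Real.log (1 + ‖w‖ ^ 2)) ^ 2 * (1 + ‖w‖ ^ 2) ^ 2) = 2 * Real.pi := by
  have hd : ∀ r : ℝ, HasDerivAt (fun r : ℝ => -((1 + Real.log (1 + r ^ 2)) * (1 + r ^ 2))⁻¹)
      (r * (2 * (2 + Real.log (1 + r ^ 2))
        / ((1 + Real.log (1 + r ^ 2)) ^ 2 * (1 + r ^ 2) ^ 2))) r := fun r => by
    have h0 := one_add_log_pos (sq_nonneg r)
    refine (((hasDerivAt_log_one_add_sq r).mul (hasDerivAt_one_add_sq r)).inv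
      (mul_pos h0 (by positivity)).ne').neg.congr_deriv ?_
    simp only [Pi.mul_apply]
    field_simp
    ring
  have h := integral_radial_of_hasDerivAt (f := fun r => 2 * (2 + Real.log (1 + r ^ 2))
        / ((1 + Real.log (1 + r ^ 2)) ^ 2 * (1 + r ^ 2) ^ 2)) (l := 0)
    (hd 0).continuousAt.continuousWithinAt (fun r _ => hd r)
    (fun r _ => by
      have h0 := one_add_log_pos (sq_nonneg r)
      exact div_nonneg (by linarith) (by positivity))
    (by simpa using (tendsto_inv_atTop_zero.comp
      (tendsto_log_one_add_sq.atTop_mul_atTop₀ tendsto_one_add_sq)).neg)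
  simpa using h

/-- The density of the double logarithm is a multiple of a difference of two integrable densities,
both of integral `2π`, so the parameter `b` carries no flux. -/
lemma integral_modelDensity (a b : ℝ) :
    Integrable (modelDensity a b) ∧ ∫ z, modelDensity a b z = 2 * Real.pi * (2 * a) := by
  obtain ⟨i1, e1⟩ := integral_two_div_sq
  obtain ⟨i2, e2⟩ := integral_two_div_log_sq
  obtain ⟨i3, e3⟩ := integral_two_mul_two_add_log
  have he : modelDensity a b = fun z => 2 * a * (2 / (1 + ‖z‖ ^ 2) ^ 2)
      + 2 * b * (2 * (2 + Real.log (1 + ‖z‖ ^ 2))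
        / ((1 + Real.log (1 + ‖z‖ ^ 2)) ^ 2 * (1 + ‖z‖ ^ 2) ^ 2)
        - 2 / ((1 + Real.log (1 + ‖z‖ ^ 2)) ^ 2 * (1 + ‖z‖ ^ 2))) := by
    ext z
    have h0 := one_add_log_pos (by positivity : 0 ≤ ‖z‖ ^ 2)
    rw [modelDensity]
    field_simp
    ring
  have i4 := (i3.sub i2).const_mul (2 * b)
  rw [he]
  refine ⟨(i1.const_mul (2 * a)).add i4, ?_⟩
  refine (integral_add (i1.const_mul (2 * a)) i4).trans ?_
  rw [integral_const_mul, integral_const_mul, e1]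
  have e4 := integral_sub i3 i2
  simp only [Pi.sub_apply]
  rw [e4, e2, e3]
  ring

lemma conjPot_modelPot (a b : ℝ) : conjPot (modelPot a b) = modelPot (-a) (-b) := by
  ext z
  simp only [conjPot, modelPot, modelProfile, RCLike.norm_conj]
  ring

/-- The extra double logarithm makes the critical power square integrable. -/
lemma pow_mem_HolL2_modelPot {m k : ℕ} (hk : k < m) :
    (fun z : ℂ => z ^ k) ∈ HolL2 (modelPot (-(m / 2)) (-1)) := by
  have hcont : Continuous fun z : ℂ => (Real.exp (modelPot (-(m / 2)) (-1) z) : ℂ) * z ^ k := by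
    have := (contDiff_modelPot (-(m / 2)) (-1)).continuous
    fun_prop
  refine ⟨differentiable_pow k, (memLp_two_iff_integrable_sq_norm hcont.aestronglyMeasurable).2 ?_⟩
  refine integral_two_div_log_sq.1.mono' (hcont.norm.pow 2).aestronglyMeasurable
    (Eventually.of_forall fun z => ?_)
  have h0 := one_add_log_pos (by positivity : 0 ≤ ‖z‖ ^ 2)
  have h1 : 0 < 1 + ‖z‖ ^ 2 := by positivity
  have hexp : Real.exp (modelPot (-(m / 2)) (-1) z) ^ 2
      = ((1 + Real.log (1 + ‖z‖ ^ 2)) ^ 2 * (1 + ‖z‖ ^ 2) ^ m)⁻¹ := by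
    have hpos : 0 < ((1 + Real.log (1 + ‖z‖ ^ 2)) ^ 2 * (1 + ‖z‖ ^ 2) ^ m)⁻¹ := by positivity
    rw [← Real.exp_nat_mul, modelPot, modelProfile, ← Real.exp_log hpos, Real.log_inv,
      Real.log_mul (by positivity) (by positivity), Real.log_pow, Real.log_pow]
    congr 1
    push_cast
    ring
  rw [Real.norm_of_nonneg (by positivity), norm_mul, Complex.norm_real, Real.norm_eq_abs,
    Real.abs_exp, mul_pow, hexp, norm_pow, ← pow_mul, mul_comm k 2, pow_mul, inv_mul_eq_div,
    div_le_div_iff₀ (by positivity) (by positivity)]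
  -- Because `k + 1 ≤ m`, the squared density is bounded by `1 / ((1 + log(1+|z|²))² (1+|z|²))`; the
  -- squared logarithm is what makes this integrable when `k = m - 1`.
  have h2 : (‖z‖ ^ 2) ^ k * (1 + ‖z‖ ^ 2) ≤ (1 + ‖z‖ ^ 2) ^ m := by
    calc (‖z‖ ^ 2) ^ k * (1 + ‖z‖ ^ 2) ≤ (1 + ‖z‖ ^ 2) ^ k * (1 + ‖z‖ ^ 2) := by
          gcongr; linarith
      _ = (1 + ‖z‖ ^ 2) ^ (k + 1) := (pow_succ _ _).symm
      _ ≤ (1 + ‖z‖ ^ 2) ^ m := pow_le_pow_right₀ (by linarith [sq_nonneg ‖z‖]) hk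
  have h3 : 0 < (1 + Real.log (1 + ‖z‖ ^ 2)) ^ 2 := by positivity
  have h4 : 0 < (1 + ‖z‖ ^ 2) ^ m := by positivity
  nlinarith [mul_le_mul_of_nonneg_left h2 h3.le]

/-- A field of definite sign whose operator has a kernel of dimension `|Φ| - 1`. -/
theorem exists_kernelDim_eq_natAbs_sub_one {n : ℤ} (hn : n ≠ 0) :
    ∃ (μ : SignedRadon) (H : Spinor →ₗ.[ℂ] Spinor), HasRegularFlux μ ((n : ℝ) : EReal) ∧
      IsPauliOperator μ H ∧ kernelDim H = ((n.natAbs - 1 : ℕ) : ℕ∞) := by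
  -- With `b = 0` the density is `2n / (1+|z|²)²`, of total flux `n` and of the sign of `n`.
  obtain ⟨hi, he⟩ := integral_modelDensity (n / 2) 0
  have hc := continuous_modelDensity (n / 2) 0
  obtain ⟨H, hH, -⟩ := exists_isPauliOperator_densityRadon hc (contDiff_modelPot _ _)
    (laplacian_modelPot (n / 2) 0)
  have hflux : HasRegularFlux (densityRadon _ hc) ((n : ℝ) : EReal) :=
    densityRadon_hasRegularFlux hc hi (by rw [he]; ring)
  refine ⟨_, H, hflux, hH, ?_⟩
  refine ((zeroModes_of_hasRegularFlux hflux (densityRadon_isReduction hc) hH).2.1 n hn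
    rfl).2 (Or.inr ?_)
  rcases lt_or_gt_of_ne hn with h | h
  · right
    have hn' : (n : ℝ) ≤ 0 := by exact_mod_cast h.le
    simp only [densityRadon]
    convert withDensity_zero using 1
    congr 1
    ext z
    simp only [Pi.zero_apply, ENNReal.ofReal_eq_zero, modelDensity]
    simp only [mul_zero, zero_mul, zero_div, add_zero]
    exact div_nonpos_of_nonpos_of_nonneg (by linarith) (by positivity)
  · left
    have hn' : (0 : ℝ) ≤ n := by exact_mod_cast h.le
    simp only [densityRadon]
    convert withDensity_zero using 1
    congr 1
    ext z
    simp only [Pi.zero_apply, ENNReal.ofReal_eq_zero, modelDensity]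
    simp only [mul_zero, zero_mul, zero_div, add_zero, Left.neg_nonpos_iff]
    positivity

/-- The kernel has dimension `|Φ|` for a potential with an additional double logarithm. -/
theorem exists_kernelDim_eq_natAbs {n : ℤ} (hn : n ≠ 0) :
    ∃ (μ : SignedRadon) (H : Spinor →ₗ.[ℂ] Spinor), HasRegularFlux μ ((n : ℝ) : EReal) ∧
      IsPauliOperator μ H ∧ kernelDim H = (n.natAbs : ℕ∞) := by
  -- With this sign the relevant weight, `e^h` for `n < 0` and `e^{-h}` for `n > 0`, gains a
  -- decaying factor `(1 + log(1+|z|²))^{-1}`. All powers below `|n|` are then admissible, which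
  -- rules out the dimension `|n| - 1`.
  set b : ℝ := ((SignType.sign n : ℤ) : ℝ) with hb
  obtain ⟨hi, he⟩ := integral_modelDensity (n / 2) b
  have hc := continuous_modelDensity (n / 2) b
  obtain ⟨H, hH, hdim⟩ := exists_isPauliOperator_densityRadon hc (contDiff_modelPot _ _)
    (laplacian_modelPot (n / 2) b)
  have hflux : HasRegularFlux (densityRadon _ hc) ((n : ℝ) : EReal) :=
    densityRadon_hasRegularFlux hc hi (by rw [he]; ring)
  refine ⟨_, H, hflux, hH, ?_⟩
  have hor := ((zeroModes_of_hasRegularFlux hflux (densityRadon_isReduction hc) hH).2.1 n hn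
    rfl).1
  refine hor.resolve_right fun h => ?_
  have hle : (n.natAbs : ℕ∞) ≤ kernelDim H := by
    rw [hdim]
    have key := le_dimHol fun k (hk : k < n.natAbs) => pow_mem_HolL2_modelPot hk
    rcases lt_or_gt_of_ne hn with h | h
    · refine key.trans (le_trans (le_of_eq ?_) le_self_add)
      have h1 : (n.natAbs : ℝ) = -n := by
        rw [Nat.cast_natAbs, abs_of_neg h, Int.cast_neg]
      rw [h1, hb, sign_neg h]
      congr 2
      · ring
      · simp
    · refine key.trans (le_trans (le_of_eq ?_) le_add_self)
      have h1 : (n.natAbs : ℝ) = n := by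
        rw [Nat.cast_natAbs, abs_of_pos h]
      rw [conjPot_modelPot, h1, hb, sign_pos h]
      simp
  rw [h] at hle
  have := Nat.cast_le.1 hle
  omega

end Models

end PauliMeasure

theorem corollary3p2 :
    (∀ (μ ν : SignedRadon) (Φ : EReal) (H : Spinor →ₗ.[ℂ] Spinor),
      HasRegularFlux μ Φ → μ.IsReduction ν → IsPauliOperator μ H →
        ((∀ n : ℤ, Φ ≠ ((n : ℝ) : EReal)) ∨ Φ = 0 → kernelDim H = ⌊Φ.abs⌋ₑ) ∧
        (∀ n : ℤ, n ≠ 0 → Φ = ((n : ℝ) : EReal) →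
          (kernelDim H = (n.natAbs : ℕ∞) ∨ kernelDim H = ((n.natAbs - 1 : ℕ) : ℕ∞)) ∧
          (ν.CompactlySupported ∨ ν.DefiniteSign →
            kernelDim H = ((n.natAbs - 1 : ℕ) : ℕ∞))) ∧
        KernelHasSpin H ((SignType.sign Φ : ℤ) : ℂ)) ∧
    (∀ n : ℤ, n ≠ 0 →
      (∃ (μ : SignedRadon) (H : Spinor →ₗ.[ℂ] Spinor),
        HasRegularFlux μ ((n : ℝ) : EReal) ∧ IsPauliOperator μ H ∧
          kernelDim H = (n.natAbs : ℕ∞)) ∧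
      (∃ (μ : SignedRadon) (H : Spinor →ₗ.[ℂ] Spinor),
        HasRegularFlux μ ((n : ℝ) : EReal) ∧ IsPauliOperator μ H ∧
          kernelDim H = ((n.natAbs - 1 : ℕ) : ℕ∞))) := by
  exact ⟨fun _ _ _ _ hμ hν hH => zeroModes_of_hasRegularFlux hμ hν hH,
    fun _ hn => ⟨exists_kernelDim_eq_natAbs hn, exists_kernelDim_eq_natAbs_sub_one hn⟩⟩
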